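/- Let $\Delta\ge 2$ and $\nu\ge 1$ be integers and put $d_1=\Delta-1$, $d_2=\Delta+1$. For $z\ne0$ let $\log z$ be the logarithm with $-\frac{3\pi}{2}<\arg z\le\frac{\pi}{2}$, and $z^s=e^{s\log z}$; thus $\log(-z)=\log z-i\pi$ when $\operatorname{Re}z>0$. For $1\le m\le 6$ put $$g^{(m)}(z;s)=z^s\,\frac{\prod_{j=1}^{m}\Gamma(b_j-s)\;\Gamma(1+\nu d_1+s)^3}{\prod_{j=m+1}^{6}\Gamma(1-b_j+s)\;\Gamma(1+\nu d_2-s)^{3}},\qquad (b_1,\dots,b_6)=(0,0,0,\nu,\nu,\nu),$$ the integrand of the Meijer function $G^{(m,3)}_{6,6}(z)=\frac1{2\pi i}\int_L g^{(m)}(z;s)\,ds$ with upper parameters $-\nu d_1$ (three times), $1+\nu d_2$ (three times) and lower parameters $b_1,\dots,b_6$. Let $-1<c<0$, $\tau>0$; let $L_1$ be the broken line $+\infty-i\tau\to c-i\tau\to c+i\tau\to+\infty+i\tau$ and $L_2$ the broken line $-\infty-i\tau\to c-i\tau\to c+i\tau\to-\infty+i\tau$. Put $$f_1(z)=\frac{(-1)^{\nu(\Delta+1)}}{2\pi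 i}\int_{L_1}g^{(1)}(z;s)\,ds\quad(0<|z|\le1),$$ and, for $z\in\Omega_0^*=\{|z|\ge1,\ \operatorname{Re}z>0\}$, $$f_2(z)=-\frac{(-1)^{\nu\Delta}}{2\pi i}\int_{L_2}g^{(4)}(-z;s)\,ds,\quad f_3(z)=\frac{(-1)^{\nu(\Delta+1)}}{2\pi i}\int_{L_2}g^{(5)}(z;s)\,ds,\quad f_5^{\vee}(z)=-\frac{(-1)^{\nu\Delta}}{2\pi i}\int_{L_2}g^{(6)}(-z;s)\,ds.$$ Let $$R_0(t)=\frac{(\nu\Delta)!}{(\nu\Delta-\nu)!}\prod_{\kappa=\nu+1}^{\nu\Delta}(t-\kappa)\prod_{\kappa=0}^{\nu\Delta}\frac1{t+\kappa},\qquad K=\Big(\frac{(\nu\Delta)!}{(\nu d_1)!}\Big)^3,$$ $$f_4(z)=-K^{-1}(-z)^\nu\sum_{t=\nu\Delta+1}^\infty z^{-t}\frac{d}{dt}R_0(t)^3,\qquad f_6(z)=\tfrac12K^{-1}(-z)^\nu\sum_{t=\nu+1}^\infty z^{-t}\frac{d^2}{dt^2}R_0(t)^3,$$ $f_5=f_6+\frac12f_2\,(\log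 z)^2+f_4\log z$, and $f_j^*=Kf_j$. For $0\le k\le\nu\Delta$ put $$\alpha_k=(-1)^{\nu+\nu\Delta+k}\binom{\nu\Delta}{k}^3\binom{\nu\Delta+k}{\nu\Delta-\nu}^3,\qquad \beta_k=\alpha_kS_k,\qquad \gamma_k=\tfrac12\alpha_k\big(S_k^2-T_k\big),$$ $$S_k=3\Big(-\sum_{\kappa=\nu+k+1}^{\nu\Delta+k}\frac1\kappa-\sum_{\kappa=1}^{\nu\Delta-k}\frac1\kappa+\sum_{\kappa=1}^{k}\frac1\kappa\Big),\qquad T_k=3\Big(\sum_{\kappa=\nu+k+1}^{\nu\Delta+k}\frac1{\kappa^2}-\sum_{\kappa=1}^{\nu\Delta-k}\frac1{\kappa^2}-\sum_{\kappa=1}^{k}\frac1{\kappa^2}\Big),$$ let $\alpha^*(z),\beta^*(z),\gamma^*(z)$ be $(-z)^\nu\sum_{k=0}^{\nu\Delta}e_kz^k$ with $e_k=\alpha_k,\beta_k,\gamma_k$ respectively, and $L_n(w)=\sum_{t\ge1}w^tt^{-n}$. Put $$\Phi_{p,q,r;n}(z)=(-z)^\nu\sum_{k=0}^{\nu\Delta}z^k\sum_{t=1}^{k+\nu}z^{-t}\Big(\frac{p\,\alpha_k}{t^{n}}+\frac{q\,\beta_k}{t^{n-1}}+\frac{r\,\gamma_k}{t^{n-2}}\Big),$$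 $\phi^*=\Phi_{1,1,1;3}$, $\psi^*=\Phi_{3,2,1;4}$, $\xi^*=\Phi_{6,3,1;5}$. Then, for all $c,\tau$ as above: 1. The integral for $f_1$ converges absolutely for $0<|z|\le1$, and $f_1$ extends uniquely to an entire function. The extension is a polynomial with rational coefficients, and for all $z\in\mathbb C$ $$f_1(z)=\Big(\frac{(\nu d_1)!}{(\nu\Delta)!}\Big)^3z^\nu(-1)^{\nu\Delta}\sum_{k=0}^{\nu\Delta}(-z)^k\binom{\nu\Delta}{k}^3\binom{\nu\Delta+k}{\nu d_1}^3,\qquad f_1^*(z)=\alpha^*(z).$$ 2. For $t\in\mathbb C\setminus\{0,-1,\dots,-\nu\Delta\}$, $$R_0(t)^3=\sum_{k=0}^{\nu\Delta}\Big(\frac{\alpha_k}{(t+k)^3}+\frac{\beta_k}{(t+k)^2}+\frac{\gamma_k}{t+k}\Big),$$ where $\beta_k=\lim_{t\to-k}\frac{d}{dt}\big(R_0(t)^3(t+k)^3\big)$; moreover $\gamma^*(1)=0$. 3. For $z\in\Omega_0^*$ the integrals for $f_2,f_3,f_5^\vee$ and all series below converge absolutely, and $$f_2(z)=(-1)^\nu\sum_{k=0}^\infty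 z^{-(1+\nu d_1+k)}\left(\frac{\prod_{j=1}^{\nu\Delta-\nu}(1+\nu\Delta-\nu+k-j)}{\prod_{j=0}^{\nu\Delta}(1+\nu\Delta+k+j)}\right)^{3},$$ $$f_2^*(z)=(-z)^\nu\sum_{t=\nu\Delta+1}^\infty z^{-t}R_0(t)^3=(-z)^\nu\sum_{t=\nu+1}^\infty z^{-t}R_0(t)^3,\qquad f_4^*(z)=-(-z)^\nu\sum_{t=\nu+1}^\infty z^{-t}\frac{d}{dt}R_0(t)^3,$$ $$f_3(z)=f_2(z)\log z+f_4(z)=f_2(z)\log z-K^{-1}(-z)^\nu\sum_{t=\nu+1}^\infty z^{-t}\frac{d}{dt}R_0(t)^3,$$ $$f_5^\vee(z)=\tfrac12f_2(z)\big((\log(-z))^2+\pi^2\big)+f_4(z)\log(-z)+\tfrac12K^{-1}(-z)^\nu\sum_{t=\nu\Delta+1}^\infty z^{-t}\frac{d^2}{dt^2}R_0(t)^3,$$ $$f_5^\vee(z)=\tfrac12f_2(z)(\log z)^2+f_4(z)\log z+\tfrac12K^{-1}(-z)^\nu\sum_{t=t_0}^\infty z^{-t}\frac{d^2}{dt^2}R_0(t)^3-\pi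 i f_3(z)\quad\text{for both } t_0=\nu\Delta+1 \text{ and } t_0=\nu+1,$$ $$f_5(z)=f_5^\vee(z)+i\pi f_3(z).$$ 4. For $z\in\Omega_0^*$, with the principal logarithm in $\log(1-1/z)$ and with the term $\gamma^*(z)\log(1-1/z)$ read as $0$ at $z=1$, $$f_2^*(z)=\alpha^*(z)L_3(1/z)+\beta^*(z)L_2(1/z)+\gamma^*(z)\big(-\log(1-1/z)\big)-\phi^*(z),$$ $$f_4^*(z)=3\alpha^*(z)L_4(1/z)+2\beta^*(z)L_3(1/z)+\gamma^*(z)L_2(1/z)-\psi^*(z),$$ $$f_6^*(z)=6\alpha^*(z)L_5(1/z)+3\beta^*(z)L_4(1/z)+\gamma^*(z)L_3(1/z)-\xi^*(z).$$ -/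

import Mathlib

noncomputable section

namespace MeijerAux

/-- The branch of the logarithm with argument in `(-3π/2, π/2]`. -/
def branchLog (z : ℂ) : ℂ := Complex.log (z * Complex.I) - Complex.I * (Real.pi / 2)

/-- The integrand of the Meijer function `G_{p,q}^{(m,n)}(z | a; b)`, where
`z ^ s = exp (s * branchLog z)`. (Mathlib's `Complex.Gamma` is `0` at the poles of `Γ`, so the
inverses below are the values of the entire function `1 / Γ`.) -/
def meijerIntegrand {p q : ℕ} (m n : ℕ) (a : Fin p → ℂ) (b : Fin q → ℂ) (z s : ℂ) : ℂ :=
  Complex.exp (s * branchLog z) *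
    (∏ j : Fin q, if (j : ℕ) < m then Complex.Gamma (b j - s)
      else (Complex.Gamma (1 - b j + s))⁻¹) *
    (∏ j : Fin p, if (j : ℕ) < n then Complex.Gamma (1 - a j + s)
      else (Complex.Gamma (a j - s))⁻¹)

/-- Absolute convergence of the integral over the right loop with abscissa `c` and
half-width `τ`. -/
def RightLoopConverges (g : ℂ → ℂ) (c τ : ℝ) : Prop :=
  MeasureTheory.IntegrableOn (fun x : ℝ => g (x - τ * Complex.I)) (Set.Ici c) ∧
  IntervalIntegrable (fun y : ℝ => g (c + y * Complex.I)) MeasureTheory.volume (-τ) τ ∧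
  MeasureTheory.IntegrableOn (fun x : ℝ => g (x + τ * Complex.I)) (Set.Ici c)

/-- The integral of `g` over the right loop, which runs
`+∞ - iτ → c - iτ → c + iτ → +∞ + iτ`: it goes from `+∞` to `+∞` and encircles
`{Re s > c, |Im s| < τ}` clockwise. -/
def rightLoopIntegral (g : ℂ → ℂ) (c τ : ℝ) : ℂ :=
  -(∫ x in Set.Ici c, g ((x : ℂ) - τ * Complex.I)) +
    Complex.I * (∫ y in (-τ)..τ, g ((c : ℂ) + y * Complex.I)) +
    ∫ x in Set.Ici c, g ((x : ℂ) + τ * Complex.I)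

/-- Absolute convergence of the integral over the left loop with abscissa `c` and
half-width `τ`. -/
def LeftLoopConverges (g : ℂ → ℂ) (c τ : ℝ) : Prop :=
  MeasureTheory.IntegrableOn (fun x : ℝ => g (x - τ * Complex.I)) (Set.Iic c) ∧
  IntervalIntegrable (fun y : ℝ => g (c + y * Complex.I)) MeasureTheory.volume (-τ) τ ∧
  MeasureTheory.IntegrableOn (fun x : ℝ => g (x + τ * Complex.I)) (Set.Iic c)

/-- The integral of `g` over the left loop, which runs
`-∞ - iτ → c - iτ → c + iτ → -∞ + iτ`: it goes from `-∞` to `-∞` and encircles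
`{Re s < c, |Im s| < τ}` counterclockwise. -/
def leftLoopIntegral (g : ℂ → ℂ) (c τ : ℝ) : ℂ :=
  (∫ x in Set.Iic c, g ((x : ℂ) - τ * Complex.I)) +
    Complex.I * (∫ y in (-τ)..τ, g ((c : ℂ) + y * Complex.I)) -
    ∫ x in Set.Iic c, g ((x : ℂ) + τ * Complex.I)

/-- `G_{p,q}^{(m,n)}(z | a; b)`, computed over the right loop. -/
def meijerGRight {p q : ℕ} (m n : ℕ) (a : Fin p → ℂ) (b : Fin q → ℂ) (c τ : ℝ) (z : ℂ) : ℂ :=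
  (2 * Real.pi * Complex.I)⁻¹ * rightLoopIntegral (meijerIntegrand m n a b z) c τ

/-- `G_{p,q}^{(m,n)}(z | a; b)`, computed over the left loop. -/
def meijerGLeft {p q : ℕ} (m n : ℕ) (a : Fin p → ℂ) (b : Fin q → ℂ) (c τ : ℝ) (z : ℂ) : ℂ :=
  (2 * Real.pi * Complex.I)⁻¹ * leftLoopIntegral (meijerIntegrand m n a b z) c τ

/-- The upper parameters `-νd₁` (three times) and `1 + νd₂` (three times), where
`d₁ = Δ - 1` and `d₂ = Δ + 1`. -/
def aPar (Δ ν : ℕ) : Fin 6 → ℂ :=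
  ![-(ν * (Δ - 1)), -(ν * (Δ - 1)), -(ν * (Δ - 1)),
    1 + ν * (Δ + 1), 1 + ν * (Δ + 1), 1 + ν * (Δ + 1)]

/-- The lower parameters `0, 0, 0, ν, ν, ν`. -/
def bPar (ν : ℕ) : Fin 6 → ℂ := ![0, 0, 0, ν, ν, ν]

/-- `f₁` as a contour integral, for `0 < |z| ≤ 1`. -/
def f1Int (Δ ν : ℕ) (c τ : ℝ) (z : ℂ) : ℂ :=
  (-1) ^ (ν * (Δ + 1)) * meijerGRight 1 3 (aPar Δ ν) (bPar ν) c τ z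

def f2 (Δ ν : ℕ) (c τ : ℝ) (z : ℂ) : ℂ :=
  -(-1) ^ (ν * Δ) * meijerGLeft 4 3 (aPar Δ ν) (bPar ν) c τ (-z)

def f3 (Δ ν : ℕ) (c τ : ℝ) (z : ℂ) : ℂ :=
  (-1) ^ (ν * (Δ + 1)) * meijerGLeft 5 3 (aPar Δ ν) (bPar ν) c τ z

/-- The function `f₅^∨`. -/
def f5Vee (Δ ν : ℕ) (c τ : ℝ) (z : ℂ) : ℂ :=
  -(-1) ^ (ν * Δ) * meijerGLeft 6 3 (aPar Δ ν) (bPar ν) c τ (-z)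

/-- The rational function `R₀(t; ν)`. -/
def R0 (Δ ν : ℕ) (t : ℂ) : ℂ :=
  ((ν * Δ).factorial : ℂ) / ((ν * Δ - ν).factorial : ℂ) *
    (∏ κ ∈ Finset.Icc (ν + 1) (ν * Δ), (t - κ)) *
    ∏ κ ∈ Finset.range (ν * Δ + 1), (1 / (t + κ))

/-- The normalizing factor `((νΔ)! / (νd₁)!)³`; `f_j^* = normFactor * f_j`. -/
def normFactor (Δ ν : ℕ) : ℂ :=
  (((ν * Δ).factorial : ℂ) / ((ν * (Δ - 1)).factorial : ℂ)) ^ 3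

/-- The term `z^{-t} (∂/∂t)^j R₀(t; ν)³` at the integer `t`. -/
def derivTerm (Δ ν j : ℕ) (z : ℂ) (t : ℕ) : ℂ :=
  (z ^ t)⁻¹ * iteratedDeriv j (fun u : ℂ => R0 Δ ν u ^ 3) (t : ℂ)

/-- The series `∑_{t ≥ N} z^{-t} (∂/∂t)^j R₀(t; ν)³`. -/
def derivSeries (Δ ν j N : ℕ) (z : ℂ) : ℂ := ∑' k : ℕ, derivTerm Δ ν j z (N + k)

def f4 (Δ ν : ℕ) (z : ℂ) : ℂ :=
  -(normFactor Δ ν)⁻¹ * (-z) ^ ν * derivSeries Δ ν 1 (ν * Δ + 1) z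

def f6 (Δ ν : ℕ) (z : ℂ) : ℂ :=
  1 / 2 * (-z) ^ ν * (normFactor Δ ν)⁻¹ * derivSeries Δ ν 2 (ν + 1) z

def f5 (Δ ν : ℕ) (c τ : ℝ) (z : ℂ) : ℂ :=
  f6 Δ ν z + 1 / 2 * f2 Δ ν c τ z * branchLog z ^ 2 + f4 Δ ν z * branchLog z

/-- The coefficient `α^*_{ν,k}`. -/
def alphaCoeff (Δ ν k : ℕ) : ℂ :=
  (-1) ^ (ν + ν * Δ + k) * ((ν * Δ).choose k : ℂ) ^ 3 * ((ν * Δ + k).choose (ν * Δ - ν) : ℂ) ^ 3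

/-- The coefficient `β^*_{ν,k}`. -/
def betaCoeff (Δ ν k : ℕ) : ℂ :=
  alphaCoeff Δ ν k *
    (3 * (-(∑ κ ∈ Finset.Icc (ν + k + 1) (ν * Δ + k), (κ : ℂ)⁻¹)
      - (∑ κ ∈ Finset.Icc 1 (ν * Δ - k), (κ : ℂ)⁻¹)
      + ∑ κ ∈ Finset.Icc 1 k, (κ : ℂ)⁻¹))

/-- The coefficient `γ^*_{ν,k}`. -/
def gammaCoeff (Δ ν k : ℕ) : ℂ :=
  1 / 2 *
    (alphaCoeff Δ ν k *
      (3 * (-(∑ κ ∈ Finset.Icc (ν + k + 1) (ν * Δ + k), (κ : ℂ)⁻¹)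
        - (∑ κ ∈ Finset.Icc 1 (ν * Δ - k), (κ : ℂ)⁻¹)
        + ∑ κ ∈ Finset.Icc 1 k, (κ : ℂ)⁻¹)) ^ 2
    - alphaCoeff Δ ν k *
      (3 * ((∑ κ ∈ Finset.Icc (ν + k + 1) (ν * Δ + k), ((κ : ℂ) ^ 2)⁻¹)
        - (∑ κ ∈ Finset.Icc 1 (ν * Δ - k), ((κ : ℂ) ^ 2)⁻¹)
        - ∑ κ ∈ Finset.Icc 1 k, ((κ : ℂ) ^ 2)⁻¹)))

/-- `(-z)^ν ∑_{k=0}^{νΔ} e_k z^k`. -/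
def starPoly (Δ ν : ℕ) (e : ℕ → ℂ) (z : ℂ) : ℂ :=
  (-z) ^ ν * ∑ k ∈ Finset.range (ν * Δ + 1), e k * z ^ k

def alphaStar (Δ ν : ℕ) (z : ℂ) : ℂ := starPoly Δ ν (alphaCoeff Δ ν) z

def betaStar (Δ ν : ℕ) (z : ℂ) : ℂ := starPoly Δ ν (betaCoeff Δ ν) z

def gammaStar (Δ ν : ℕ) (z : ℂ) : ℂ := starPoly Δ ν (gammaCoeff Δ ν) z

/-- `(-z)^ν ∑_{k=0}^{νΔ} e_k z^k ∑_{t=1}^{k+ν} z^{-t} t^{-n}`. -/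
def finSum (Δ ν : ℕ) (e : ℕ → ℂ) (n : ℕ) (z : ℂ) : ℂ :=
  (-z) ^ ν * ∑ k ∈ Finset.range (ν * Δ + 1),
    e k * z ^ k * ∑ t ∈ Finset.Icc 1 (k + ν), (z ^ t)⁻¹ * ((t : ℂ) ^ n)⁻¹

/-- The finite sum `φ^*`. -/
def phiStar (Δ ν : ℕ) (z : ℂ) : ℂ :=
  finSum Δ ν (alphaCoeff Δ ν) 3 z + finSum Δ ν (betaCoeff Δ ν) 2 z
    + finSum Δ ν (gammaCoeff Δ ν) 1 z

/-- The finite sum `ψ^*`. -/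
def psiStar (Δ ν : ℕ) (z : ℂ) : ℂ :=
  finSum Δ ν (fun k => 3 * alphaCoeff Δ ν k) 4 z + finSum Δ ν (fun k => 2 * betaCoeff Δ ν k) 3 z
    + finSum Δ ν (gammaCoeff Δ ν) 2 z

/-- The finite sum `ξ^*`. -/
def xiStar (Δ ν : ℕ) (z : ℂ) : ℂ :=
  finSum Δ ν (fun k => 6 * alphaCoeff Δ ν k) 5 z + finSum Δ ν (fun k => 3 * betaCoeff Δ ν k) 4 z
    + finSum Δ ν (gammaCoeff Δ ν) 3 z

/-- The term `w^t / t^n`, with `t = k + 1`, of the polylogarithm series. -/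
def polylogTerm (n : ℕ) (w : ℂ) (k : ℕ) : ℂ := w ^ (k + 1) / ((k + 1 : ℕ) : ℂ) ^ n

/-- The polylogarithm `L_n(w) = ∑_{t ≥ 1} w^t / t^n`. -/
def polylog (n : ℕ) (w : ℂ) : ℂ := ∑' k : ℕ, polylogTerm n w k

end MeijerAux

end

/-!
Off the integers, the reflection formula `Γ(w) Γ(1 - w) = π / sin πw` turns all four integrands
into elementary functions: up to constants they are `z^s R₀(ν - s)³` times `(sin πs / π)²` for
`m = 1` and times `(π / sin πs)^j` for `m = 3 + j` (`meijerIntegrand_eq`). The rational function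
`R₀³` decays quadratically (`R0_cube_isBigO`) and the trigonometric factors are bounded on the
loops, so the integrals converge absolutely and are limits of integrals over the boundaries of
rectangles `[c - n, c] × [-τ, τ]` (`leftLoop_of_isBigO`); the right loop is a reflected left one.

For `m > 3` the large rectangle is cut into unit rectangles, each containing one integer. The pole
there is made simple by integrating by parts: `(π / sin)²` and `(π / sin)³` are derivatives up to a
multiple of `π / sin`, and the derivatives move to `z^s R₀(ν - s)³`, producing the logarithms and
the derivatives of `R₀³` (`rectInt_mul_pi_div_sin_sq`, `rectInt_mul_pi_div_sin_cube`). Summing the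
residues gives the series for `f₂`, `f₃`, `f₅^∨` (`leftLoopIntegral_eq_tsum`); passing from `z` to
`-z` in `f₂` and `f₅^∨` absorbs the sign `(-1)^t`. For `m = 1` the double zeros of `sin²` leave
simple poles at the `νΔ + 1` triple poles of `R₀³`, and the sum of their residues is the polynomial
`α^*` (`rectInt_rightIntegrand`).

The partial fractions of `R₀³` are computed with jets of polynomials: modulo `x³`, a product of
linear factors is governed by its value and the first two power sums of the reciprocals of its
roots, which yields `α_k`, `S_k` and `T_k` (`numPoly_cube`, `R0_cube`). As `t R₀(t)³ → 0`, the
residues `γ_k` add up to `0`. Inserting the partial fractions into the series and shifting indices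
produces the polylogarithms. The only conditionally convergent series, `∑ z^{-t} / t`, is avoided on
`|z| = 1` by proving the identity for `|z| > 1` and passing to the limit; at `z = 1` the zero of
`γ^*` cancels the logarithm (`derivSeries_zero_eq`).
-/

namespace MeijerAux
open Polynomial Finset

/-! ### Partial fractions of `R₀³` -/

/-- `HasJet p f a S T` says that `f ≡ a (1 + S x + (S² - T) / 2 x²)` modulo `x³`, where
`x = X - p`. The parametrization is chosen so that `S` and `T` add up under multiplication: they
are the value at `p` of `f' / f` and of `-(f' / f)'`. -/
def HasJet (p : ℂ) (f : ℂ[X]) (a S T : ℂ) : Prop :=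
  (X - C p) ^ 3 ∣ f - C a * (1 + C S * (X - C p) + C ((S ^ 2 - T) / 2) * (X - C p) ^ 2)

theorem HasJet.mul {p : ℂ} {f g : ℂ[X]} {a S T b S' T' : ℂ} (hf : HasJet p f a S T)
    (hg : HasJet p g b S' T') : HasJet p (f * g) (a * b) (S + S') (T + T') := by
  obtain ⟨u, hu⟩ := hf
  obtain ⟨v, hv⟩ := hg
  rw [sub_eq_iff_eq_add] at hu hv
  have h2 : C (((S + S') ^ 2 - (T + T')) / 2) =
      C ((S ^ 2 - T) / 2) + C ((S' ^ 2 - T') / 2) + C S * C S' := by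
    rw [← C_add, ← C_mul, ← C_add]; congr 1; ring
  unfold HasJet
  rw [h2, hu, hv, C_mul, C_add]
  generalize C ((S ^ 2 - T) / 2) = q
  generalize C ((S' ^ 2 - T') / 2) = q'
  generalize X - C p = x
  refine ⟨u * (x ^ 3 * v + C b * (1 + C S' * x + q' * x ^ 2)) + C a * (1 + C S * x + q * x ^ 2) * v
    + C a * C b * (C S * q' + C S' * q + q * q' * x), ?_⟩
  ring

theorem hasJet_C (p a : ℂ) : HasJet p (C a) a 0 0 := by
  simp [HasJet]

theorem hasJet_X_sub_C {p q : ℂ} (h : p ≠ q) :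
    HasJet p (X - C q) (p - q) (p - q)⁻¹ ((p - q) ^ 2)⁻¹ := by
  have h' : p - q ≠ 0 := sub_ne_zero.2 h
  have : X - C q - C (p - q) * (1 + C (p - q)⁻¹ * (X - C p)
      + C (((p - q)⁻¹ ^ 2 - ((p - q) ^ 2)⁻¹) / 2) * (X - C p) ^ 2) = 0 := by
    rw [inv_pow, sub_self, zero_div, C_0, zero_mul, add_zero, mul_add, ← mul_assoc, ← C_mul,
      mul_inv_cancel₀ h']
    simp
  rw [HasJet, this]
  exact dvd_zero _

theorem HasJet.prod {ι : Type*} {p : ℂ} {f : ι → ℂ[X]} {a S T : ι → ℂ} (s : Finset ι)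
    (h : ∀ i ∈ s, HasJet p (f i) (a i) (S i) (T i)) :
    HasJet p (∏ i ∈ s, f i) (∏ i ∈ s, a i) (∑ i ∈ s, S i) (∑ i ∈ s, T i) := by
  classical
  induction s using Finset.induction_on with
  | empty => simpa using hasJet_C p 1
  | insert i s hi ih =>
    rw [prod_insert hi, prod_insert hi, sum_insert hi, sum_insert hi]
    exact (h i (mem_insert_self i s)).mul (ih fun j hj => h j (mem_insert_of_mem hj))

theorem HasJet.cube {p : ℂ} {f : ℂ[X]} {a S T : ℂ} (h : HasJet p f a S T) :
    HasJet p (f ^ 3) (a ^ 3) (3 * S) (3 * T) := by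
  convert (h.mul h).mul h using 1 <;> ring

/-- Jets divide: the jet of `f / g` is read off from those of `f` and `g`. -/
theorem HasJet.dvd_sub {p : ℂ} {f g : ℂ[X]} {a S T b S' T' r : ℂ} (hf : HasJet p f a S T)
    (hg : HasJet p g b S' T') (hr : r * b = a) :
    (X - C p) ^ 3 ∣ f - (C r + C (r * (S - S')) * (X - C p)
      + C (r * ((S - S') ^ 2 - (T - T')) / 2) * (X - C p) ^ 2) * g := by
  have hq : HasJet p (C r + C (r * (S - S')) * (X - C p)
      + C (r * ((S - S') ^ 2 - (T - T')) / 2) * (X - C p) ^ 2) r (S - S') (T - T') := by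
    refine ⟨0, ?_⟩
    rw [mul_div_assoc]
    simp only [C_mul]
    ring
  have h := hq.mul hg
  rw [hr, sub_add_cancel, sub_add_cancel] at h
  have := _root_.dvd_sub hf h
  rwa [sub_sub_sub_cancel_right] at this

@[to_additive]
theorem prod_erase_range {A : Type*} [CommMonoid A] (f : ℤ → A) {N k : ℕ} (hk : k ≤ N) :
    ∏ κ ∈ (range (N + 1)).erase k, f ((κ : ℤ) - k) =
      (∏ i ∈ Icc 1 (N - k), f i) * ∏ i ∈ Icc 1 k, f (-(i : ℤ)) := by
  have hd : (range (N + 1)).erase k = Icc (k + 1) N ∪ range k := by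
    ext x; simp only [mem_erase, mem_range, mem_union, mem_Icc]; omega
  rw [hd, prod_union]
  · congr 1
    · refine prod_nbij' (fun i => i - k) (fun i => i + k) ?_ ?_ ?_ ?_ ?_
      all_goals intro x hx; simp only [mem_Icc] at *
      · omega
      · omega
      · omega
      · omega
      · congr 1; omega
    · refine prod_nbij' (fun i => k - i) (fun i => k - i) ?_ ?_ ?_ ?_ ?_
      all_goals intro x hx; simp only [mem_Icc, mem_range] at *
      · omega
      · omega
      · omega
      · omega
      · congr 1; omega
  · rw [disjoint_left]; intro x; simp only [mem_Icc, mem_range]; omega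

@[to_additive]
theorem prod_Icc_shift {A : Type*} [CommMonoid A] (f : ℕ → A) (a b k : ℕ) :
    ∏ κ ∈ Icc a b, f (κ + k) = ∏ κ ∈ Icc (a + k) (b + k), f κ := by
  rw [← map_add_right_Icc, prod_map]
  rfl

theorem prod_Icc_cast_mul_factorial {a b : ℕ} (h : a ≤ b) :
    (∏ i ∈ Icc (a + 1) b, (i : ℂ)) * a.factorial = b.factorial := by
  induction b, h using Nat.le_induction with
  | base => simp
  | succ b hb ih =>
    rw [prod_Icc_succ_top (by omega), mul_right_comm, ih, Nat.factorial_succ]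
    push_cast; ring

theorem prod_Icc_cast_eq_factorial (n : ℕ) : ∏ i ∈ Icc 1 n, (i : ℂ) = n.factorial := by
  simpa using prod_Icc_cast_mul_factorial n.zero_le

/-- The value at `-k` of `∏_{κ ≠ k} (t + κ)`. -/
theorem prod_erase_sub {N k : ℕ} (hk : k ≤ N) :
    ∏ κ ∈ (range (N + 1)).erase k, (-(k : ℂ) - -(κ : ℂ)) =
      (-1) ^ k * k.factorial * (N - k).factorial := by
  have h := prod_erase_range (fun i : ℤ => (i : ℂ)) hk
  have h1 : ∀ κ : ℕ, -(k : ℂ) - -(κ : ℂ) = (((κ : ℤ) - k : ℤ) : ℂ) := by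
    intro κ; push_cast; ring
  simp only [h1]
  rw [h]
  push_cast
  rw [prod_neg, prod_Icc_cast_eq_factorial, prod_Icc_cast_eq_factorial, Nat.card_Icc,
    Nat.add_sub_cancel]
  ring

theorem sum_erase_inv {N k : ℕ} (hk : k ≤ N) :
    ∑ κ ∈ (range (N + 1)).erase k, (-(k : ℂ) - -(κ : ℂ))⁻¹ =
      ∑ κ ∈ Icc 1 (N - k), (κ : ℂ)⁻¹ - ∑ κ ∈ Icc 1 k, (κ : ℂ)⁻¹ := by
  have h := sum_erase_range (fun i : ℤ => (i : ℂ)⁻¹) hk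
  have h1 : ∀ κ : ℕ, -(k : ℂ) - -(κ : ℂ) = (((κ : ℤ) - k : ℤ) : ℂ) := by
    intro κ; push_cast; ring
  simp only [h1]
  rw [h]
  push_cast
  simp only [inv_neg, sum_neg_distrib]
  ring

theorem sum_erase_sq_inv {N k : ℕ} (hk : k ≤ N) :
    ∑ κ ∈ (range (N + 1)).erase k, ((-(k : ℂ) - -(κ : ℂ)) ^ 2)⁻¹ =
      ∑ κ ∈ Icc 1 (N - k), ((κ : ℂ) ^ 2)⁻¹ + ∑ κ ∈ Icc 1 k, ((κ : ℂ) ^ 2)⁻¹ := by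
  have h := sum_erase_range (fun i : ℤ => ((i : ℂ) ^ 2)⁻¹) hk
  have h1 : ∀ κ : ℕ, -(k : ℂ) - -(κ : ℂ) = (((κ : ℤ) - k : ℤ) : ℂ) := by
    intro κ; push_cast; ring
  simp only [h1]
  rw [h]
  push_cast
  simp only [neg_sq]

/-- The numerator of `R₀`. -/
noncomputable def numPoly (Δ ν : ℕ) : ℂ[X] :=
  C (((ν * Δ).factorial : ℂ) / ((ν * Δ - ν).factorial : ℂ)) *
    ∏ κ ∈ Icc (ν + 1) (ν * Δ), (X - C (κ : ℂ))

/-- The denominator of `R₀` without its factor `t + k`. -/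
noncomputable def coPoly (Δ ν k : ℕ) : ℂ[X] :=
  ∏ κ ∈ (range (ν * Δ + 1)).erase k, (X - C (-(κ : ℂ)))

theorem hasJet_numPoly (Δ ν k : ℕ) :
    HasJet (-(k : ℂ)) (numPoly Δ ν)
      (((ν * Δ).factorial : ℂ) / ((ν * Δ - ν).factorial : ℂ) *
        ∏ κ ∈ Icc (ν + 1) (ν * Δ), (-(k : ℂ) - κ))
      (-∑ κ ∈ Icc (ν + k + 1) (ν * Δ + k), (κ : ℂ)⁻¹)
      (∑ κ ∈ Icc (ν + k + 1) (ν * Δ + k), ((κ : ℂ) ^ 2)⁻¹) := by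
  have h := (hasJet_C (-(k : ℂ)) (((ν * Δ).factorial : ℂ) / ((ν * Δ - ν).factorial : ℂ))).mul
    (HasJet.prod (p := -(k : ℂ)) (f := fun κ : ℕ => X - C (κ : ℂ)) (Icc (ν + 1) (ν * Δ))
      fun κ hκ => hasJet_X_sub_C (by
        intro h
        have : ((κ + k : ℕ) : ℂ) = 0 := by push_cast; rw [← h]; ring
        rw [Nat.cast_eq_zero] at this
        rw [mem_Icc] at hκ; omega))
  convert h using 1
  · rfl
  · rw [zero_add, show ν + k + 1 = ν + 1 + k by ring,
      ← sum_Icc_shift (fun κ : ℕ => (κ : ℂ)⁻¹), ← sum_neg_distrib]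
    refine sum_congr rfl fun κ _ => ?_
    rw [← inv_neg]; push_cast; congr 1; ring
  · rw [zero_add, show ν + k + 1 = ν + 1 + k by ring,
      ← sum_Icc_shift (fun κ : ℕ => ((κ : ℂ) ^ 2)⁻¹)]
    refine sum_congr rfl fun κ _ => ?_
    push_cast; congr 1; ring

theorem hasJet_coPoly {Δ ν k : ℕ} (hk : k ≤ ν * Δ) :
    HasJet (-(k : ℂ)) (coPoly Δ ν k) ((-1) ^ k * k.factorial * (ν * Δ - k).factorial)
      (∑ κ ∈ Icc 1 (ν * Δ - k), (κ : ℂ)⁻¹ - ∑ κ ∈ Icc 1 k, (κ : ℂ)⁻¹)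
      (∑ κ ∈ Icc 1 (ν * Δ - k), ((κ : ℂ) ^ 2)⁻¹ + ∑ κ ∈ Icc 1 k, ((κ : ℂ) ^ 2)⁻¹) := by
  rw [← prod_erase_sub hk, ← sum_erase_inv hk, ← sum_erase_sq_inv hk]
  refine HasJet.prod _ fun κ hκ => hasJet_X_sub_C fun h => ?_
  rw [neg_inj, Nat.cast_inj] at h
  exact (mem_erase.1 hκ).1 h.symm

/-- The residue-like constant `((t + k) R₀(t))³` at `t = -k` is `α_k`. -/
theorem alphaCoeff_mul {Δ ν k : ℕ} (hν : ν ≤ ν * Δ) (hk : k ≤ ν * Δ) :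
    alphaCoeff Δ ν k * ((-1) ^ k * k.factorial * (ν * Δ - k).factorial) ^ 3 =
      (((ν * Δ).factorial : ℂ) / ((ν * Δ - ν).factorial : ℂ) *
        ∏ κ ∈ Icc (ν + 1) (ν * Δ), (-(k : ℂ) - κ)) ^ 3 := by
  unfold alphaCoeff
  generalize ν * Δ = N at *
  have hs : ∏ κ ∈ Icc (ν + 1) N, (-(k : ℂ) - κ) =
      (-1) ^ (N - ν) * ∏ κ ∈ Icc (ν + k + 1) (N + k), (κ : ℂ) := by
    rw [show ν + k + 1 = ν + 1 + k by ring, ← prod_Icc_shift (fun κ : ℕ => (κ : ℂ))]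
    rw [show N - ν = #(Icc (ν + 1) N) by rw [Nat.card_Icc]; omega, ← prod_neg]
    refine prod_congr rfl fun κ _ => ?_
    push_cast; ring
  have hp := prod_Icc_cast_mul_factorial (show ν + k ≤ N + k by omega)
  have hc1 : (N.choose k : ℂ) * k.factorial * (N - k).factorial = N.factorial := by
    exact_mod_cast Nat.choose_mul_factorial_mul_factorial hk
  have hc2 : ((N + k).choose (N - ν) : ℂ) * (N - ν).factorial * (ν + k).factorial
      = (N + k).factorial := by
    have := Nat.choose_mul_factorial_mul_factorial (show N - ν ≤ N + k by omega)
    rw [show N + k - (N - ν) = ν + k by omega] at this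
    exact_mod_cast this
  have hne : ((N - ν).factorial : ℂ) ≠ 0 := Nat.cast_ne_zero.2 (Nat.factorial_ne_zero _)
  have hne2 : ((ν + k).factorial : ℂ) ≠ 0 := Nat.cast_ne_zero.2 (Nat.factorial_ne_zero _)
  have hprod : ∏ κ ∈ Icc (ν + k + 1) (N + k), (κ : ℂ) =
      (N + k).choose (N - ν) * (N - ν).factorial := by
    apply mul_right_cancel₀ hne2
    rw [hp, ← hc2]
  have h1 : ((-1 : ℂ)) ^ (ν + N + k) = ((-1) ^ (N - ν)) ^ 3 * ((-1) ^ k) := by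
    rw [← pow_mul, ← pow_add]
    rw [neg_one_pow_eq_pow_mod_two, neg_one_pow_eq_pow_mod_two (n := (N - ν) * 3 + k)]
    congr 1; omega
  have h2 : ((-1 : ℂ) ^ k) ^ 4 = 1 := by
    rw [← pow_mul, mul_comm, pow_mul]; norm_num
  rw [hs, hprod, h1, ← hc1]
  field_simp
  linear_combination (N.choose k : ℂ) ^ 3
    * ((N + k).choose (N - ν) : ℂ) ^ 3 * (k.factorial) ^ 3 * ((N - k).factorial) ^ 3 * h2

theorem dvd_numPoly_sub {Δ ν k : ℕ} (hν : ν ≤ ν * Δ) (hk : k ≤ ν * Δ) :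
    (X - C (-(k : ℂ))) ^ 3 ∣ numPoly Δ ν ^ 3 - (C (alphaCoeff Δ ν k)
      + C (betaCoeff Δ ν k) * (X - C (-(k : ℂ)))
      + C (gammaCoeff Δ ν k) * (X - C (-(k : ℂ))) ^ 2) * coPoly Δ ν k ^ 3 := by
  convert (hasJet_numPoly Δ ν k).cube.dvd_sub (hasJet_coPoly hk).cube (alphaCoeff_mul hν hk)
    using 5
  · congr 2
    unfold betaCoeff; ring
  · congr 1
    unfold gammaCoeff; ring

/-- `numPoly ^ 3` is the numerator of the sum of the partial fractions: the difference is divisible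
by the coprime polynomials `(t + k) ^ 3`, and its degree is too small. -/
theorem numPoly_cube {Δ ν : ℕ} (hν : ν ≤ ν * Δ) :
    numPoly Δ ν ^ 3 = ∑ k ∈ range (ν * Δ + 1), (C (alphaCoeff Δ ν k)
      + C (betaCoeff Δ ν k) * (X - C (-(k : ℂ)))
      + C (gammaCoeff Δ ν k) * (X - C (-(k : ℂ))) ^ 2) * coPoly Δ ν k ^ 3 := by
  rw [← sub_eq_zero]
  set D := numPoly Δ ν ^ 3 - ∑ k ∈ range (ν * Δ + 1), (C (alphaCoeff Δ ν k)
      + C (betaCoeff Δ ν k) * (X - C (-(k : ℂ)))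
      + C (gammaCoeff Δ ν k) * (X - C (-(k : ℂ))) ^ 2) * coPoly Δ ν k ^ 3 with hD
  have hdvd : ∏ k ∈ range (ν * Δ + 1), (X - C (-(k : ℂ))) ^ 3 ∣ D := by
    refine Finset.prod_dvd_of_coprime ?_ fun k hk => ?_
    · intro i _ j _ hij
      refine IsCoprime.pow (isCoprime_X_sub_C_of_isUnit_sub ?_)
      rw [isUnit_iff_ne_zero]
      intro h
      apply hij
      have : (i : ℂ) = j := by linear_combination -h
      exact_mod_cast this
    · rw [hD, ← add_sum_erase _ _ hk, ← sub_sub]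
      refine dvd_sub (dvd_numPoly_sub hν (by simpa [Nat.lt_succ_iff] using hk)) ?_
      refine dvd_sum fun j hj => Dvd.dvd.mul_left (pow_dvd_pow_of_dvd ?_ 3) _
      exact dvd_prod_of_mem _ (mem_erase.2 ⟨(mem_erase.1 hj).1.symm, hk⟩)
  have hco : ∀ k ∈ range (ν * Δ + 1), (coPoly Δ ν k).natDegree ≤ ν * Δ := by
    intro k hk
    unfold coPoly
    rw [natDegree_prod_of_monic _ _ fun _ _ => monic_X_sub_C _]
    simp only [natDegree_X_sub_C]
    simp [card_erase_of_mem hk]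
  have hnum : (numPoly Δ ν).natDegree ≤ ν * Δ := by
    refine (natDegree_C_mul_le _ _).trans ?_
    rw [natDegree_prod_of_monic _ _ fun _ _ => monic_X_sub_C _]
    simp only [natDegree_X_sub_C]
    simp
  have hdeg : D.natDegree ≤ 3 * (ν * Δ) + 2 := by
    refine (natDegree_sub_le _ _).trans (max_le ?_ ?_)
    · exact natDegree_pow_le.trans (by omega)
    · refine natDegree_sum_le_of_forall_le _ _ fun k hk => ?_
      refine natDegree_mul_le.trans ?_
      have h1 : (C (alphaCoeff Δ ν k) + C (betaCoeff Δ ν k) * (X - C (-(k : ℂ)))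
          + C (gammaCoeff Δ ν k) * (X - C (-(k : ℂ))) ^ 2).natDegree ≤ 2 := by
        compute_degree
      have h2 : (coPoly Δ ν k ^ 3).natDegree ≤ 3 * (ν * Δ) :=
        natDegree_pow_le.trans (by have := hco k hk; omega)
      omega
  refine eq_zero_of_dvd_of_natDegree_lt hdvd (hdeg.trans_lt ?_)
  rw [natDegree_prod_of_monic _ _ fun _ _ => (monic_X_sub_C _).pow 3]
  simp only [natDegree_pow, natDegree_X_sub_C]
  simp; omega

/-- The elementary sum `∑_{k ≤ νΔ} e_k / (t + k)^n`. -/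
noncomputable def fracSum (Δ ν : ℕ) (e : ℕ → ℂ) (n : ℕ) (t : ℂ) : ℂ :=
  ∑ k ∈ range (ν * Δ + 1), e k * ((t + k) ^ n)⁻¹

theorem R0_cube {Δ ν : ℕ} (hν : ν ≤ ν * Δ) {t : ℂ}
    (ht : ∀ k ∈ range (ν * Δ + 1), t ≠ -(k : ℂ)) :
    R0 Δ ν t ^ 3 = fracSum Δ ν (alphaCoeff Δ ν) 3 t + fracSum Δ ν (betaCoeff Δ ν) 2 t
      + fracSum Δ ν (gammaCoeff Δ ν) 1 t := by
  have hne : ∀ k ∈ range (ν * Δ + 1), t + k ≠ 0 := fun k hk h =>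
    ht k hk (eq_neg_of_add_eq_zero_left h)
  have hQ : ∏ k ∈ range (ν * Δ + 1), (t + k) ≠ 0 := prod_ne_zero_iff.2 hne
  have hR : R0 Δ ν t = (numPoly Δ ν).eval t / ∏ k ∈ range (ν * Δ + 1), (t + k) := by
    simp [R0, numPoly, eval_prod, prod_inv_distrib, div_eq_mul_inv]
  have hco : ∀ k ∈ range (ν * Δ + 1),
      (coPoly Δ ν k).eval t = (∏ k ∈ range (ν * Δ + 1), (t + k)) / (t + k) := by
    intro k hk
    rw [← mul_prod_erase _ _ hk, mul_div_cancel_left₀ _ (hne k hk)]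
    simp [coPoly, eval_prod]
  rw [hR, div_pow, ← eval_pow, numPoly_cube hν, eval_finsetSum, fracSum, fracSum, fracSum,
    ← sum_add_distrib, ← sum_add_distrib, sum_div]
  refine sum_congr rfl fun k hk => ?_
  have := hne k hk
  simp only [eval_mul, eval_add, eval_pow, eval_sub, eval_X, eval_C, sub_neg_eq_add, hco k hk]
  field_simp

end MeijerAux
namespace MeijerAux
open Polynomial Finset

/-! ### Growth of `R₀³` at infinity and its derivatives -/

open Filter Topology Asymptotics Bornology in
theorem R0_cube_isBigO {Δ ν : ℕ} (hν : 0 < ν) (h : ν ≤ ν * Δ) :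
    (fun t => R0 Δ ν t ^ 3) =O[cobounded ℂ] fun t => (‖t‖ ^ 2)⁻¹ := by
  have hone : ∀ a : ℂ, (fun _ : ℂ => a) =O[cobounded ℂ] fun t => t := fun a =>
    (isLittleO_const_left.2 (Or.inr tendsto_norm_cobounded_atTop)).isBigO
  have hsub : ∀ a : ℂ, (fun t : ℂ => t - a) =O[cobounded ℂ] fun t => t := fun a =>
    (isBigO_refl _ _).sub (hone a)
  have hinv : ∀ a : ℂ, (fun t : ℂ => 1 / (t + a)) =O[cobounded ℂ] fun t => t⁻¹ := by
    intro a
    have h1 : (fun t : ℂ => t) =O[cobounded ℂ] fun t => t + a :=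
      (isLittleO_const_left.2 (Or.inr tendsto_norm_cobounded_atTop)).right_isBigO_add'
    simp only [one_div]
    refine h1.inv_rev ?_
    filter_upwards [eventually_ne_cobounded (0 : ℂ)] with t ht h0 using absurd h0 ht
  have hR : R0 Δ ν =O[cobounded ℂ] fun t => (t⁻¹) ^ 1 := by
    have h2 := ((isBigO_const_const (((ν * Δ).factorial : ℂ) / ((ν * Δ - ν).factorial : ℂ))
        (one_ne_zero (α := ℂ)) (cobounded ℂ)).mul
      (IsBigO.finsetProd (s := Icc (ν + 1) (ν * Δ)) fun κ _ => hsub (κ : ℂ))).mul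
      (IsBigO.finsetProd (s := range (ν * Δ + 1)) fun κ _ => hinv (κ : ℂ))
    refine h2.trans (IsBigO.of_bound 1 ?_)
    filter_upwards [(hasBasis_cobounded_norm (E := ℂ)).mem_of_mem (i := 1) trivial] with t ht
    have ht : 1 ≤ ‖t‖ := ht
    have ht0 : t ≠ 0 := norm_pos_iff.1 (by linarith)
    simp only [prod_const, Nat.card_Icc, card_range, one_mul, norm_mul, norm_pow, norm_inv]
    rw [show ν * Δ + 1 - (ν + 1) = ν * Δ - ν by omega,
      show ν * Δ + 1 = (ν * Δ - ν) + (ν + 1) by omega, pow_add, ← mul_assoc, ← mul_pow,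
      mul_inv_cancel₀ (norm_ne_zero_iff.2 ht0), one_pow, one_mul]
    exact pow_le_pow_of_le_one (by positivity) (inv_le_one_of_one_le₀ ht) (by omega)
  refine (hR.pow 3).trans (IsBigO.of_bound 1 ?_)
  filter_upwards [(hasBasis_cobounded_norm (E := ℂ)).mem_of_mem (i := 1) trivial] with t ht
  have ht : 1 ≤ ‖t‖ := ht
  simp only [pow_one, norm_pow, norm_inv, one_mul, norm_norm, ← inv_pow]
  exact pow_le_pow_of_le_one (by positivity) (inv_le_one_of_one_le₀ ht) (by omega)

open Filter Topology Asymptotics Bornology in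
theorem tendsto_natCast_cobounded : Tendsto (fun n : ℕ => (n : ℂ)) atTop (cobounded ℂ) := by
  rw [← tendsto_norm_atTop_iff_cobounded]
  simpa using tendsto_natCast_atTop_atTop (R := ℝ)

open Filter Topology Asymptotics Bornology in
theorem R0_cube_natCast_isBigO {Δ ν : ℕ} (hν : 0 < ν) (h : ν ≤ ν * Δ) :
    (fun n : ℕ => R0 Δ ν n ^ 3) =O[atTop] fun n => ((n : ℝ) ^ 2)⁻¹ := by
  have := (R0_cube_isBigO hν h).comp_tendsto tendsto_natCast_cobounded
  refine this.congr_right fun n => ?_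
  simp

theorem natCast_ne_neg {t : ℕ} (ht : 0 < t) (k : ℕ) : (t : ℂ) ≠ -(k : ℂ) := by
  intro h
  have : ((t + k : ℕ) : ℂ) = 0 := by push_cast; rw [h]; ring
  rw [Nat.cast_eq_zero] at this
  omega

open Filter Topology Asymptotics in
/-- The residues of `R₀³` add up to `0`, because `t R₀(t)³ → 0` as `t → ∞`. -/
theorem sum_gammaCoeff {Δ ν : ℕ} (hν : 0 < ν) (h : ν ≤ ν * Δ) :
    ∑ k ∈ range (ν * Δ + 1), gammaCoeff Δ ν k = 0 := by
  have hinv : Tendsto (fun n : ℕ => ((n : ℂ))⁻¹) atTop (𝓝 0) :=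
    tendsto_inv₀_cobounded.comp tendsto_natCast_cobounded
  have h1 : Tendsto (fun n : ℕ => (n : ℂ) * R0 Δ ν n ^ 3) atTop (𝓝 0) := by
    have hn : (fun n : ℕ => (n : ℂ)) =O[atTop] fun n => (n : ℝ) :=
      IsBigO.of_bound 1 (Eventually.of_forall fun n => by simp)
    refine (hn.mul (R0_cube_natCast_isBigO hν h)).trans_tendsto ?_
    refine (tendsto_inv_atTop_nhds_zero_nat (𝕜 := ℝ)).congr' ?_
    filter_upwards [eventually_gt_atTop 0] with n hn
    have : (n : ℝ) ≠ 0 := by exact_mod_cast hn.ne'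
    field_simp
  have hk : ∀ k : ℕ, Tendsto (fun n : ℕ => ((n : ℂ) + k)⁻¹) atTop (𝓝 0) := fun k => by
    have := hinv.comp (tendsto_add_atTop_nat k)
    refine this.congr fun n => ?_
    simp
  have hf : ∀ (e : ℕ → ℂ) (m : ℕ),
      Tendsto (fun n : ℕ => (n : ℂ) * fracSum Δ ν e (m + 1) n) atTop
        (𝓝 (∑ k ∈ range (ν * Δ + 1), 1 * e k * 0 ^ m)) := by
    intro e m
    simp only [fracSum, mul_sum]
    refine tendsto_finsetSum _ fun k _ => ?_
    refine (((tendsto_natCast_div_add_atTop (k : ℂ)).mul_const (e k)).mul ((hk k).pow m)).congr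
      fun n => ?_
    rw [pow_succ, mul_inv, inv_pow]
    ring
  have h3 := ((hf (alphaCoeff Δ ν) 2).add (hf (betaCoeff Δ ν) 1)).add (hf (gammaCoeff Δ ν) 0)
  have h4 := tendsto_nhds_unique (h1.congr' ?_) h3
  · simpa using h4.symm
  · filter_upwards [eventually_gt_atTop 0] with n hn
    rw [R0_cube h fun k _ => natCast_ne_neg hn k]
    ring

theorem hasDerivAt_fracSum (Δ ν : ℕ) (e : ℕ → ℂ) (n : ℕ) {t : ℂ}
    (ht : ∀ k ∈ range (ν * Δ + 1), t ≠ -(k : ℂ)) :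
    HasDerivAt (fracSum Δ ν e n) (-n * fracSum Δ ν e (n + 1) t) t := by
  unfold fracSum
  rw [mul_sum]
  refine HasDerivAt.fun_sum fun k hk => ?_
  have hne : t + k ≠ 0 := fun h => ht k hk (eq_neg_of_add_eq_zero_left h)
  have := ((((hasDerivAt_id t).add_const (k : ℂ)).pow n).inv (pow_ne_zero n hne)).const_mul (e k)
  refine this.congr_deriv ?_
  rcases n with _ | n
  · simp
  · simp only [id, Nat.add_sub_cancel, Pi.pow_apply]
    field_simp
    ring

/-- The `j`-th derivative of `R₀³`. -/
noncomputable def cubeDeriv (Δ ν j : ℕ) : ℂ → ℂ := iteratedDeriv j fun u => R0 Δ ν u ^ 3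

theorem isOpen_rightHalfPlane : IsOpen {t : ℂ | 0 < t.re} := isOpen_lt continuous_const
  Complex.continuous_re

theorem ne_neg_natCast {t : ℂ} (ht : 0 < t.re) (k : ℕ) : t ≠ -(k : ℂ) := by
  rintro rfl
  simp only [Complex.neg_re, Complex.natCast_re] at ht
  have : (0 : ℝ) ≤ k := k.cast_nonneg
  linarith

theorem differentiableAt_R0 (Δ ν : ℕ) {t : ℂ} (ht : ∀ k ∈ range (ν * Δ + 1), t ≠ -(k : ℂ)) :
    DifferentiableAt ℂ (R0 Δ ν) t := by
  have hne : ∀ k ∈ range (ν * Δ + 1), t + k ≠ 0 := fun k hk h =>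
    ht k hk (eq_neg_of_add_eq_zero_left h)
  unfold R0
  refine ((differentiableAt_const _).mul ?_).mul ?_
  · exact DifferentiableAt.fun_finsetProd fun κ _ => by fun_prop
  · exact DifferentiableAt.fun_finsetProd fun κ hκ =>
      (differentiableAt_const _).div (by fun_prop) (hne κ hκ)

theorem differentiableOn_cubeDeriv (Δ ν j : ℕ) :
    DifferentiableOn ℂ (cubeDeriv Δ ν j) {t : ℂ | 0 < t.re} := by
  induction j with
  | zero =>
    intro t ht
    simp only [cubeDeriv, iteratedDeriv_zero]
    exact ((differentiableAt_R0 Δ ν fun k _ => ne_neg_natCast ht k).pow 3).differentiableWithinAt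
  | succ j ih =>
    simp only [cubeDeriv, iteratedDeriv_succ]
    exact ih.deriv isOpen_rightHalfPlane

theorem hasDerivAt_cubeDeriv (Δ ν j : ℕ) {t : ℂ} (ht : 0 < t.re) :
    HasDerivAt (cubeDeriv Δ ν j) (cubeDeriv Δ ν (j + 1) t) t := by
  have := ((differentiableOn_cubeDeriv Δ ν j).differentiableAt
    (isOpen_rightHalfPlane.mem_nhds ht)).hasDerivAt
  simpa only [cubeDeriv, iteratedDeriv_succ] using this

theorem cubeDeriv_succ_of_eqOn {Δ ν j : ℕ} {f f' : ℂ → ℂ}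
    (h : ∀ t : ℂ, 0 < t.re → cubeDeriv Δ ν j t = f t)
    (hf : ∀ t : ℂ, 0 < t.re → HasDerivAt f (f' t) t) :
    ∀ t : ℂ, 0 < t.re → cubeDeriv Δ ν (j + 1) t = f' t := fun t ht =>
  (hasDerivAt_cubeDeriv Δ ν j ht).unique ((hf t ht).congr_of_eventuallyEq
    (Filter.eventually_of_mem (isOpen_rightHalfPlane.mem_nhds ht) h))

theorem cubeDeriv_zero {Δ ν : ℕ} (h : ν ≤ ν * Δ) (t : ℂ) (ht : 0 < t.re) :
    cubeDeriv Δ ν 0 t = fracSum Δ ν (alphaCoeff Δ ν) 3 t + fracSum Δ ν (betaCoeff Δ ν) 2 t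
      + fracSum Δ ν (gammaCoeff Δ ν) 1 t := by
  rw [cubeDeriv, iteratedDeriv_zero, R0_cube h fun k _ => ne_neg_natCast ht k]

theorem cubeDeriv_one {Δ ν : ℕ} (h : ν ≤ ν * Δ) (t : ℂ) (ht : 0 < t.re) :
    cubeDeriv Δ ν 1 t = -3 * fracSum Δ ν (alphaCoeff Δ ν) 4 t
      - 2 * fracSum Δ ν (betaCoeff Δ ν) 3 t - fracSum Δ ν (gammaCoeff Δ ν) 2 t := by
  refine cubeDeriv_succ_of_eqOn (cubeDeriv_zero h) (f' := fun t =>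
    -3 * fracSum Δ ν (alphaCoeff Δ ν) 4 t - 2 * fracSum Δ ν (betaCoeff Δ ν) 3 t
      - fracSum Δ ν (gammaCoeff Δ ν) 2 t) (fun t ht => ?_) t ht
  have hd := fun e n => hasDerivAt_fracSum Δ ν e n (t := t) fun k _ => ne_neg_natCast ht k
  refine (((hd _ 3).add (hd _ 2)).add (hd _ 1)).congr_deriv ?_
  push_cast; ring

theorem cubeDeriv_two {Δ ν : ℕ} (h : ν ≤ ν * Δ) (t : ℂ) (ht : 0 < t.re) :
    cubeDeriv Δ ν 2 t = 12 * fracSum Δ ν (alphaCoeff Δ ν) 5 t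
      + 6 * fracSum Δ ν (betaCoeff Δ ν) 4 t + 2 * fracSum Δ ν (gammaCoeff Δ ν) 3 t := by
  refine cubeDeriv_succ_of_eqOn (cubeDeriv_one h) (f' := fun t =>
    12 * fracSum Δ ν (alphaCoeff Δ ν) 5 t + 6 * fracSum Δ ν (betaCoeff Δ ν) 4 t
      + 2 * fracSum Δ ν (gammaCoeff Δ ν) 3 t) (fun t ht => ?_) t ht
  have hd := fun e n => hasDerivAt_fracSum Δ ν e n (t := t) fun k _ => ne_neg_natCast ht k
  refine ((((hd _ 4).const_mul (-3)).sub ((hd _ 3).const_mul 2)).sub (hd _ 2)).congr_deriv ?_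
  push_cast; ring

/-- `R₀³` has triple zeros at `t = ν + 1, …, νΔ`. -/
theorem cubeDeriv_eq_zero {Δ ν t j : ℕ} (h1 : ν < t) (h2 : t ≤ ν * Δ) (hj : j ≤ 2) :
    cubeDeriv Δ ν j t = 0 := by
  have ht : 0 < (t : ℂ).re := by simpa using (Nat.zero_le ν).trans_lt h1
  have h0 : R0 Δ ν t = 0 := by
    unfold R0
    rw [prod_eq_zero (mem_Icc.2 ⟨h1, h2⟩) (sub_self _)]
    simp
  have hd : DifferentiableOn ℂ (R0 Δ ν) {t : ℂ | 0 < t.re} := fun t ht =>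
    (differentiableAt_R0 Δ ν fun k _ => ne_neg_natCast ht k).differentiableWithinAt
  have hD : ∀ t : ℂ, 0 < t.re → HasDerivAt (R0 Δ ν) (deriv (R0 Δ ν) t) t := fun t ht =>
    (hd.differentiableAt (isOpen_rightHalfPlane.mem_nhds ht)).hasDerivAt
  have hD2 : ∀ t : ℂ, 0 < t.re → HasDerivAt (deriv (R0 Δ ν)) (deriv (deriv (R0 Δ ν)) t) t :=
    fun t ht => ((hd.deriv isOpen_rightHalfPlane).differentiableAt
      (isOpen_rightHalfPlane.mem_nhds ht)).hasDerivAt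
  have e0 : ∀ t : ℂ, 0 < t.re → cubeDeriv Δ ν 0 t = R0 Δ ν t ^ 3 := fun t _ => by
    rw [cubeDeriv, iteratedDeriv_zero]
  have e1 := cubeDeriv_succ_of_eqOn e0 fun t ht => (hD t ht).pow 3
  have e2 := cubeDeriv_succ_of_eqOn e1 fun t ht => (((hD t ht).pow 2).const_mul _).mul (hD2 t ht)
  interval_cases j
  · rw [e0 _ ht, h0]; simp
  · rw [e1 _ ht, h0]; simp
  · rw [e2 _ ht, Pi.pow_apply, h0]; simp

open Filter Topology in
theorem tendsto_deriv_betaCoeff {Δ ν : ℕ} (h : ν ≤ ν * Δ) {k : ℕ} (hk : k ∈ range (ν * Δ + 1)) :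
    Tendsto (fun t : ℂ => deriv (fun u : ℂ => R0 Δ ν u ^ 3 * (u + k) ^ 3) t)
      (𝓝[≠] (-(k : ℂ))) (𝓝 (betaCoeff Δ ν k)) := by
  -- `Ψ` is the analytic continuation of `R₀(u)³ (u + k)³` to a neighbourhood of `-k`
  set H : ℂ → ℂ := fun u => ∑ j ∈ (range (ν * Δ + 1)).erase k,
    (alphaCoeff Δ ν j * ((u + j) ^ 3)⁻¹ + betaCoeff Δ ν j * ((u + j) ^ 2)⁻¹
      + gammaCoeff Δ ν j * ((u + j) ^ 1)⁻¹) with hH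
  set Ψ : ℂ → ℂ := fun u => alphaCoeff Δ ν k + betaCoeff Δ ν k * (u + k)
    + gammaCoeff Δ ν k * (u + k) ^ 2 + (u + k) ^ 3 * H u with hΨ
  have hid : AnalyticAt ℂ (fun u : ℂ => u) (-(k : ℂ)) := analyticAt_id
  have hlin : ∀ j : ℕ, AnalyticAt ℂ (fun u : ℂ => u + j) (-(k : ℂ)) := fun j =>
    hid.add analyticAt_const
  have hHa : AnalyticAt ℂ H (-(k : ℂ)) := by
    refine Finset.analyticAt_fun_sum _ fun j hj => ?_
    have hne : -(k : ℂ) + j ≠ 0 := fun h0 => (mem_erase.1 hj).1 (by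
      have : (j : ℂ) = k := by linear_combination h0
      exact_mod_cast this)
    exact ((analyticAt_const.mul (((hlin j).pow 3).inv (pow_ne_zero _ hne))).add
      (analyticAt_const.mul (((hlin j).pow 2).inv (pow_ne_zero _ hne)))).add
      (analyticAt_const.mul (((hlin j).pow 1).inv (pow_ne_zero _ hne)))
  have hΨa : AnalyticAt ℂ Ψ (-(k : ℂ)) :=
    ((analyticAt_const.add (analyticAt_const.mul (hlin k))).add
      (analyticAt_const.mul ((hlin k).pow 2))).add (((hlin k).pow 3).mul hHa)
  have hder : HasDerivAt Ψ (betaCoeff Δ ν k) (-(k : ℂ)) := by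
    have hl : HasDerivAt (fun u : ℂ => u + k) 1 (-(k : ℂ)) := (hasDerivAt_id _).add_const _
    refine ((((hasDerivAt_const _ _).add (hl.const_mul _)).add ((hl.pow 2).const_mul _)).add
      ((hl.pow 3).mul hHa.differentiableAt.hasDerivAt)).congr_deriv ?_
    simp
  have hcont : Tendsto (deriv Ψ) (𝓝[≠] (-(k : ℂ))) (𝓝 (betaCoeff Δ ν k)) := by
    have := hΨa.deriv.continuousAt.tendsto
    rw [hder.deriv] at this
    exact this.mono_left nhdsWithin_le_nhds
  refine hcont.congr' ?_
  have heq : ∀ᶠ u in 𝓝[≠] (-(k : ℂ)), Ψ u = R0 Δ ν u ^ 3 * (u + k) ^ 3 := by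
    have hne : ∀ᶠ u in 𝓝[≠] (-(k : ℂ)), ∀ j ∈ range (ν * Δ + 1), u ≠ -(j : ℂ) := by
      refine (Filter.eventually_all_finset _).2 fun j _ => ?_
      by_cases hjk : j = k
      · rw [hjk]; exact self_mem_nhdsWithin
      · refine (eventually_ne_nhds ?_).filter_mono nhdsWithin_le_nhds
        intro h0
        rw [neg_inj, Nat.cast_inj] at h0
        exact hjk h0.symm
    filter_upwards [hne] with u hu
    have huk : u + k ≠ 0 := fun h0 => hu k hk (eq_neg_of_add_eq_zero_left h0)
    rw [R0_cube h hu, fracSum, fracSum, fracSum, ← sum_add_distrib, ← sum_add_distrib,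
      ← add_sum_erase _ _ hk]
    simp only [hΨ, hH]
    field_simp
  have h2 := eventually_eventually_nhdsWithin.2 heq
  filter_upwards [h2, self_mem_nhdsWithin] with t ht htk
  rw [IsOpen.nhdsWithin_eq isOpen_compl_singleton htk] at ht
  exact Filter.EventuallyEq.deriv_eq ht

/-! ### Summability -/

theorem summable_inv_add_pow {z : ℂ} (hz : 1 ≤ ‖z‖) {n : ℕ} (hn : 2 ≤ n) (a k : ℕ) :
    Summable fun i : ℕ => (z ^ (i + 1 + a))⁻¹ * ((((i + 1 + a : ℕ) : ℂ) + k) ^ n)⁻¹ := by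
  refine Summable.of_norm_bounded
    ((summable_nat_add_iff 1).2 (Real.summable_nat_pow_inv.2 one_lt_two)) fun i => ?_
  rw [norm_mul, norm_inv, norm_inv, norm_pow, norm_pow]
  have h1 : (‖z‖ ^ (i + 1 + a))⁻¹ ≤ 1 := inv_le_one_of_one_le₀ (one_le_pow₀ hz)
  have h2 : ((i + 1 : ℕ) : ℝ) ^ 2 ≤ ‖((i + 1 + a : ℕ) : ℂ) + k‖ ^ n := by
    rw [← Nat.cast_add, Complex.norm_natCast]
    norm_cast
    calc (i + 1) ^ 2 ≤ (i + 1) ^ n := Nat.pow_le_pow_right (by omega) hn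
      _ ≤ _ := Nat.pow_le_pow_left (by omega) n
  calc _ ≤ 1 * (((i + 1 : ℕ) : ℝ) ^ 2)⁻¹ := by gcongr
    _ = _ := one_mul _

theorem summable_fracSum {z : ℂ} (hz : 1 ≤ ‖z‖) {n : ℕ} (hn : 2 ≤ n) (Δ ν : ℕ) (e : ℕ → ℂ)
    (a : ℕ) :
    Summable fun i : ℕ => (z ^ (i + 1 + a))⁻¹ * fracSum Δ ν e n ((i + 1 + a : ℕ) : ℂ) := by
  simp only [fracSum, mul_sum]
  refine summable_sum fun k _ => ?_
  refine ((summable_inv_add_pow hz hn a k).mul_left (e k)).congr fun i => ?_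
  ring

open Filter Asymptotics in
theorem summable_derivTerm {Δ ν : ℕ} (hν : 0 < ν) (h : ν ≤ ν * Δ) {z : ℂ} (hz : 1 ≤ ‖z‖) {j : ℕ}
    (hj : j ≤ 2) (N : ℕ) : Summable fun k : ℕ => derivTerm Δ ν j z (N + k) := by
  suffices hs : Summable fun k : ℕ => derivTerm Δ ν j z (k + 1 + 0) by
    have h1 := (summable_nat_add_iff (f := derivTerm Δ ν j z) 1).1 hs
    have h2 := (summable_nat_add_iff (f := derivTerm Δ ν j z) N).2 h1
    exact h2.congr fun k => by rw [add_comm]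
  have hre : ∀ i : ℕ, 0 < ((i + 1 + 0 : ℕ) : ℂ).re := fun i => by
    rw [Complex.natCast_re]; positivity
  have hf := fun e n (hn : 2 ≤ n) => summable_fracSum hz hn Δ ν e 0
  interval_cases j
  · refine summable_of_isBigO_nat
      ((summable_nat_add_iff 1).2 (Real.summable_nat_pow_inv.2 one_lt_two)) ?_
    have hO := (R0_cube_natCast_isBigO hν h).comp_tendsto (tendsto_add_atTop_nat 1)
    refine IsBigO.trans (IsBigO.of_bound 1 (Eventually.of_forall fun i => ?_)) hO
    simp only [derivTerm, iteratedDeriv_zero, norm_mul, norm_inv, norm_pow, Function.comp, add_zero]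
    gcongr
    exact inv_le_one_of_one_le₀ (one_le_pow₀ hz)
  · refine ((((hf (alphaCoeff Δ ν) 4 (by norm_num)).mul_left (-3)).sub
      ((hf (betaCoeff Δ ν) 3 (by norm_num)).mul_left 2)).sub
      (hf (gammaCoeff Δ ν) 2 (by norm_num))).congr fun i => ?_
    have := cubeDeriv_one h _ (hre i)
    rw [cubeDeriv] at this
    rw [derivTerm, this]; ring
  · refine ((((hf (alphaCoeff Δ ν) 5 (by norm_num)).mul_left 12).add
      ((hf (betaCoeff Δ ν) 4 (by norm_num)).mul_left 6)).add
      ((hf (gammaCoeff Δ ν) 3 (by norm_num)).mul_left 2)).congr fun i => ?_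
    have := cubeDeriv_two h _ (hre i)
    rw [cubeDeriv] at this
    rw [derivTerm, this]; ring

/-- The series may start at `ν + 1` or at `νΔ + 1`: the terms in between vanish. -/
theorem derivSeries_eq {Δ ν : ℕ} (hν : 0 < ν) (h : ν ≤ ν * Δ) {z : ℂ} (hz : 1 ≤ ‖z‖) {j : ℕ}
    (hj : j ≤ 2) : derivSeries Δ ν j (ν * Δ + 1) z = derivSeries Δ ν j (ν + 1) z := by
  unfold derivSeries
  rw [← (summable_derivTerm hν h hz hj (ν + 1)).sum_add_tsum_nat_add (ν * Δ - ν),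
    sum_eq_zero, zero_add]
  · refine tsum_congr fun k => ?_
    congr 1; omega
  · intro i hi
    rw [mem_range] at hi
    have := cubeDeriv_eq_zero (Δ := Δ) (show ν < ν + 1 + i by omega) (by omega) hj
    rw [cubeDeriv] at this
    rw [derivTerm, this, mul_zero]

end MeijerAux
namespace MeijerAux
open Set

/-! ### Integrals over the boundary of a rectangle -/

/-- The counterclockwise integral of `g` over the boundary of `[a, b] × [-τ, τ]`. -/
noncomputable def rectInt (g : ℂ → ℂ) (a b τ : ℝ) : ℂ :=
  (∫ x in a..b, g ((x : ℂ) - τ * Complex.I)) +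
    Complex.I * (∫ y in (-τ)..τ, g ((b : ℂ) + y * Complex.I)) -
    (∫ x in a..b, g ((x : ℂ) + τ * Complex.I)) -
    Complex.I * ∫ y in (-τ)..τ, g ((a : ℂ) + y * Complex.I)

/-- The boundary of the rectangle `[a, b] × [-τ, τ]`. -/
def rectFrame (a b τ : ℝ) : Set ℂ :=
  {s | s.re ∈ Icc a b ∧ s.im ∈ Icc (-τ) τ ∧ ((s.im = -τ ∨ s.im = τ) ∨ s.re = a ∨ s.re = b)}

theorem rectFrame_subset (a b τ : ℝ) : rectFrame a b τ ⊆ Icc a b ×ℂ Icc (-τ) τ :=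
  fun _ hs => ⟨hs.1, hs.2.1⟩

section sides

variable {a b τ : ℝ}

theorem bottom_mem (hτ : 0 < τ) {x : ℝ} (hx : x ∈ Icc a b) :
    (x : ℂ) - τ * Complex.I ∈ rectFrame a b τ := by
  have : -τ ≤ τ := by linarith
  simpa [rectFrame, this] using hx

theorem top_mem (hτ : 0 < τ) {x : ℝ} (hx : x ∈ Icc a b) :
    (x : ℂ) + τ * Complex.I ∈ rectFrame a b τ := by
  have : -τ ≤ τ := by linarith
  simpa [rectFrame, this] using hx

theorem left_mem (hab : a ≤ b) {y : ℝ} (hy : y ∈ Icc (-τ) τ) :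
    (a : ℂ) + y * Complex.I ∈ rectFrame a b τ := by
  simpa [rectFrame, hab] using hy

theorem right_mem (hab : a ≤ b) {y : ℝ} (hy : y ∈ Icc (-τ) τ) :
    (b : ℂ) + y * Complex.I ∈ rectFrame a b τ := by
  simpa [rectFrame, hab] using hy

variable {g : ℂ → ℂ}

theorem intervalIntegrable_bottom (hab : a ≤ b) (hτ : 0 < τ)
    (hg : ContinuousOn g (rectFrame a b τ)) :
    IntervalIntegrable (fun x : ℝ => g ((x : ℂ) - τ * Complex.I)) MeasureTheory.volume a b := by
  refine ContinuousOn.intervalIntegrable ?_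
  rw [uIcc_of_le hab]
  exact hg.comp (by fun_prop) fun x hx => bottom_mem hτ hx

theorem intervalIntegrable_top (hab : a ≤ b) (hτ : 0 < τ) (hg : ContinuousOn g (rectFrame a b τ)) :
    IntervalIntegrable (fun x : ℝ => g ((x : ℂ) + τ * Complex.I)) MeasureTheory.volume a b := by
  refine ContinuousOn.intervalIntegrable ?_
  rw [uIcc_of_le hab]
  exact hg.comp (by fun_prop) fun x hx => top_mem hτ hx

theorem intervalIntegrable_left (hab : a ≤ b) (hτ : 0 < τ) (hg : ContinuousOn g (rectFrame a b τ)) :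
    IntervalIntegrable (fun y : ℝ => g ((a : ℂ) + y * Complex.I)) MeasureTheory.volume (-τ) τ := by
  refine ContinuousOn.intervalIntegrable ?_
  rw [uIcc_of_le (by linarith)]
  exact hg.comp (by fun_prop) fun x hx => left_mem hab hx

theorem intervalIntegrable_right (hab : a ≤ b) (hτ : 0 < τ)
    (hg : ContinuousOn g (rectFrame a b τ)) :
    IntervalIntegrable (fun y : ℝ => g ((b : ℂ) + y * Complex.I)) MeasureTheory.volume (-τ) τ := by
  refine ContinuousOn.intervalIntegrable ?_
  rw [uIcc_of_le (by linarith)]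
  exact hg.comp (by fun_prop) fun x hx => right_mem hab hx

theorem rectInt_congr {g' : ℂ → ℂ} (hab : a ≤ b) (hτ : 0 < τ)
    (h : ∀ s ∈ rectFrame a b τ, g s = g' s) : rectInt g a b τ = rectInt g' a b τ := by
  have hτ' : -τ ≤ τ := by linarith
  unfold rectInt
  congr 1; congr 1; congr 1
  · refine intervalIntegral.integral_congr fun x hx => h _ (bottom_mem hτ ?_)
    rwa [uIcc_of_le hab] at hx
  · congr 1
    refine intervalIntegral.integral_congr fun x hx => h _ (right_mem hab ?_)
    rwa [uIcc_of_le hτ'] at hx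
  · refine intervalIntegral.integral_congr fun x hx => h _ (top_mem hτ ?_)
    rwa [uIcc_of_le hab] at hx
  · congr 1
    refine intervalIntegral.integral_congr fun x hx => h _ (left_mem hab ?_)
    rwa [uIcc_of_le hτ'] at hx

theorem rectInt_add {g' : ℂ → ℂ} (hab : a ≤ b) (hτ : 0 < τ)
    (hg : ContinuousOn g (rectFrame a b τ)) (hg' : ContinuousOn g' (rectFrame a b τ)) :
    rectInt (fun s => g s + g' s) a b τ = rectInt g a b τ + rectInt g' a b τ := by
  unfold rectInt
  rw [intervalIntegral.integral_add (intervalIntegrable_bottom hab hτ hg)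
      (intervalIntegrable_bottom hab hτ hg'),
    intervalIntegral.integral_add (intervalIntegrable_top hab hτ hg)
      (intervalIntegrable_top hab hτ hg'),
    intervalIntegral.integral_add (intervalIntegrable_left hab hτ hg)
      (intervalIntegrable_left hab hτ hg'),
    intervalIntegral.integral_add (intervalIntegrable_right hab hτ hg)
      (intervalIntegrable_right hab hτ hg')]
  ring

theorem rectInt_const_mul (c : ℂ) :
    rectInt (fun s => c * g s) a b τ = c * rectInt g a b τ := by
  simp only [rectInt, intervalIntegral.integral_const_mul]
  ring

theorem rectInt_sum {ι : Type*} {f : ι → ℂ → ℂ} (S : Finset ι) (hab : a ≤ b) (hτ : 0 < τ)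
    (hf : ∀ i ∈ S, ContinuousOn (f i) (rectFrame a b τ)) :
    rectInt (fun s => ∑ i ∈ S, f i s) a b τ = ∑ i ∈ S, rectInt (f i) a b τ := by
  classical
  induction S using Finset.induction_on with
  | empty => simp [rectInt]
  | insert i S hi ih =>
    have hS := fun j hj => hf j (Finset.mem_insert_of_mem hj)
    simp only [Finset.sum_insert hi]
    rw [rectInt_add hab hτ (hf i (Finset.mem_insert_self i S)) (continuousOn_finsetSum S hS),
      ih hS]

/-- Adjacent rectangles: the common side cancels. -/
theorem rectInt_add_adjacent {d : ℝ} (hab : a ≤ b) (hbd : b ≤ d) (hτ : 0 < τ)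
    (hg : ContinuousOn g (rectFrame a b τ)) (hg' : ContinuousOn g (rectFrame b d τ)) :
    rectInt g a b τ + rectInt g b d τ = rectInt g a d τ := by
  have h1 := intervalIntegral.integral_add_adjacent_intervals
    (intervalIntegrable_bottom hab hτ hg) (intervalIntegrable_bottom hbd hτ hg')
  have h2 := intervalIntegral.integral_add_adjacent_intervals
    (intervalIntegrable_top hab hτ hg) (intervalIntegrable_top hbd hτ hg')
  unfold rectInt
  rw [← h1, ← h2]
  ring

theorem rectInt_eq_zero_of_differentiableOn (hab : a ≤ b) (hτ : 0 < τ)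
    (hg : DifferentiableOn ℂ g (Icc a b ×ℂ Icc (-τ) τ)) : rectInt g a b τ = 0 := by
  have h := Complex.integral_boundary_rect_eq_zero_of_differentiableOn g
    ((a : ℂ) + (-τ : ℝ) * Complex.I) ((b : ℂ) + τ * Complex.I)
  simp only [Complex.add_re, Complex.ofReal_re, Complex.re_ofReal_mul, Complex.I_re, mul_zero,
    add_zero, Complex.add_im, Complex.ofReal_im, Complex.im_ofReal_mul, Complex.I_im, mul_one,
    zero_add, uIcc_of_le hab, uIcc_of_le (show -τ ≤ τ by linarith), smul_eq_mul] at h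
  rw [← h hg, rectInt]
  push_cast
  simp only [neg_mul, ← sub_eq_add_neg]
  ring

end sides

theorem hasDerivAt_horizontal {F : ℂ → ℂ} {f' w : ℂ} {x : ℝ} (h : HasDerivAt F f' ((x : ℂ) + w)) :
    HasDerivAt (fun x : ℝ => F ((x : ℂ) + w)) f' x := by
  have h1 : HasDerivAt (fun x : ℝ => (x : ℂ) + w) 1 x :=
    (Complex.ofRealCLM.hasDerivAt (x := x)).add_const w
  have h2 := h.scomp x h1
  rw [one_smul] at h2
  exact h2

theorem hasDerivAt_vertical {F : ℂ → ℂ} {f' w : ℂ} {y : ℝ}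
    (h : HasDerivAt F f' (w + y * Complex.I)) :
    HasDerivAt (fun y : ℝ => F (w + y * Complex.I)) (Complex.I * f') y := by
  have h1 : HasDerivAt (fun y : ℝ => w + (y : ℂ) * Complex.I) Complex.I y := by
    simpa using ((Complex.ofRealCLM.hasDerivAt (x := y)).mul_const Complex.I).const_add w
  exact h.scomp y h1

theorem rectInt_eq_zero_of_hasDerivAt {F f : ℂ → ℂ} {a b τ : ℝ} (hab : a ≤ b) (hτ : 0 < τ)
    (hF : ∀ s ∈ rectFrame a b τ, HasDerivAt F (f s) s) (hf : ContinuousOn f (rectFrame a b τ)) :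
    rectInt f a b τ = 0 := by
  have hτ' : -τ ≤ τ := by linarith
  have hB : ∫ x in a..b, f ((x : ℂ) - τ * Complex.I) =
      F (b - τ * Complex.I) - F (a - τ * Complex.I) := by
    refine intervalIntegral.integral_eq_sub_of_hasDerivAt
      (f := fun x : ℝ => F ((x : ℂ) - τ * Complex.I)) (fun x hx => ?_)
      (intervalIntegrable_bottom hab hτ hf)
    rw [uIcc_of_le hab] at hx
    have := hF _ (bottom_mem hτ hx)
    simp only [sub_eq_add_neg] at this ⊢
    exact hasDerivAt_horizontal this
  have hT : ∫ x in a..b, f ((x : ℂ) + τ * Complex.I) =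
      F (b + τ * Complex.I) - F (a + τ * Complex.I) := by
    refine intervalIntegral.integral_eq_sub_of_hasDerivAt
      (f := fun x : ℝ => F ((x : ℂ) + τ * Complex.I)) (fun x hx => ?_)
      (intervalIntegrable_top hab hτ hf)
    rw [uIcc_of_le hab] at hx
    exact hasDerivAt_horizontal (hF _ (top_mem hτ hx))
  have hL : Complex.I * ∫ y in (-τ)..τ, f ((a : ℂ) + y * Complex.I) =
      F (a + τ * Complex.I) - F (a - τ * Complex.I) := by
    rw [← intervalIntegral.integral_const_mul, intervalIntegral.integral_eq_sub_of_hasDerivAt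
      (f := fun y : ℝ => F ((a : ℂ) + y * Complex.I)) (fun y hy => ?_)
      ((intervalIntegrable_left hab hτ hf).const_mul _)]
    · simp [sub_eq_add_neg]
    · rw [uIcc_of_le hτ'] at hy
      exact hasDerivAt_vertical (hF _ (left_mem hab hy))
  have hR : Complex.I * ∫ y in (-τ)..τ, f ((b : ℂ) + y * Complex.I) =
      F (b + τ * Complex.I) - F (b - τ * Complex.I) := by
    rw [← intervalIntegral.integral_const_mul, intervalIntegral.integral_eq_sub_of_hasDerivAt
      (f := fun y : ℝ => F ((b : ℂ) + y * Complex.I)) (fun y hy => ?_)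
      ((intervalIntegrable_right hab hτ hf).const_mul _)]
    · simp [sub_eq_add_neg]
    · rw [uIcc_of_le hτ'] at hy
      exact hasDerivAt_vertical (hF _ (right_mem hab hy))
  rw [rectInt, hB, hT, hL, hR]
  ring

theorem ne_of_mem_rectFrame {a b τ p : ℝ} (hap : a < p) (hpb : p < b) (hτ : 0 < τ) {s : ℂ}
    (hs : s ∈ rectFrame a b τ) : s ≠ p := by
  rintro rfl
  obtain ⟨-, -, (h | h) | h | h⟩ := hs
  all_goals simp only [Complex.ofReal_im, Complex.ofReal_re] at h; linarith

theorem continuousOn_inv_sub {a b τ p : ℝ} (hap : a < p) (hpb : p < b) (hτ : 0 < τ) :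
    ContinuousOn (fun s : ℂ => (s - p)⁻¹) (rectFrame a b τ) :=
  ContinuousOn.inv₀ (by fun_prop) fun _ hs => sub_ne_zero.2 (ne_of_mem_rectFrame hap hpb hτ hs)

/-- The principal logarithm is a primitive of `1 / s` on three of the sides, and `log (-s)` is one
on the left side; the two jumps add up to `2πi`. -/
theorem rectInt_inv_sub {a b τ p : ℝ} (hap : a < p) (hpb : p < b) (hτ : 0 < τ) :
    rectInt (fun s : ℂ => (s - p)⁻¹) a b τ = 2 * Real.pi * Complex.I := by
  have hab : a ≤ b := (hap.trans hpb).le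
  have hτ' : -τ ≤ τ := by linarith
  have hc := continuousOn_inv_sub hap hpb hτ
  have hlog : ∀ s : ℂ, (p < s.re ∨ s.im ≠ 0) →
      HasDerivAt (fun s => Complex.log (s - p)) (s - p)⁻¹ s := fun s hs => by
    have hsl : s - (p : ℂ) ∈ Complex.slitPlane := by
      rcases hs with h | h
      · left; simpa using h
      · right; simpa using h
    simpa using ((hasDerivAt_id s).sub_const (p : ℂ)).clog hsl
  have hlog' : ∀ s : ℂ, s.re < p → HasDerivAt (fun s => Complex.log (p - s)) (s - p)⁻¹ s :=
      fun s hs => by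
    have hsl : (p : ℂ) - s ∈ Complex.slitPlane := by left; simpa using hs
    have := ((hasDerivAt_id s).const_sub (p : ℂ)).clog hsl
    refine this.congr_deriv ?_
    rw [id, neg_div, ← div_neg, neg_sub, one_div]
  have hB : ∫ x in a..b, ((x : ℂ) - τ * Complex.I - p)⁻¹ =
      Complex.log (b - τ * Complex.I - p) - Complex.log (a - τ * Complex.I - p) := by
    refine intervalIntegral.integral_eq_sub_of_hasDerivAt
      (f := fun x : ℝ => Complex.log ((x : ℂ) - τ * Complex.I - p)) (fun x hx => ?_)
      (intervalIntegrable_bottom hab hτ hc)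
    have := hlog ((x : ℂ) - τ * Complex.I) (Or.inr (by simpa using hτ.ne'))
    rw [sub_eq_add_neg (x : ℂ)] at this
    simpa only [← sub_eq_add_neg] using hasDerivAt_horizontal this
  have hT : ∫ x in a..b, ((x : ℂ) + τ * Complex.I - p)⁻¹ =
      Complex.log (b + τ * Complex.I - p) - Complex.log (a + τ * Complex.I - p) := by
    refine intervalIntegral.integral_eq_sub_of_hasDerivAt
      (f := fun x : ℝ => Complex.log ((x : ℂ) + τ * Complex.I - p)) (fun x hx => ?_)
      (intervalIntegrable_top hab hτ hc)
    exact hasDerivAt_horizontal (hlog ((x : ℂ) + τ * Complex.I) (Or.inr (by simpa using hτ.ne')))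
  have hL : Complex.I * ∫ y in (-τ)..τ, ((a : ℂ) + y * Complex.I - p)⁻¹ =
      Complex.log (p - (a + τ * Complex.I)) - Complex.log (p - (a - τ * Complex.I)) := by
    rw [← intervalIntegral.integral_const_mul, intervalIntegral.integral_eq_sub_of_hasDerivAt
      (f := fun y : ℝ => Complex.log (p - ((a : ℂ) + y * Complex.I))) (fun y hy => ?_)
      ((intervalIntegrable_left hab hτ hc).const_mul _)]
    · simp [sub_eq_add_neg]
    · exact hasDerivAt_vertical (hlog' _ (by simpa using hap))
  have hR : Complex.I * ∫ y in (-τ)..τ, ((b : ℂ) + y * Complex.I - p)⁻¹ =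
      Complex.log (b + τ * Complex.I - p) - Complex.log (b - τ * Complex.I - p) := by
    rw [← intervalIntegral.integral_const_mul, intervalIntegral.integral_eq_sub_of_hasDerivAt
      (f := fun y : ℝ => Complex.log ((b : ℂ) + y * Complex.I - p)) (fun y hy => ?_)
      ((intervalIntegrable_right hab hτ hc).const_mul _)]
    · simp [sub_eq_add_neg]
    · exact hasDerivAt_vertical (hlog _ (Or.inl (by simpa using hpb)))
  have j1 : Complex.log (-((a : ℂ) + τ * Complex.I - p)) =
      Complex.log (a + τ * Complex.I - p) - Real.pi * Complex.I := by
    rw [Complex.log, Complex.log, norm_neg, Complex.arg_neg_eq_arg_sub_pi_of_im_pos (by simpa)]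
    push_cast; ring
  have j2 : Complex.log (-((a : ℂ) - τ * Complex.I - p)) =
      Complex.log (a - τ * Complex.I - p) + Real.pi * Complex.I := by
    rw [Complex.log, Complex.log, norm_neg, Complex.arg_neg_eq_arg_add_pi_of_im_neg (by simpa)]
    push_cast; ring
  rw [neg_sub] at j1 j2
  rw [rectInt, hB, hT, hL, hR, j1, j2]
  ring

/-- Cauchy's integral formula on a rectangle. -/
theorem rectInt_div_sub {k : ℂ → ℂ} {a b τ p : ℝ} (hap : a < p) (hpb : p < b) (hτ : 0 < τ)
    (hk : DifferentiableOn ℂ k (Icc a b ×ℂ Icc (-τ) τ)) :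
    rectInt (fun s => k s * (s - p)⁻¹) a b τ = 2 * Real.pi * Complex.I * k p := by
  have hab : a ≤ b := (hap.trans hpb).le
  have hnhds : Icc a b ×ℂ Icc (-τ) τ ∈ nhds (p : ℂ) := by
    rw [mem_nhds_iff]
    refine ⟨Ioo a b ×ℂ Ioo (-τ) τ, fun s hs => ⟨Ioo_subset_Icc_self hs.1, Ioo_subset_Icc_self hs.2⟩,
      isOpen_Ioo.reProdIm isOpen_Ioo, ?_⟩
    simp [Complex.mem_reProdIm, hap, hpb, hτ]
  have hd : DifferentiableOn ℂ (dslope k p) (Icc a b ×ℂ Icc (-τ) τ) :=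
    (Complex.differentiableOn_dslope hnhds).2 hk
  have h1 : rectInt (fun s => k s * (s - p)⁻¹) a b τ =
      rectInt (fun s => k p * (s - p)⁻¹ + dslope k p s) a b τ := by
    refine rectInt_congr hab hτ fun s hs => ?_
    have hne := ne_of_mem_rectFrame hap hpb hτ hs
    have := sub_ne_zero.2 hne
    rw [dslope_of_ne _ hne, slope_def_field]
    field_simp
    ring
  rw [h1, rectInt_add hab hτ ((continuousOn_inv_sub hap hpb hτ).const_mul _)
    (hd.continuousOn.mono (rectFrame_subset a b τ)), rectInt_const_mul, rectInt_inv_sub hap hpb hτ,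
    rectInt_eq_zero_of_differentiableOn hab hτ hd]
  ring

/-! ### Residues of `h(s) (π / sin πs)^j` -/

/-- `sin (πs) / (s - p)`, for `p` an integer, as an entire function. -/
noncomputable def sinQuot (p : ℂ) : ℂ → ℂ := dslope (fun s => Complex.sin (Real.pi * s)) p

theorem differentiable_sinQuot (p : ℂ) : Differentiable ℂ (sinQuot p) := by
  rw [← differentiableOn_univ, sinQuot, Complex.differentiableOn_dslope Filter.univ_mem]
  fun_prop

theorem sinQuot_self (p : ℂ) : sinQuot p p = Real.pi * Complex.cos (Real.pi * p) := by
  rw [sinQuot, dslope_same]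
  have h : HasDerivAt (fun s : ℂ => Complex.sin (Real.pi * s))
      (Complex.cos (Real.pi * p) * (Real.pi * 1)) p := ((hasDerivAt_id p).const_mul _).csin
  rw [h.deriv]; ring

theorem sin_pi_mul_intCast (m : ℤ) : Complex.sin (Real.pi * m) = 0 := by
  rw [mul_comm]; exact Complex.sin_int_mul_pi m

theorem sinQuot_mul_sub (m : ℤ) (s : ℂ) : sinQuot m s * (s - m) = Complex.sin (Real.pi * s) := by
  rw [mul_comm, ← smul_eq_mul, sinQuot, sub_smul_dslope, sin_pi_mul_intCast, sub_zero]

theorem cos_pi_mul_intCast_sq (m : ℤ) : Complex.cos (Real.pi * m) ^ 2 = 1 := by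
  rw [Complex.cos_sq', sin_pi_mul_intCast]; simp

theorem sin_pi_mul_eq_zero {s : ℂ} (h : Complex.sin (Real.pi * s) = 0) : ∃ m : ℤ, s = m := by
  obtain ⟨m, hm⟩ := Complex.sin_eq_zero_iff.1 h
  refine ⟨m, mul_left_cancel₀ (Complex.ofReal_ne_zero.2 Real.pi_ne_zero) ?_⟩
  rw [hm, mul_comm]

section residues

variable {h h₁ h₂ : ℂ → ℂ} {a b τ : ℝ} {m : ℤ}

theorem sin_pi_mul_ne_zero (h1 : (m : ℝ) - 1 < a) (h2 : b < m + 1) {s : ℂ} (hre : s.re ∈ Icc a b)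
    (hs : s ≠ m) : Complex.sin (Real.pi * s) ≠ 0 := by
  intro h0
  obtain ⟨n, rfl⟩ := sin_pi_mul_eq_zero h0
  rw [Complex.intCast_re, mem_Icc] at hre
  have h3 : m - 1 < n := by exact_mod_cast h1.trans_le hre.1
  have h4 : n < m + 1 := by exact_mod_cast hre.2.trans_lt h2
  exact hs (by congr 1; omega)

theorem sinQuot_ne_zero (h1 : (m : ℝ) - 1 < a) (h2 : b < m + 1) {s : ℂ} (hre : s.re ∈ Icc a b) :
    sinQuot m s ≠ 0 := by
  by_cases hs : s = m
  · rw [hs, sinQuot_self]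
    refine mul_ne_zero (Complex.ofReal_ne_zero.2 Real.pi_ne_zero) fun h0 => ?_
    simpa [h0] using cos_pi_mul_intCast_sq m
  · intro h0
    have := sinQuot_mul_sub m s
    rw [h0, zero_mul] at this
    exact sin_pi_mul_ne_zero h1 h2 hre hs this.symm

theorem rectInt_mul_pi_div_sin (h1 : (m : ℝ) - 1 < a) (ham : a < m) (hmb : m < b) (h2 : b < m + 1)
    (hτ : 0 < τ) (hh : DifferentiableOn ℂ h (Icc a b ×ℂ Icc (-τ) τ)) :
    rectInt (fun s => h s * (Real.pi / Complex.sin (Real.pi * s))) a b τ =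
      2 * Real.pi * Complex.I * (Complex.cos (Real.pi * m) * h m) := by
  have hk : DifferentiableOn ℂ (fun s => h s * (Real.pi / sinQuot m s))
      (Icc a b ×ℂ Icc (-τ) τ) := fun s hs => (hh s hs).mul
    (((differentiableAt_const _).div (differentiable_sinQuot m s)
      (sinQuot_ne_zero h1 h2 hs.1)).differentiableWithinAt)
  have h3 := rectInt_div_sub ham hmb hτ hk
  rw [Complex.ofReal_intCast, sinQuot_self] at h3
  have hcos : Complex.cos (Real.pi * m) ≠ 0 := fun h0 => by
    simpa [h0] using cos_pi_mul_intCast_sq m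
  have hpi : (Real.pi : ℂ) ≠ 0 := Complex.ofReal_ne_zero.2 Real.pi_ne_zero
  have h4 : h m * (Real.pi / (Real.pi * Complex.cos (Real.pi * m))) =
      Complex.cos (Real.pi * m) * h m := by
    field_simp
    rw [cos_pi_mul_intCast_sq]; ring
  rw [h4] at h3
  rw [← h3]
  refine rectInt_congr (ham.trans hmb).le hτ fun s hs => ?_
  rw [← sinQuot_mul_sub m s]
  simp only [div_eq_mul_inv, mul_inv]
  ring

theorem sin_ne_zero_of_mem_rectFrame (h1 : (m : ℝ) - 1 < a) (ham : a < m) (hmb : m < b)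
    (h2 : b < m + 1) (hτ : 0 < τ) {s : ℂ} (hs : s ∈ rectFrame a b τ) :
    Complex.sin (Real.pi * s) ≠ 0 :=
  sin_pi_mul_ne_zero h1 h2 hs.1 (by simpa using ne_of_mem_rectFrame ham hmb hτ hs)

theorem hasDerivAt_sin_pi_mul (s : ℂ) : HasDerivAt (fun s : ℂ => Complex.sin (Real.pi * s))
    (Real.pi * Complex.cos (Real.pi * s)) s := by
  have h : HasDerivAt (fun s : ℂ => Complex.sin (Real.pi * s))
    (Complex.cos (Real.pi * s) * (Real.pi * 1)) s := ((hasDerivAt_id s).const_mul _).csin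
  exact h.congr_deriv (by ring)

theorem hasDerivAt_cos_pi_mul (s : ℂ) : HasDerivAt (fun s : ℂ => Complex.cos (Real.pi * s))
    (-Real.pi * Complex.sin (Real.pi * s)) s := by
  have h : HasDerivAt (fun s : ℂ => Complex.cos (Real.pi * s))
    (-Complex.sin (Real.pi * s) * (Real.pi * 1)) s := ((hasDerivAt_id s).const_mul _).ccos
  exact h.congr_deriv (by ring)

/-- Integration by parts with `(π / sin πs)² = -(π cot πs)'` leaves a simple pole. -/
theorem rectInt_mul_pi_div_sin_sq (h1 : (m : ℝ) - 1 < a) (ham : a < m) (hmb : m < b)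
    (h2 : b < m + 1) (hτ : 0 < τ) (hh : ∀ s ∈ Icc a b ×ℂ Icc (-τ) τ, HasDerivAt h (h₁ s) s)
    (hh₁ : DifferentiableOn ℂ h₁ (Icc a b ×ℂ Icc (-τ) τ)) :
    rectInt (fun s => h s * (Real.pi / Complex.sin (Real.pi * s)) ^ 2) a b τ =
      2 * Real.pi * Complex.I * h₁ m := by
  have hab := (ham.trans hmb).le
  have hs0 := fun s hs => sin_ne_zero_of_mem_rectFrame h1 ham hmb h2 hτ (s := s) hs
  have hsub := rectFrame_subset a b τ
  have hcinv : ContinuousOn (fun s : ℂ => Real.pi / Complex.sin (Real.pi * s)) (rectFrame a b τ) :=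
    ContinuousOn.div (by fun_prop) (by fun_prop) hs0
  have hc : ContinuousOn h (rectFrame a b τ) := fun s hs =>
    (hh s (hsub hs)).continuousAt.continuousWithinAt
  have hk : DifferentiableOn ℂ (fun s => h₁ s * Complex.cos (Real.pi * s))
      (Icc a b ×ℂ Icc (-τ) τ) := hh₁.mul (by fun_prop)
  have hA : ContinuousOn (fun s => h₁ s * Complex.cos (Real.pi * s) *
      (Real.pi / Complex.sin (Real.pi * s))) (rectFrame a b τ) :=
    (hk.continuousOn.mono hsub).mul hcinv
  have hB : ContinuousOn (fun s => (-1) * (h s * (Real.pi / Complex.sin (Real.pi * s)) ^ 2))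
      (rectFrame a b τ) := (hc.mul (hcinv.pow 2)).const_smul (-1 : ℂ)
  have hzero := rectInt_eq_zero_of_hasDerivAt (F := fun s => h s *
      (Complex.cos (Real.pi * s) * (Real.pi / Complex.sin (Real.pi * s))))
    (f := fun s => h₁ s * Complex.cos (Real.pi * s) * (Real.pi / Complex.sin (Real.pi * s)) +
      (-1) * (h s * (Real.pi / Complex.sin (Real.pi * s)) ^ 2)) hab hτ (fun s hs => ?_)
    (hA.add hB)
  · rw [rectInt_add hab hτ hA hB, rectInt_mul_pi_div_sin h1 ham hmb h2 hτ hk,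
      rectInt_const_mul] at hzero
    linear_combination -hzero + 2 * Real.pi * Complex.I * h₁ m * cos_pi_mul_intCast_sq m
  · have hne := hs0 s hs
    refine ((hh s (hsub hs)).mul ((hasDerivAt_cos_pi_mul s).mul
      ((hasDerivAt_const s (Real.pi : ℂ)).div (hasDerivAt_sin_pi_mul s) hne))).congr_deriv ?_
    simp only [Pi.mul_apply, Pi.div_apply]
    field_simp
    have := Complex.sin_sq_add_cos_sq (Real.pi * s)
    linear_combination -h s * Real.pi ^ 2 * this

/-- Integration by parts with `2 (π / sin πs)³ = (π / sin πs)'' + π² (π / sin πs)` leaves a simple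
pole. -/
theorem rectInt_mul_pi_div_sin_cube (h1 : (m : ℝ) - 1 < a) (ham : a < m) (hmb : m < b)
    (h2 : b < m + 1) (hτ : 0 < τ) (hh : ∀ s ∈ Icc a b ×ℂ Icc (-τ) τ, HasDerivAt h (h₁ s) s)
    (hh₁ : ∀ s ∈ Icc a b ×ℂ Icc (-τ) τ, HasDerivAt h₁ (h₂ s) s)
    (hh₂ : DifferentiableOn ℂ h₂ (Icc a b ×ℂ Icc (-τ) τ)) :
    rectInt (fun s => h s * (Real.pi / Complex.sin (Real.pi * s)) ^ 3) a b τ =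
      2 * Real.pi * Complex.I *
        (Complex.cos (Real.pi * m) * (1 / 2 * (h₂ m + Real.pi ^ 2 * h m))) := by
  have hab := (ham.trans hmb).le
  have hs0 := fun s hs => sin_ne_zero_of_mem_rectFrame h1 ham hmb h2 hτ (s := s) hs
  have hsub := rectFrame_subset a b τ
  have hcinv : ContinuousOn (fun s : ℂ => Real.pi / Complex.sin (Real.pi * s)) (rectFrame a b τ) :=
    ContinuousOn.div (by fun_prop) (by fun_prop) hs0
  have hd : DifferentiableOn ℂ h (Icc a b ×ℂ Icc (-τ) τ) := fun s hs =>
    (hh s hs).differentiableAt.differentiableWithinAt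
  have hk : DifferentiableOn ℂ (fun s => h₂ s + Real.pi ^ 2 * h s)
      (Icc a b ×ℂ Icc (-τ) τ) := hh₂.add (hd.const_mul _)
  have hA : ContinuousOn (fun s => (h₂ s + Real.pi ^ 2 * h s) *
      (Real.pi / Complex.sin (Real.pi * s))) (rectFrame a b τ) :=
    (hk.continuousOn.mono hsub).mul hcinv
  have hB : ContinuousOn (fun s => (-2) * (h s * (Real.pi / Complex.sin (Real.pi * s)) ^ 3))
      (rectFrame a b τ) :=
    ((hd.continuousOn.mono hsub).mul (hcinv.pow 3)).const_smul (-2 : ℂ)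
  have hzero := rectInt_eq_zero_of_hasDerivAt (F := fun s => h₁ s *
      (Real.pi / Complex.sin (Real.pi * s)) + h s * Complex.cos (Real.pi * s) *
      (Real.pi / Complex.sin (Real.pi * s)) ^ 2)
    (f := fun s => (h₂ s + Real.pi ^ 2 * h s) * (Real.pi / Complex.sin (Real.pi * s)) +
      (-2) * (h s * (Real.pi / Complex.sin (Real.pi * s)) ^ 3)) hab hτ (fun s hs => ?_)
    (hA.add hB)
  · rw [rectInt_add hab hτ hA hB, rectInt_mul_pi_div_sin h1 ham hmb h2 hτ hk,
      rectInt_const_mul] at hzero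
    linear_combination (-1 / 2) * hzero
  · have hne := hs0 s hs
    have hq := (hasDerivAt_const s (Real.pi : ℂ)).div (hasDerivAt_sin_pi_mul s) hne
    refine (((hh₁ s (hsub hs)).mul hq).add (((hh s (hsub hs)).mul (hasDerivAt_cos_pi_mul s)).mul
      (hq.pow 2))).congr_deriv ?_
    simp only [Pi.mul_apply, Pi.div_apply, Pi.pow_apply]
    field_simp
    have := Complex.sin_sq_add_cos_sq (Real.pi * s)
    have hinv := mul_inv_cancel₀ hne
    linear_combination (-2 * Real.pi ^ 3 * Complex.cos (Real.pi * s) ^ 2 * h s) * hinv -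
      2 * Real.pi ^ 3 * h s * this

end residues

end MeijerAux
namespace MeijerAux
open Set Filter Topology Asymptotics Bornology MeasureTheory

/-! ### Loop integrals as limits of rectangle integrals -/

/-- The half-line sides of the left loop of abscissa `c` and half-width `τ`, together with the
vertical segments of abscissas `c, c - 1, c - 2, …` between them. -/
def loopGrid (c τ : ℝ) : Set ℂ :=
  {s | s.re ≤ c ∧ s.im ∈ Icc (-τ) τ ∧ ((s.im = -τ ∨ s.im = τ) ∨ ∃ n : ℕ, s.re = c - n)}

theorem rectFrame_subset_loopGrid {c τ : ℝ} {m n : ℕ} :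
    rectFrame (c - m) (c - n) τ ⊆ loopGrid c τ := by
  rintro s ⟨h1, h2, h3⟩
  refine ⟨h1.2.trans (sub_le_self _ n.cast_nonneg), h2, h3.imp id fun h => ?_⟩
  exact h.elim (fun h => ⟨m, h⟩) fun h => ⟨n, h⟩

section grid

variable {c τ : ℝ}

theorem grid_bottom (hτ : 0 < τ) {x : ℝ} (hx : x ≤ c) :
    (x : ℂ) - τ * Complex.I ∈ loopGrid c τ := by
  have : -τ ≤ τ := by linarith
  simp [loopGrid, this, hx]

theorem grid_top (hτ : 0 < τ) {x : ℝ} (hx : x ≤ c) :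
    (x : ℂ) + τ * Complex.I ∈ loopGrid c τ := by
  have : -τ ≤ τ := by linarith
  simp [loopGrid, this, hx]

theorem grid_vertical (n : ℕ) {y : ℝ} (hy : y ∈ Icc (-τ) τ) :
    (c : ℂ) - n + y * Complex.I ∈ loopGrid c τ := by
  refine ⟨by simp, by simpa using hy, Or.inr ⟨n, by simp⟩⟩

theorem grid_right {y : ℝ} (hy : y ∈ Icc (-τ) τ) : (c : ℂ) + y * Complex.I ∈ loopGrid c τ := by
  simpa using grid_vertical (c := c) 0 hy

variable {g g' : ℂ → ℂ}

/-- The left loop integral depends only on the values of the integrand on the loop. -/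
theorem leftLoopIntegral_congr (hτ : 0 < τ) (h : ∀ s ∈ loopGrid c τ, g s = g' s) :
    leftLoopIntegral g c τ = leftLoopIntegral g' c τ := by
  unfold leftLoopIntegral
  congr 1; congr 1
  · exact setIntegral_congr_fun measurableSet_Iic fun x hx => h _ (grid_bottom hτ hx)
  · congr 1
    refine intervalIntegral.integral_congr fun y hy => h _ (grid_right ?_)
    rwa [uIcc_of_le (by linarith)] at hy
  · exact setIntegral_congr_fun measurableSet_Iic fun x hx => h _ (grid_top hτ hx)

theorem LeftLoopConverges.congr (hτ : 0 < τ) (h : ∀ s ∈ loopGrid c τ, g s = g' s)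
    (hg : LeftLoopConverges g c τ) : LeftLoopConverges g' c τ := by
  refine ⟨hg.1.congr_fun (fun x hx => h _ (grid_bottom hτ hx)) measurableSet_Iic,
    hg.2.1.congr fun y hy => h _ (grid_right ?_),
    hg.2.2.congr_fun (fun x hx => h _ (grid_top hτ hx)) measurableSet_Iic⟩
  rw [uIoc_of_le (by linarith)] at hy
  exact Ioc_subset_Icc_self hy

theorem tendsto_atBot_of_re (hτ : 0 < τ) {w : ℝ} (hw : w = τ ∨ w = -τ) :
    Tendsto (fun x : ℝ => (x : ℂ) + w * Complex.I) atBot (cobounded ℂ ⊓ 𝓟 (loopGrid c τ)) := by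
  refine tendsto_inf.2 ⟨?_, tendsto_principal.2 ?_⟩
  · rw [← tendsto_norm_atTop_iff_cobounded]
    refine tendsto_atTop_mono (fun x => ?_) tendsto_abs_atBot_atTop
    simpa using Complex.abs_re_le_norm ((x : ℂ) + w * Complex.I)
  · filter_upwards [eventually_le_atBot c] with x hx
    rcases hw with rfl | rfl
    · exact grid_top hτ hx
    · simpa [sub_eq_add_neg] using grid_bottom hτ hx

theorem integrableOn_halfLine (hτ : 0 < τ) (hg : ContinuousOn g (loopGrid c τ))
    (hO : g =O[cobounded ℂ ⊓ 𝓟 (loopGrid c τ)] fun s => (‖s‖ ^ 2)⁻¹) {w : ℝ}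
    (hw : w = τ ∨ w = -τ) : IntegrableOn (fun x : ℝ => g ((x : ℂ) + w * Complex.I)) (Iic c) := by
  have hc : ContinuousOn (fun x : ℝ => g ((x : ℂ) + w * Complex.I)) (Iic c) := by
    refine hg.comp (by fun_prop) fun x hx => ?_
    rcases hw with rfl | rfl
    · exact grid_top hτ hx
    · simpa [sub_eq_add_neg] using grid_bottom hτ hx
  refine LocallyIntegrableOn.integrableOn_of_isBigO_atBot (g := fun x : ℝ => (1 + x ^ 2)⁻¹)
    (hc.locallyIntegrableOn measurableSet_Iic) ?_ (integrable_inv_one_add_sq.integrableAtFilter _)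
  refine (hO.comp_tendsto (tendsto_atBot_of_re hτ hw)).trans (IsBigO.of_bound 2 ?_)
  filter_upwards [eventually_le_atBot (-1)] with x hx
  have h1 : x ^ 2 ≤ ‖(x : ℂ) + w * Complex.I‖ ^ 2 := by
    rw [← Complex.normSq_eq_norm_sq, Complex.normSq_add_mul_I]
    nlinarith [sq_nonneg w]
  have h2 : (1 : ℝ) ≤ x ^ 2 := by nlinarith
  simp only [Function.comp, norm_inv, norm_pow, norm_norm]
  rw [Real.norm_of_nonneg (by positivity : (0 : ℝ) ≤ 1 + x ^ 2), ← one_div, ← div_eq_mul_inv,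
    div_le_div_iff₀ (by linarith) (by positivity)]
  linarith

/-- If `g` decays quadratically on the grid, its left loop integral converges absolutely and is
the limit of its integrals over the rectangles `[c - n, c] × [-τ, τ]`. -/
theorem leftLoop_of_isBigO (hτ : 0 < τ) (hg : ContinuousOn g (loopGrid c τ))
    (hO : g =O[cobounded ℂ ⊓ 𝓟 (loopGrid c τ)] fun s => (‖s‖ ^ 2)⁻¹) :
    LeftLoopConverges g c τ ∧
      Tendsto (fun n : ℕ => rectInt g (c - n) c τ) atTop (𝓝 (leftLoopIntegral g c τ)) := by
  have hτ' : -τ ≤ τ := by linarith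
  have hT := integrableOn_halfLine hτ hg hO (Or.inl rfl)
  have hB : IntegrableOn (fun x : ℝ => g ((x : ℂ) - τ * Complex.I)) (Iic c) := by
    simpa [sub_eq_add_neg] using integrableOn_halfLine hτ hg hO (Or.inr rfl)
  have hR : IntervalIntegrable (fun y : ℝ => g ((c : ℂ) + y * Complex.I)) volume (-τ) τ := by
    refine ContinuousOn.intervalIntegrable ?_
    rw [uIcc_of_le hτ']
    exact hg.comp (by fun_prop) fun y hy => grid_right hy
  refine ⟨⟨hB, hR, hT⟩, ?_⟩
  have hn : Tendsto (fun n : ℕ => c - (n : ℝ)) atTop atBot :=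
    tendsto_const_nhds.add_atBot (tendsto_neg_atTop_atBot.comp tendsto_natCast_atTop_atTop)
  have hV : Tendsto (fun n : ℕ => ∫ y in (-τ)..τ, g (((c - n : ℝ) : ℂ) + y * Complex.I)) atTop
      (𝓝 0) := by
    obtain ⟨B, hB0, hB⟩ := hO.exists_pos
    rw [IsBigOWith, eventually_inf_principal] at hB
    obtain ⟨R, -, hR⟩ := (hasBasis_cobounded_norm (E := ℂ)).eventually_iff.1 hB
    have hlim : Tendsto (fun n : ℕ => B * (|c - n| ^ 2)⁻¹ * |τ - -τ|) atTop (𝓝 0) := by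
      have h1 : Tendsto (fun n : ℕ => (|c - n| ^ 2)⁻¹) atTop (𝓝 0) :=
        tendsto_inv_atTop_zero.comp ((tendsto_pow_atTop two_ne_zero).comp
          (tendsto_abs_atBot_atTop.comp hn))
      simpa using (h1.const_mul B).mul_const |τ - -τ|
    refine squeeze_zero_norm' ?_ hlim
    filter_upwards [(tendsto_abs_atBot_atTop.comp hn).eventually_ge_atTop (max R 1)] with n hn'
    simp only [Function.comp, max_le_iff] at hn'
    refine intervalIntegral.norm_integral_le_of_norm_le_const fun y hy => ?_
    rw [uIoc_of_le hτ'] at hy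
    have habs : |c - n| ≤ ‖((c - n : ℝ) : ℂ) + y * Complex.I‖ := by
      simpa using Complex.abs_re_le_norm (((c - n : ℝ) : ℂ) + y * Complex.I)
    have hmem : ((c - n : ℝ) : ℂ) + y * Complex.I ∈ loopGrid c τ := by
      have := grid_vertical (c := c) n (Ioc_subset_Icc_self hy)
      push_cast; exact this
    refine (hR (show R ≤ _ from hn'.1.trans habs) hmem).trans ?_
    rw [norm_inv, norm_pow, norm_norm]
    have hpos : 0 < |c - n| := by linarith
    gcongr
  have hlim := (((intervalIntegral_tendsto_integral_Iic c hB hn).add_const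
    (Complex.I * ∫ y in (-τ)..τ, g ((c : ℂ) + y * Complex.I))).sub
    (intervalIntegral_tendsto_integral_Iic c hT hn)).sub (hV.const_mul Complex.I)
  rw [mul_zero, sub_zero] at hlim
  exact hlim

/-- The right loop is the reflection of a left loop. -/
theorem rightLoopIntegral_eq (g : ℂ → ℂ) (c τ : ℝ) :
    rightLoopIntegral g c τ = leftLoopIntegral (fun s => g (-s)) (-c) τ := by
  unfold rightLoopIntegral leftLoopIntegral
  rw [integral_Ici_eq_integral_Ioi, integral_Ici_eq_integral_Ioi]
  have h1 := integral_comp_neg_Iic (-c) fun x : ℝ => g ((x : ℂ) + τ * Complex.I)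
  have h2 := integral_comp_neg_Iic (-c) fun x : ℝ => g ((x : ℂ) - τ * Complex.I)
  have h3 := intervalIntegral.integral_comp_neg (a := -τ) (b := τ)
    fun y : ℝ => g ((c : ℂ) + y * Complex.I)
  rw [neg_neg] at h1 h2 h3
  rw [← h1, ← h2, ← h3]
  have e1 : ∀ x : ℝ, -((x : ℂ) - τ * Complex.I) = ((-x : ℝ) : ℂ) + τ * Complex.I := fun x => by
    push_cast; ring
  have e2 : ∀ x : ℝ, -((x : ℂ) + τ * Complex.I) = ((-x : ℝ) : ℂ) - τ * Complex.I := fun x => by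
    push_cast; ring
  have e3 : ∀ y : ℝ, -(((-c : ℝ) : ℂ) + y * Complex.I) = (c : ℂ) + ((-y : ℝ) : ℂ) * Complex.I :=
    fun y => by push_cast; ring
  simp only [e1, e2, e3]
  ring

theorem rightLoopConverges_of_left
    (h : LeftLoopConverges (fun s => g (-s)) (-c) τ) : RightLoopConverges g c τ := by
  obtain ⟨hB, hR, hT⟩ := h
  have hneg : ∀ f : ℝ → ℂ, IntegrableOn f (Iic (-c)) → IntegrableOn (fun x => f (-x)) (Ici c) := by
    intro f hf
    have := (Measure.measurePreserving_neg (volume : Measure ℝ)).integrableOn_comp_preimage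
      (Homeomorph.neg ℝ).measurableEmbedding (f := f) (s := Iic (-c))
    have h2 := this.2 hf
    have h3 : Neg.neg ⁻¹' Iic (-c) = Ici c := by ext x; simp
    rw [h3] at h2
    exact h2
  refine ⟨?_, ?_, ?_⟩
  · refine (hneg _ hT).congr_fun (fun x _ => ?_) measurableSet_Ici
    simp only; congr 1; push_cast; ring
  · have h2 := (IntervalIntegrable.iff_comp_neg).1 hR
    rw [neg_neg] at h2
    refine h2.symm.congr fun y _ => ?_
    simp only; congr 1; push_cast; ring
  · refine (hneg _ hB).congr_fun (fun x _ => ?_) measurableSet_Ici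
    simp only; congr 1; push_cast; ring

/-! ### Bounds on the grid -/

theorem normSq_sin (w : ℂ) :
    ‖Complex.sin w‖ ^ 2 = Real.sin w.re ^ 2 + Real.sinh w.im ^ 2 := by
  rw [Complex.sin_eq, ← Complex.ofReal_sin, ← Complex.ofReal_cos, ← Complex.ofReal_cosh,
    ← Complex.ofReal_sinh, ← Complex.ofReal_mul, ← Complex.ofReal_mul,
    ← Complex.normSq_eq_norm_sq, Complex.normSq_add_mul_I, mul_pow, mul_pow, Real.cosh_sq,
    Real.cos_sq']
  ring

theorem abs_sin_sub_nat_mul_pi (x : ℝ) (n : ℕ) : |Real.sin (x - n * Real.pi)| = |Real.sin x| := by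
  rw [Real.sin_sub_nat_mul_pi, abs_mul, abs_pow, abs_neg, abs_one, one_pow, one_mul]

/-- `sin πs` is bounded away from `0` on the grid, if `c` is not an integer. -/
theorem exists_le_norm_sin (hτ : 0 < τ) (hc : Real.sin (Real.pi * c) ≠ 0) :
    ∃ δ > 0, ∀ s ∈ loopGrid c τ, δ ≤ ‖Complex.sin (Real.pi * s)‖ := by
  have hsinh : 0 < Real.sinh (Real.pi * τ) := Real.sinh_pos_iff.2 (by positivity)
  refine ⟨min |Real.sin (Real.pi * c)| (Real.sinh (Real.pi * τ)),
    lt_min (abs_pos.2 hc) hsinh, fun s hs => ?_⟩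
  have h := normSq_sin (Real.pi * s)
  rw [Complex.re_ofReal_mul, Complex.im_ofReal_mul] at h
  obtain ⟨-, -, h1 | ⟨n, h1⟩⟩ := hs
  · refine (min_le_right _ _).trans (le_of_sq_le_sq ?_ (norm_nonneg _))
    have h2 : Real.sinh (Real.pi * s.im) ^ 2 = Real.sinh (Real.pi * τ) ^ 2 := by
      rcases h1 with h1 | h1
      · rw [h1, mul_neg, Real.sinh_neg, neg_sq]
      · rw [h1]
    rw [h, h2]
    nlinarith [sq_nonneg (Real.sin (Real.pi * s.re))]
  · refine (min_le_left _ _).trans (le_of_sq_le_sq ?_ (norm_nonneg _))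
    rw [h, h1, mul_sub, mul_comm _ (n : ℝ), ← sq_abs (Real.sin (_ - _)), abs_sin_sub_nat_mul_pi]
    nlinarith [sq_nonneg (Real.sinh (Real.pi * s.im))]

theorem norm_sin_le_cosh (hτ : 0 < τ) {s : ℂ} (hs : s ∈ loopGrid c τ) :
    ‖Complex.sin (Real.pi * s)‖ ≤ Real.cosh (Real.pi * τ) := by
  refine le_of_sq_le_sq ?_ (Real.cosh_pos _).le
  rw [normSq_sin, Complex.re_ofReal_mul, Complex.im_ofReal_mul]
  have h1 : Real.cosh (Real.pi * s.im) ≤ Real.cosh (Real.pi * τ) := by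
    rw [Real.cosh_le_cosh, abs_mul, abs_mul]
    refine mul_le_mul_of_nonneg_left ?_ (abs_nonneg _)
    rw [abs_of_pos hτ]
    exact abs_le.2 hs.2.1
  have h2 := Real.cosh_sq (Real.pi * s.im)
  have h3 := Real.sin_sq_le_one (Real.pi * s.re)
  have h4 := Real.cosh_pos (Real.pi * s.im)
  nlinarith

theorem norm_exp_mul_le {L : ℂ} (hL : 0 ≤ L.re) {s : ℂ} (hs : s ∈ loopGrid c τ) :
    ‖Complex.exp (s * L)‖ ≤ Real.exp (c * L.re + τ * |L.im|) := by
  rw [Complex.norm_exp, Real.exp_le_exp, Complex.mul_re]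
  have h1 : s.re * L.re ≤ c * L.re := mul_le_mul_of_nonneg_right hs.1 hL
  have h2 : -(s.im * L.im) ≤ τ * |L.im| := by
    refine (neg_le_abs _).trans ?_
    rw [abs_mul]
    exact mul_le_mul_of_nonneg_right (abs_le.2 hs.2.1) (abs_nonneg _)
  linarith

end grid

end MeijerAux
namespace MeijerAux
open Set Filter Topology Asymptotics Bornology MeasureTheory

/-! ### The integrands in terms of `R₀³` and `sin` -/

theorem Gamma_add_natCast {w : ℂ} (hw : ∀ m : ℕ, w ≠ -m) (n : ℕ) :
    Complex.Gamma (w + n) = (∏ i ∈ Finset.range n, (w + i)) * Complex.Gamma w := by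
  induction n with
  | zero => simp
  | succ n ih =>
    rw [Finset.prod_range_succ, Nat.cast_succ, ← add_assoc, Complex.Gamma_add_one, ih]
    · ring
    · exact fun h => hw n (eq_neg_of_add_eq_zero_left h)

theorem ne_intCast_of_sin_ne_zero {s : ℂ} (hs : Complex.sin (Real.pi * s) ≠ 0) (m : ℤ) : s ≠ m := by
  rintro rfl
  exact hs (sin_pi_mul_intCast m)

theorem prod_eq_R0 {Δ ν : ℕ} (h : ν ≤ ν * Δ) {t : ℂ}
    (ht : ∀ k ∈ Finset.range (ν * Δ + 1), t ≠ -(k : ℂ)) :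
    ∏ i ∈ Finset.range (ν * Δ), (1 - t + i) =
      (-1) ^ (ν * Δ) * (((ν * Δ - ν).factorial : ℂ) / ((ν * Δ).factorial : ℂ)) * R0 Δ ν t *
        ∏ i ∈ Finset.range (ν * Δ + ν + 1), (t - ν + i) := by
  have hf1 : ((ν * Δ).factorial : ℂ) ≠ 0 := Nat.cast_ne_zero.2 (Nat.factorial_ne_zero _)
  have hf2 : ((ν * Δ - ν).factorial : ℂ) ≠ 0 := Nat.cast_ne_zero.2 (Nat.factorial_ne_zero _)
  have hne : ∏ k ∈ Finset.range (ν * Δ + 1), (t + k) ≠ 0 := Finset.prod_ne_zero_iff.2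
    fun k hk h0 => ht k hk (eq_neg_of_add_eq_zero_left h0)
  unfold R0
  generalize ν * Δ = N at *
  obtain ⟨M, rfl⟩ := Nat.exists_eq_add_of_le h
  have h1 : ∏ i ∈ Finset.range (ν + M), (1 - t + i) = (-1) ^ (ν + M) *
      ((∏ i ∈ Finset.range ν, (t - ((i + 1 : ℕ) : ℂ))) *
        ∏ κ ∈ Finset.Icc (ν + 1) (ν + M), (t - (κ : ℂ))) := by
    have h2 : ∏ κ ∈ Finset.Icc (ν + 1) (ν + M), (t - (κ : ℂ)) =
        ∏ i ∈ Finset.range M, (t - ((ν + i + 1 : ℕ) : ℂ)) := by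
      have h3 : Finset.Icc (ν + 1) (ν + M) = Finset.Ico (ν + 1) (ν + M + 1) := by
        ext x; simp only [Finset.mem_Icc, Finset.mem_Ico]; omega
      rw [h3, Finset.prod_Ico_eq_prod_range, show ν + M + 1 - (ν + 1) = M by omega]
      refine Finset.prod_congr rfl fun i _ => ?_
      push_cast; ring
    rw [h2, ← Finset.prod_range_add (fun i : ℕ => t - ((i + 1 : ℕ) : ℂ))]
    rw [show (-1 : ℂ) ^ (ν + M) = (-1) ^ (Finset.range (ν + M)).card by rw [Finset.card_range],
      ← Finset.prod_neg]
    refine Finset.prod_congr rfl fun i _ => ?_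
    push_cast; ring
  have h4 : ∏ i ∈ Finset.range (ν + M + ν + 1), (t - ν + i) =
      (∏ i ∈ Finset.range ν, (t - ((i + 1 : ℕ) : ℂ))) *
        ∏ i ∈ Finset.range (ν + M + 1), (t + i) := by
    rw [show ν + M + ν + 1 = ν + (ν + M + 1) by ring, Finset.prod_range_add,
      ← Finset.prod_range_reflect (fun i : ℕ => t - ((i + 1 : ℕ) : ℂ))]
    congr 1
    · refine Finset.prod_congr rfl fun i hi => ?_
      rw [Finset.mem_range] at hi
      rw [show ν - 1 - i + 1 = ν - i by omega, Nat.cast_sub hi.le]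
      ring
    · refine Finset.prod_congr rfl fun i _ => ?_
      push_cast; ring
  have h5 : ∏ κ ∈ Finset.range (ν + M + 1), (1 / (t + (κ : ℂ))) =
      (∏ κ ∈ Finset.range (ν + M + 1), (t + (κ : ℂ)))⁻¹ := by
    rw [← Finset.prod_inv_distrib]
    simp only [one_div]
  rw [h1, h4, h5]
  field_simp

/-- The quotient of Gamma factors common to all the integrands. -/
theorem Gamma_mul_Gamma_eq {Δ ν : ℕ} (h : ν ≤ ν * Δ) {s : ℂ}
    (hs : Complex.sin (Real.pi * s) ≠ 0) :
    Complex.Gamma (1 + (ν * (Δ - 1)) + s) * Complex.Gamma (-s) =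
      (-1) ^ (ν * Δ) * (((ν * Δ - ν).factorial : ℂ) / ((ν * Δ).factorial : ℂ)) * R0 Δ ν (ν - s) *
        (Complex.Gamma (1 - ν + s) * Complex.Gamma (1 + ν * (Δ + 1) - s)) := by
  have hne := ne_intCast_of_sin_ne_zero hs
  have h1 := Gamma_add_natCast (w := 1 - ν + s) (fun m h0 => hne (ν - 1 - m) (by
    push_cast; linear_combination h0)) (ν * Δ)
  have h2 := Gamma_add_natCast (w := -s) (fun m h0 => hne m (by
    push_cast; linear_combination -h0)) (ν * Δ + ν + 1)
  have h3 := prod_eq_R0 h (t := ν - s) fun k _ h0 => hne (ν + k) (by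
    push_cast; linear_combination -h0)
  have e1 : (1 : ℂ) + ν * (Δ - 1) + s = 1 - ν + s + (ν * Δ : ℕ) := by push_cast; ring
  have e2 : (1 : ℂ) + ν * (Δ + 1) - s = -s + (ν * Δ + ν + 1 : ℕ) := by push_cast; ring
  have e3 : (1 : ℂ) - (ν - s) = 1 - ν + s := by ring
  have e4 : (ν : ℂ) - s - ν = -s := by ring
  rw [e3, e4] at h3
  rw [e1, e2, h1, h2, h3]
  ring

theorem inv_normFactor (Δ ν : ℕ) : (normFactor Δ ν)⁻¹ =
    (((ν * Δ - ν).factorial : ℂ) / ((ν * Δ).factorial : ℂ)) ^ 3 := by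
  rw [normFactor, ← inv_pow, inv_div, Nat.mul_sub_one]

theorem normFactor_ne_zero (Δ ν : ℕ) : normFactor Δ ν ≠ 0 := by
  have hf : ∀ n : ℕ, (n.factorial : ℂ) ≠ 0 := fun n => Nat.cast_ne_zero.2 (Nat.factorial_ne_zero n)
  exact pow_ne_zero _ (div_ne_zero (hf _) (hf _))

theorem neg_one_pow_cube (n : ℕ) : ((-1 : ℂ) ^ n) ^ 3 = (-1) ^ n := by
  rw [← pow_mul, mul_comm, pow_mul]; norm_num

section integrands

variable {Δ ν : ℕ} {s : ℂ} (z : ℂ)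

theorem Gamma_factors_ne_zero (hs : Complex.sin (Real.pi * s) ≠ 0) :
    Complex.Gamma (-s) ≠ 0 ∧ Complex.Gamma (1 + s) ≠ 0 ∧ Complex.Gamma (ν - s) ≠ 0 ∧
      Complex.Gamma (1 - ν + s) ≠ 0 ∧ Complex.Gamma (1 + ν * (Δ + 1) - s) ≠ 0 := by
  have hne := ne_intCast_of_sin_ne_zero hs
  refine ⟨?_, ?_, ?_, ?_, ?_⟩ <;> refine Complex.Gamma_ne_zero fun m h0 => ?_
  · exact hne m (by push_cast; linear_combination -h0)
  · exact hne (-m - 1) (by push_cast; linear_combination h0)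
  · exact hne (ν + m) (by push_cast; linear_combination -h0)
  · exact hne (ν - 1 - m) (by push_cast; linear_combination h0)
  · exact hne (1 + ν * (Δ + 1) + m) (by push_cast; linear_combination -h0)

theorem Gamma_neg_mul (s : ℂ) : Complex.Gamma (-s) * Complex.Gamma (1 + s) =
    -(Real.pi / Complex.sin (Real.pi * s)) := by
  have h := Complex.Gamma_mul_Gamma_one_sub (-s)
  rw [sub_neg_eq_add, mul_neg, Complex.sin_neg, div_neg] at h
  exact h

theorem Gamma_nu_mul (ν : ℕ) (s : ℂ) : Complex.Gamma (ν - s) * Complex.Gamma (1 - ν + s) =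
    -((-1) ^ ν * (Real.pi / Complex.sin (Real.pi * s))) := by
  have h := Complex.Gamma_mul_Gamma_one_sub (ν - s)
  have h1 : Complex.sin (Real.pi * (ν - s)) = -((-1) ^ ν * Complex.sin (Real.pi * s)) := by
    rw [show (Real.pi : ℂ) * (ν - s) = ν * Real.pi - Real.pi * s by ring,
      ← neg_sub, Complex.sin_neg, Complex.sin_antiperiodic.sub_nat_mul_eq]
  have h2 : ((-1 : ℂ) ^ ν) * (-1) ^ ν = 1 := by rw [← mul_pow]; norm_num
  rw [h1, show (1 : ℂ) - (ν - s) = 1 - ν + s by ring] at h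
  rw [h, div_neg, div_mul_eq_div_div, ← mul_div_assoc]
  congr 2
  rw [div_eq_iff (left_ne_zero_of_mul_eq_one h2)]
  linear_combination -Real.pi * h2

/-- The powers of `π / sin πs` in the four integrands come from pairing `Γ(-s)` with `Γ(1 + s)` and
`Γ(ν - s)` with `Γ(1 - ν + s)`. -/
theorem meijerIntegrand_eq (h : ν ≤ ν * Δ) (hs : Complex.sin (Real.pi * s) ≠ 0) :
    meijerIntegrand 1 3 (aPar Δ ν) (bPar ν) z s = (-1) ^ (ν * Δ) * (normFactor Δ ν)⁻¹ *
        (Complex.exp (s * branchLog z) * R0 Δ ν (ν - s) ^ 3 *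
          (Complex.sin (Real.pi * s) / Real.pi) ^ 2) ∧
    meijerIntegrand 4 3 (aPar Δ ν) (bPar ν) z s =
      -((-1) ^ (ν * Δ) * (-1) ^ ν * (normFactor Δ ν)⁻¹) *
        (Complex.exp (s * branchLog z) * R0 Δ ν (ν - s) ^ 3 *
          (Real.pi / Complex.sin (Real.pi * s)) ^ 1) ∧
    meijerIntegrand 5 3 (aPar Δ ν) (bPar ν) z s =
      (-1) ^ (ν * Δ) * (normFactor Δ ν)⁻¹ *
        (Complex.exp (s * branchLog z) * R0 Δ ν (ν - s) ^ 3 *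
          (Real.pi / Complex.sin (Real.pi * s)) ^ 2) ∧
    meijerIntegrand 6 3 (aPar Δ ν) (bPar ν) z s =
      -((-1) ^ (ν * Δ) * (-1) ^ ν * (normFactor Δ ν)⁻¹) *
        (Complex.exp (s * branchLog z) * R0 Δ ν (ν - s) ^ 3 *
          (Real.pi / Complex.sin (Real.pi * s)) ^ 3) := by
  have hA := Gamma_mul_Gamma_eq h hs
  have hX := Gamma_neg_mul s
  have hY := Gamma_nu_mul ν s
  obtain ⟨n1, n2, n3, n4, n5⟩ := Gamma_factors_ne_zero (Δ := Δ) (ν := ν) hs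
  have hpi : (Real.pi : ℂ) ≠ 0 := Complex.ofReal_ne_zero.2 Real.pi_ne_zero
  have hq : Complex.sin (Real.pi * s) / Real.pi = (Real.pi / Complex.sin (Real.pi * s))⁻¹ := by
    rw [inv_div]
  rw [← neg_one_pow_cube (ν * Δ), inv_normFactor, hq]
  have hA3 : Complex.Gamma (1 + (ν * (Δ - 1)) + s) = (-1) ^ (ν * Δ) *
      (((ν * Δ - ν).factorial : ℂ) / ((ν * Δ).factorial : ℂ)) * R0 Δ ν (ν - s) *
        (Complex.Gamma (1 - ν + s) * Complex.Gamma (1 + ν * (Δ + 1) - s)) / Complex.Gamma (-s) := by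
    rw [← hA, mul_div_cancel_right₀ _ n1]
  have hsq : ((-1 : ℂ) ^ ν) * (-1) ^ ν = 1 := by rw [← mul_pow]; norm_num
  have hq1 : Real.pi / Complex.sin (Real.pi * s) =
      -(Complex.Gamma (-s) * Complex.Gamma (1 + s)) := by rw [hX, neg_neg]
  have hq2 : Real.pi / Complex.sin (Real.pi * s) =
      -((-1) ^ ν * (Complex.Gamma (ν - s) * Complex.Gamma (1 - ν + s))) := by
    rw [hY]
    linear_combination -(Real.pi / Complex.sin (Real.pi * s)) * hsq
  generalize (((ν * Δ - ν).factorial : ℂ) / ((ν * Δ).factorial : ℂ)) = κ at *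
  simp only [meijerIntegrand, aPar, bPar, Fin.prod_univ_six]
  simp only [Fin.isValue, Fin.coe_ofNat_eq_mod, Nat.zero_mod, Nat.one_mod, Nat.reduceMod,
    Nat.reduceLT, if_true, if_false, Matrix.cons_val, sub_zero, zero_sub, sub_neg_eq_add,
    Nat.lt_irrefl, Nat.one_lt_ofNat, Nat.ofNat_pos, zero_lt_one]
  rw [hA3]
  refine ⟨?_, ?_, ?_, ?_⟩
  · rw [hq1]
    field_simp
  · rw [hq2]
    field_simp
    linear_combination (-κ ^ 3 * R0 Δ ν (ν - s) ^ 3) * hsq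
  · rw [hq2]
    field_simp
    linear_combination (-κ ^ 3 * R0 Δ ν (ν - s) ^ 3) * hsq
  · rw [hq2]
    field_simp
    linear_combination (-κ ^ 3 * R0 Δ ν (ν - s) ^ 3 * ((-1) ^ ν * (-1) ^ ν + 1)) * hsq

end integrands

theorem exp_branchLog {z : ℂ} (hz : z ≠ 0) : Complex.exp (branchLog z) = z := by
  rw [branchLog, Complex.exp_sub, Complex.exp_log (mul_ne_zero hz Complex.I_ne_zero),
    mul_comm Complex.I, Complex.exp_pi_div_two_mul_I, mul_div_cancel_right₀ _ Complex.I_ne_zero]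

theorem branchLog_re (z : ℂ) : (branchLog z).re = Real.log ‖z‖ := by
  simp [branchLog, Complex.log_re]

theorem branchLog_neg {z : ℂ} (hz : 0 < z.re) :
    branchLog (-z) = branchLog z - Complex.I * Real.pi := by
  have hz0 : z ≠ 0 := by rintro rfl; simp at hz
  have harg := Complex.abs_arg_lt_pi_div_two_iff.2 (Or.inl hz)
  rw [abs_lt] at harg
  have hpi := Real.pi_pos
  have h1 : Complex.log (z * Complex.I) = Complex.log z + Complex.log Complex.I :=
    Complex.log_mul hz0 Complex.I_ne_zero (by
      rw [Complex.arg_I]; constructor <;> linarith)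
  have h2 : Complex.log (z * -Complex.I) = Complex.log z + Complex.log (-Complex.I) :=
    Complex.log_mul hz0 (neg_ne_zero.2 Complex.I_ne_zero) (by
      rw [Complex.arg_neg_I]; constructor <;> linarith)
  rw [branchLog, branchLog, neg_mul, ← mul_neg, h1, h2, Complex.log_I, Complex.log_neg_I]
  ring

end MeijerAux
namespace MeijerAux
open Set Filter Topology Asymptotics Bornology MeasureTheory

/-! ### Evaluation of the loop integrals -/

theorem sin_pi_mul_ne_zero_of_mem {c τ : ℝ} (hτ : 0 < τ) (hc : Real.sin (Real.pi * c) ≠ 0) {s : ℂ}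
    (hs : s ∈ loopGrid c τ) : Complex.sin (Real.pi * s) ≠ 0 := by
  obtain ⟨δ, hδ, h⟩ := exists_le_norm_sin hτ hc
  exact norm_pos_iff.1 (hδ.trans_le (h s hs))

theorem leftLoop_exp_mul {c τ : ℝ} (hτ : 0 < τ) {L : ℂ} (hL : 0 ≤ L.re) {F T : ℂ → ℂ}
    (hF : F =O[cobounded ℂ] fun s => (‖s‖ ^ 2)⁻¹) (hFc : ContinuousOn F (loopGrid c τ))
    (hTc : ContinuousOn T (loopGrid c τ)) {B : ℝ} (hT : ∀ s ∈ loopGrid c τ, ‖T s‖ ≤ B) :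
    ContinuousOn (fun s => Complex.exp (s * L) * F s * T s) (loopGrid c τ) ∧
    LeftLoopConverges (fun s => Complex.exp (s * L) * F s * T s) c τ ∧
      Tendsto (fun n : ℕ => rectInt (fun s => Complex.exp (s * L) * F s * T s) (c - n) c τ) atTop
        (𝓝 (leftLoopIntegral (fun s => Complex.exp (s * L) * F s * T s) c τ)) := by
  have hE : ContinuousOn (fun s : ℂ => Complex.exp (s * L)) (loopGrid c τ) := by fun_prop
  have hc := (hE.mul hFc).mul hTc
  refine ⟨hc, leftLoop_of_isBigO hτ hc ?_⟩
  have h1 : (fun s : ℂ => Complex.exp (s * L)) =O[cobounded ℂ ⊓ 𝓟 (loopGrid c τ)]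
      fun _ => (1 : ℝ) := by
    refine IsBigO.of_bound (Real.exp (c * L.re + τ * |L.im|)) ?_
    filter_upwards [mem_inf_of_right (mem_principal_self _)] with s hs
    simpa using norm_exp_mul_le hL hs
  have h2 : T =O[cobounded ℂ ⊓ 𝓟 (loopGrid c τ)] fun _ => (1 : ℝ) := by
    refine IsBigO.of_bound B ?_
    filter_upwards [mem_inf_of_right (mem_principal_self _)] with s hs
    simpa using hT s hs
  exact ((h1.mul (hF.mono inf_le_left)).mul h2).congr_right fun s => by simp

theorem tendsto_affine_cobounded {u v : ℂ} (hv : v ≠ 0) :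
    Tendsto (fun s : ℂ => u + v * s) (cobounded ℂ) (cobounded ℂ) := by
  rw [← tendsto_norm_atTop_iff_cobounded]
  refine tendsto_atTop_mono (fun s => ?_) (tendsto_atTop_add_const_right _ (-‖u‖)
    (tendsto_norm_cobounded_atTop.const_mul_atTop (norm_pos_iff.2 hv)))
  have := norm_sub_norm_le (v * s) (-u)
  rw [norm_neg, norm_mul, sub_neg_eq_add, add_comm (v * s)] at this
  linarith

theorem R0_cube_affine_isBigO {Δ ν : ℕ} (hν : 0 < ν) (h : ν ≤ ν * Δ) {u v : ℂ} (hv : ‖v‖ = 1) :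
    (fun s => R0 Δ ν (u + v * s) ^ 3) =O[cobounded ℂ] fun s => (‖s‖ ^ 2)⁻¹ := by
  have hv0 : v ≠ 0 := norm_pos_iff.1 (by rw [hv]; exact one_pos)
  refine ((R0_cube_isBigO hν h).comp_tendsto (tendsto_affine_cobounded (u := u) hv0)).trans
    (IsBigO.of_bound 4 ?_)
  have hmem := (hasBasis_cobounded_norm (E := ℂ)).mem_of_mem (i := max 1 (2 * ‖u‖)) trivial
  filter_upwards [hmem] with s hs
  have hs : max 1 (2 * ‖u‖) ≤ ‖s‖ := hs
  rw [max_le_iff] at hs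
  have h1 : ‖s‖ / 2 ≤ ‖u + v * s‖ := by
    have := norm_sub_norm_le (v * s) (-u)
    rw [norm_neg, norm_mul, sub_neg_eq_add, add_comm (v * s), hv, one_mul] at this
    linarith
  simp only [Function.comp, norm_inv, norm_pow, norm_norm]
  have hpos : 0 < ‖s‖ / 2 := by linarith
  calc (‖u + v * s‖ ^ 2)⁻¹ ≤ ((‖s‖ / 2) ^ 2)⁻¹ := by gcongr
    _ = 4 * (‖s‖ ^ 2)⁻¹ := by rw [div_pow, inv_div, div_eq_mul_inv]; norm_num

section left

variable {Δ ν : ℕ} {c τ : ℝ} {L : ℂ}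

theorem hasDerivAt_exp_mul_cubeDeriv (j : ℕ) {s : ℂ} (hs : 0 < (ν - s : ℂ).re) :
    HasDerivAt (fun s => Complex.exp (s * L) * cubeDeriv Δ ν j (ν - s))
      (Complex.exp (s * L) * (L * cubeDeriv Δ ν j (ν - s) - cubeDeriv Δ ν (j + 1) (ν - s))) s := by
  have h1 : HasDerivAt (fun s : ℂ => (ν : ℂ) - s) (-1) s := (hasDerivAt_id s).const_sub _
  have h2 := (hasDerivAt_cubeDeriv Δ ν j hs).comp s h1
  have h3 : HasDerivAt (fun s : ℂ => Complex.exp (s * L)) (Complex.exp (s * L) * (1 * L)) s :=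
    ((hasDerivAt_id s).mul_const L).cexp
  refine (h3.mul h2).congr_deriv ?_
  simp only [Function.comp]
  ring

theorem sin_pi_mul_abscissa_ne_zero (hc : -1 < c) (hc' : c < 0) : Real.sin (Real.pi * c) ≠ 0 := by
  have hpi := Real.pi_pos
  exact (Real.sin_neg_of_neg_of_neg_pi_lt (by nlinarith) (by nlinarith)).ne

/-- The integrand `e^{sL} R₀(ν - s)³ (π / sin πs)^j`. -/
noncomputable def leftIntegrand (Δ ν j : ℕ) (L s : ℂ) : ℂ :=
  Complex.exp (s * L) * R0 Δ ν (ν - s) ^ 3 * (Real.pi / Complex.sin (Real.pi * s)) ^ j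

theorem leftIntegrand_loop (hν : 0 < ν) (h : ν ≤ ν * Δ) (hc : -1 < c) (hc' : c < 0) (hτ : 0 < τ)
    (hL : 0 ≤ L.re) (j : ℕ) :
    ContinuousOn (leftIntegrand Δ ν j L) (loopGrid c τ) ∧
    LeftLoopConverges (leftIntegrand Δ ν j L) c τ ∧
      Tendsto (fun n : ℕ => rectInt (leftIntegrand Δ ν j L) (c - n) c τ) atTop
        (𝓝 (leftLoopIntegral (leftIntegrand Δ ν j L) c τ)) := by
  have hsin := sin_pi_mul_abscissa_ne_zero hc hc'
  obtain ⟨δ, hδ, hb⟩ := exists_le_norm_sin hτ hsin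
  refine leftLoop_exp_mul hτ hL (F := fun s => R0 Δ ν (ν - s) ^ 3)
    (T := fun s => (Real.pi / Complex.sin (Real.pi * s)) ^ j) ?_ ?_ ?_ (B := (Real.pi / δ) ^ j) ?_
  · simpa [sub_eq_add_neg] using R0_cube_affine_isBigO hν h (u := ν) (v := -1) (by simp)
  · intro s hs
    refine (ContinuousAt.pow ?_ 3).continuousWithinAt
    refine (differentiableAt_R0 Δ ν fun k _ => ne_neg_natCast ?_ k).continuousAt.comp
      (f := fun s : ℂ => (ν : ℂ) - s) (by fun_prop)
    have := hs.1
    simp only [Complex.sub_re, Complex.natCast_re]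
    have : (0 : ℝ) ≤ ν := ν.cast_nonneg
    linarith
  · exact (ContinuousOn.div (by fun_prop) (by fun_prop) fun s hs =>
      sin_pi_mul_ne_zero_of_mem hτ hsin hs).pow j
  · intro s hs
    rw [norm_pow, norm_div, Complex.norm_real, Real.norm_of_nonneg Real.pi_pos.le]
    have := hb s hs
    gcongr

/-- The contribution to the left loop integral of the pole `s = -(i + 1)`. -/
noncomputable def residueTerm (Δ ν j : ℕ) (L : ℂ) (i : ℕ) : ℂ :=
  Complex.cos (Real.pi * ((-(i + 1) : ℤ) : ℂ)) ^ j * Complex.exp (((-(i + 1) : ℤ) : ℂ) * L) *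
    match j with
    | 1 => cubeDeriv Δ ν 0 ((ν + 1 + i : ℕ) : ℂ)
    | 2 => L * cubeDeriv Δ ν 0 ((ν + 1 + i : ℕ) : ℂ) - cubeDeriv Δ ν 1 ((ν + 1 + i : ℕ) : ℂ)
    | _ => 1 / 2 * ((L ^ 2 + Real.pi ^ 2) * cubeDeriv Δ ν 0 ((ν + 1 + i : ℕ) : ℂ)
        - 2 * L * cubeDeriv Δ ν 1 ((ν + 1 + i : ℕ) : ℂ) + cubeDeriv Δ ν 2 ((ν + 1 + i : ℕ) : ℂ))

theorem rectInt_leftIntegrand (hc : -1 < c) (hc' : c < 0) (hτ : 0 < τ) {j : ℕ}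
    (hj : j ∈ Icc 1 3) (i : ℕ) :
    rectInt (leftIntegrand Δ ν j L) (c - (i + 1 : ℕ)) (c - i) τ =
      2 * Real.pi * Complex.I * residueTerm Δ ν j L i := by
  set m : ℤ := -(i + 1) with hm
  have hmr : (m : ℝ) = -(i + 1) := by rw [hm]; push_cast; ring
  have h1 : (m : ℝ) - 1 < c - (i + 1 : ℕ) := by rw [hmr]; push_cast; linarith
  have h2 : c - (i + 1 : ℕ) < m := by rw [hmr]; push_cast; linarith
  have h3 : (m : ℝ) < c - i := by rw [hmr]; linarith
  have h4 : c - i < m + 1 := by rw [hmr]; linarith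
  have hre : ∀ s ∈ Icc (c - (i + 1 : ℕ)) (c - i) ×ℂ Icc (-τ) τ, 0 < (ν - s : ℂ).re := by
    intro s hs
    have h5 : s.re ≤ c - i := hs.1.2
    have h6 : (0 : ℝ) ≤ ν := ν.cast_nonneg
    have h7 : (0 : ℝ) ≤ i := i.cast_nonneg
    simp only [Complex.sub_re, Complex.natCast_re]
    linarith
  have hd := fun j s hs => hasDerivAt_exp_mul_cubeDeriv (Δ := Δ) (L := L) j (hre s hs)
  have hD : ∀ j, DifferentiableOn ℂ (fun s => Complex.exp (s * L) * cubeDeriv Δ ν j (ν - s))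
      (Icc (c - (i + 1 : ℕ)) (c - i) ×ℂ Icc (-τ) τ) := fun j s hs =>
    (hd j s hs).differentiableAt.differentiableWithinAt
  have hI : leftIntegrand Δ ν j L = fun s => Complex.exp (s * L) * cubeDeriv Δ ν 0 (ν - s) *
      (Real.pi / Complex.sin (Real.pi * s)) ^ j := by
    simp only [cubeDeriv, iteratedDeriv_zero]
    rfl
  have et : (ν : ℂ) - m = ((ν + 1 + i : ℕ) : ℂ) := by rw [hm]; push_cast; ring
  have hh₁ : ∀ s ∈ Icc (c - (i + 1 : ℕ)) (c - i) ×ℂ Icc (-τ) τ,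
      HasDerivAt (fun s => Complex.exp (s * L) * cubeDeriv Δ ν 0 (ν - s))
        (L * (Complex.exp (s * L) * cubeDeriv Δ ν 0 (ν - s))
          - Complex.exp (s * L) * cubeDeriv Δ ν 1 (ν - s)) s := fun s hs =>
    (hd 0 s hs).congr_deriv (by ring)
  have hD₁ := ((hD 0).const_mul L).sub (hD 1)
  obtain rfl | rfl | rfl : j = 1 ∨ j = 2 ∨ j = 3 := by
    have := hj.1; have := hj.2; omega
  · have := rectInt_mul_pi_div_sin h1 h2 h3 h4 hτ (hD 0)
    simp only [hI, residueTerm, pow_one]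
    rw [this, et]; ring
  · have := rectInt_mul_pi_div_sin_sq h1 h2 h3 h4 hτ hh₁ hD₁
    simp only [hI, residueTerm]
    rw [this, et, cos_pi_mul_intCast_sq]; ring
  · have := rectInt_mul_pi_div_sin_cube (h₂ := fun s =>
      L * (L * (Complex.exp (s * L) * cubeDeriv Δ ν 0 (ν - s))
          - Complex.exp (s * L) * cubeDeriv Δ ν 1 (ν - s))
        - (L * (Complex.exp (s * L) * cubeDeriv Δ ν 1 (ν - s))
          - Complex.exp (s * L) * cubeDeriv Δ ν 2 (ν - s))) h1 h2 h3 h4 hτ hh₁ (fun s hs =>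
      ((hh₁ s hs).const_mul L).sub ((hd 1 s hs).congr_deriv (by ring)))
      ((hD₁.const_mul L).sub (((hD 1).const_mul L).sub (hD 2)))
    simp only [hI, residueTerm]
    rw [this, et, pow_succ _ 2, cos_pi_mul_intCast_sq]; ring

/-- The residue theorem for the left loop: the loop is exhausted by unit rectangles, each of which
encloses one pole. -/
theorem leftLoopIntegral_eq_tsum (hν : 0 < ν) (h : ν ≤ ν * Δ) (hc : -1 < c) (hc' : c < 0)
    (hτ : 0 < τ) (hL : 0 ≤ L.re) {j : ℕ} (hj : j ∈ Icc 1 3) {r : ℂ}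
    (hr : HasSum (residueTerm Δ ν j L) r) :
    leftLoopIntegral (leftIntegrand Δ ν j L) c τ = 2 * Real.pi * Complex.I * r := by
  obtain ⟨hcont, -, hlim⟩ := leftIntegrand_loop hν h hc hc' hτ hL j
  refine tendsto_nhds_unique hlim ?_
  refine (hr.tendsto_sum_nat.const_mul (2 * Real.pi * Complex.I)).congr fun n => ?_
  rw [Finset.mul_sum]
  induction n with
  | zero => simp [rectInt]
  | succ n ih =>
    have e0 : c = c - (0 : ℕ) := by simp
    have hf : ∀ m n : ℕ, ContinuousOn (leftIntegrand Δ ν j L) (rectFrame (c - m) (c - n) τ) :=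
      fun m n => hcont.mono rectFrame_subset_loopGrid
    rw [Finset.sum_range_succ, ih, ← rectInt_leftIntegrand hc hc' hτ hj, add_comm]
    refine rectInt_add_adjacent (by push_cast; linarith) (by simp) hτ (hf _ _) ?_
    conv => enter [2, 2]; rw [e0]
    exact hf _ _

end left

/-! ### The right loop -/

section right

variable {Δ ν : ℕ} {c τ : ℝ} {L : ℂ}

/-- The reflected integrand of `f₁`, up to a constant factor. -/
noncomputable def rightIntegrand (Δ ν : ℕ) (L s : ℂ) : ℂ :=
  Complex.exp (s * L) * R0 Δ ν (ν + s) ^ 3 * (Complex.sin (Real.pi * s) / Real.pi) ^ 2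

theorem rightIntegrand_loop (hν : 0 < ν) (h : ν ≤ ν * Δ) (hc : Real.sin (Real.pi * c) ≠ 0)
    (hτ : 0 < τ) (hL : 0 ≤ L.re) :
    LeftLoopConverges (rightIntegrand Δ ν L) c τ ∧
      Tendsto (fun n : ℕ => rectInt (rightIntegrand Δ ν L) (c - n) c τ) atTop
        (𝓝 (leftLoopIntegral (rightIntegrand Δ ν L) c τ)) := by
  refine (leftLoop_exp_mul hτ hL (F := fun s => R0 Δ ν (ν + s) ^ 3)
    (T := fun s => (Complex.sin (Real.pi * s) / Real.pi) ^ 2) ?_ ?_ ?_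
    (B := (Real.cosh (Real.pi * τ) / Real.pi) ^ 2) ?_).2
  · simpa using R0_cube_affine_isBigO hν h (u := ν) (v := 1) (by simp)
  · intro s hs
    refine (ContinuousAt.pow ?_ 3).continuousWithinAt
    refine (differentiableAt_R0 Δ ν fun k _ h0 => ?_).continuousAt.comp
      (f := fun s : ℂ => (ν : ℂ) + s) (by fun_prop)
    exact ne_intCast_of_sin_ne_zero (sin_pi_mul_ne_zero_of_mem hτ hc hs) (-(ν + k)) (by
      push_cast; linear_combination h0)
  · fun_prop
  · intro s hs
    rw [norm_pow, norm_div, Complex.norm_real, Real.norm_of_nonneg Real.pi_pos.le]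
    have := norm_sin_le_cosh hτ hs
    have := Real.pi_pos
    gcongr

/-- Inside a large rectangle, the double zeros of `sin²` reduce the triple poles of `R₀³` to simple
ones, with residues given by the leading coefficients `α_k`. -/
theorem rectInt_rightIntegrand (h : ν ≤ ν * Δ) (hν : 0 < ν) (hc : 0 < c)
    (hsin : Real.sin (Real.pi * c) ≠ 0) (hτ : 0 < τ) {n : ℕ} (hn : c + ν + ν * Δ < n) :
    rectInt (rightIntegrand Δ ν L) (c - n) c τ = 2 * Real.pi * Complex.I *
      ∑ k ∈ Finset.range (ν * Δ + 1), alphaCoeff Δ ν k * Complex.exp (-(ν + k : ℕ) * L) := by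
  have hsn : ∀ s ∈ rectFrame (c - n) c τ, Complex.sin (Real.pi * s) ≠ 0 := fun s hs =>
    sin_pi_mul_ne_zero_of_mem hτ hsin
      (rectFrame_subset_loopGrid (m := n) (n := 0) (by simpa using hs))
  have hpi : (Real.pi : ℂ) ≠ 0 := Complex.ofReal_ne_zero.2 Real.pi_ne_zero
  set f : ℕ → ℂ → ℂ := fun k s => Complex.exp (s * L) *
    (sinQuot ((-(ν + k) : ℤ) : ℂ) s / Real.pi) ^ 2 *
    (alphaCoeff Δ ν k + betaCoeff Δ ν k * (s - ((-(ν + k) : ℤ) : ℂ))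
      + gammaCoeff Δ ν k * (s - ((-(ν + k) : ℤ) : ℂ)) ^ 2) with hf
  have hfd : ∀ k, Differentiable ℂ (f k) := fun k => by
    have := differentiable_sinQuot ((-(ν + k) : ℤ) : ℂ)
    simp only [hf]
    fun_prop
  have hpole : ∀ k ∈ Finset.range (ν * Δ + 1),
      c - n < ((-(ν + k) : ℤ) : ℝ) ∧ ((-(ν + k) : ℤ) : ℝ) < c := by
    intro k hk
    have hk' : (k : ℝ) ≤ ν * Δ := by
      exact_mod_cast Nat.lt_succ_iff.1 (Finset.mem_range.1 hk)
    have hν' : (0 : ℝ) < ν := Nat.cast_pos.2 hν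
    have hk0 : (0 : ℝ) ≤ k := k.cast_nonneg
    push_cast
    constructor
    · linarith
    · linarith
  have hI : ∀ k ∈ Finset.range (ν * Δ + 1),
      rectInt (fun s => f k s * (s - ((-(ν + k) : ℤ) : ℂ))⁻¹) (c - n) c τ =
        2 * Real.pi * Complex.I * (alphaCoeff Δ ν k * Complex.exp (-(ν + k : ℕ) * L)) := by
    intro k hk
    have h1 := rectInt_div_sub (hpole k hk).1 (hpole k hk).2 hτ (hfd k).differentiableOn
    rw [Complex.ofReal_intCast] at h1
    rw [h1]
    simp only [hf, sinQuot_self, mul_div_cancel_left₀ _ hpi, cos_pi_mul_intCast_sq, sub_self]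
    push_cast
    ring
  have hcont : ∀ k ∈ Finset.range (ν * Δ + 1),
      ContinuousOn (fun s => f k s * (s - ((-(ν + k) : ℤ) : ℂ))⁻¹) (rectFrame (c - n) c τ) := by
    intro k hk
    have h1 := continuousOn_inv_sub (hpole k hk).1 (hpole k hk).2 hτ
    rw [Complex.ofReal_intCast] at h1
    exact (hfd k).continuous.continuousOn.mul h1
  have hle : c - n ≤ c := sub_le_self _ n.cast_nonneg
  rw [Finset.mul_sum, ← Finset.sum_congr rfl hI, ← rectInt_sum _ hle hτ hcont]
  refine rectInt_congr hle hτ fun s hs => ?_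
  have hs0 := ne_intCast_of_sin_ne_zero (hsn s hs)
  rw [rightIntegrand, R0_cube h fun k _ h0 => hs0 (-(ν + k)) (by
    push_cast; linear_combination h0)]
  simp only [fracSum]
  rw [← Finset.sum_add_distrib, ← Finset.sum_add_distrib, Finset.mul_sum, Finset.sum_mul]
  refine Finset.sum_congr rfl fun k _ => ?_
  have hne : s - ((-(ν + k) : ℤ) : ℂ) ≠ 0 := sub_ne_zero.2 (hs0 _)
  have e1 : (ν : ℂ) + s + k = s - ((-(ν + k) : ℤ) : ℂ) := by push_cast; ring
  rw [e1, ← sinQuot_mul_sub (-(ν + k)) s]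
  simp only [hf]
  field_simp

theorem leftLoopIntegral_rightIntegrand (hν : 0 < ν) (h : ν ≤ ν * Δ) (hc : 0 < c)
    (hsin : Real.sin (Real.pi * c) ≠ 0) (hτ : 0 < τ) (hL : 0 ≤ L.re) :
    leftLoopIntegral (rightIntegrand Δ ν L) c τ = 2 * Real.pi * Complex.I *
      ∑ k ∈ Finset.range (ν * Δ + 1), alphaCoeff Δ ν k * Complex.exp (-(ν + k : ℕ) * L) := by
  refine tendsto_nhds_unique (rightIntegrand_loop hν h hsin hτ hL).2
    (tendsto_const_nhds.congr' ?_)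
  filter_upwards [tendsto_natCast_atTop_atTop.eventually_gt_atTop (c + ν + ν * Δ)] with n hn
  exact (rectInt_rightIntegrand h hν hc hsin hτ hn).symm

end right

end MeijerAux
namespace MeijerAux
open Set Filter Topology MeasureTheory

section evaluation

variable {Δ ν : ℕ} {c τ : ℝ} {z : ℂ}

theorem leftLoopIntegral_const_mul (a : ℂ) (g : ℂ → ℂ) (c τ : ℝ) :
    leftLoopIntegral (fun s => a * g s) c τ = a * leftLoopIntegral g c τ := by
  simp only [leftLoopIntegral, integral_const_mul, intervalIntegral.integral_const_mul]
  ring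

theorem LeftLoopConverges.const_mul {g : ℂ → ℂ} (hg : LeftLoopConverges g c τ) (a : ℂ) :
    LeftLoopConverges (fun s => a * g s) c τ :=
  ⟨hg.1.const_mul a, hg.2.1.const_mul a, hg.2.2.const_mul a⟩

theorem meijerGLeft_eval (hν : 0 < ν) (h : ν ≤ ν * Δ) (hc : -1 < c) (hc' : c < 0) (hτ : 0 < τ)
    {w a : ℂ} {m j : ℕ} (hj : j ∈ Icc 1 3) (hw : 1 ≤ ‖w‖)
    (hm : ∀ s, Complex.sin (Real.pi * s) ≠ 0 → meijerIntegrand m 3 (aPar Δ ν) (bPar ν) w s =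
      a * leftIntegrand Δ ν j (branchLog w) s) {r : ℂ}
    (hr : HasSum (residueTerm Δ ν j (branchLog w)) r) :
    LeftLoopConverges (meijerIntegrand m 3 (aPar Δ ν) (bPar ν) w) c τ ∧
      meijerGLeft m 3 (aPar Δ ν) (bPar ν) c τ w = a * r := by
  have hsin := sin_pi_mul_abscissa_ne_zero hc hc'
  have hL : 0 ≤ (branchLog w).re := by
    rw [branchLog_re]; exact Real.log_nonneg hw
  have hE : ∀ s ∈ loopGrid c τ, a * leftIntegrand Δ ν j (branchLog w) s =
      meijerIntegrand m 3 (aPar Δ ν) (bPar ν) w s := fun s hs =>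
    (hm s (sin_pi_mul_ne_zero_of_mem hτ hsin hs)).symm
  refine ⟨((leftIntegrand_loop hν h hc hc' hτ hL j).2.1.const_mul a).congr hτ hE, ?_⟩
  rw [meijerGLeft, ← leftLoopIntegral_congr hτ hE, leftLoopIntegral_const_mul,
    leftLoopIntegral_eq_tsum hν h hc hc' hτ hL hj hr]
  have hpi : (Real.pi : ℂ) ≠ 0 := Complex.ofReal_ne_zero.2 Real.pi_ne_zero
  have := Complex.I_ne_zero
  field_simp

theorem exp_neg_succ_mul_branchLog (hz : z ≠ 0) (i : ℕ) :
    Complex.exp (((-(i + 1) : ℤ) : ℂ) * branchLog z) = (z ^ (i + 1))⁻¹ := by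
  rw [Complex.exp_int_mul, exp_branchLog hz, zpow_neg]
  norm_cast

/-- Passing from `z` to `-z` compensates the sign of `cos πm` at an integer `m`. -/
theorem cos_mul_exp_branchLog_neg (hz : 0 < z.re) (m : ℤ) :
    Complex.cos (Real.pi * m) * Complex.exp (m * branchLog (-z)) =
      Complex.exp (m * branchLog z) := by
  have h1 : Complex.exp (-(Real.pi * m) * Complex.I) = Complex.cos (Real.pi * m) := by
    rw [Complex.exp_mul_I, Complex.cos_neg, Complex.sin_neg, sin_pi_mul_intCast]
    simp
  rw [branchLog_neg hz, show (m : ℂ) * (branchLog z - Complex.I * Real.pi) =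
    m * branchLog z + -(Real.pi * m) * Complex.I by ring, Complex.exp_add, h1]
  linear_combination Complex.exp (m * branchLog z) * cos_pi_mul_intCast_sq m

theorem hasSum_cubeDeriv (hν : 0 < ν) (h : ν ≤ ν * Δ) (hz : 1 ≤ ‖z‖) {j : ℕ} (hj : j ≤ 2) :
    HasSum (fun i : ℕ => Complex.exp (((-(i + 1) : ℤ) : ℂ) * branchLog z) *
      cubeDeriv Δ ν j ((ν + 1 + i : ℕ) : ℂ)) (z ^ ν * derivSeries Δ ν j (ν + 1) z) := by
  have hz0 : z ≠ 0 := norm_pos_iff.1 (by linarith)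
  refine ((summable_derivTerm hν h hz hj (ν + 1)).hasSum.mul_left (z ^ ν)).congr_fun fun i => ?_
  rw [derivTerm, exp_neg_succ_mul_branchLog hz0, cubeDeriv,
    show ν + 1 + i = ν + (i + 1) by ring, pow_add z ν, mul_inv, ← mul_assoc, ← mul_assoc,
    mul_inv_cancel₀ (pow_ne_zero _ hz0), one_mul]

theorem f2_eval (hν : 0 < ν) (h : ν ≤ ν * Δ) (hc : -1 < c) (hc' : c < 0) (hτ : 0 < τ)
    (hz : 1 ≤ ‖z‖) (hre : 0 < z.re) :
    LeftLoopConverges (meijerIntegrand 4 3 (aPar Δ ν) (bPar ν) (-z)) c τ ∧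
      f2 Δ ν c τ z = (normFactor Δ ν)⁻¹ * (-z) ^ ν * derivSeries Δ ν 0 (ν + 1) z := by
  have hr : HasSum (residueTerm Δ ν 1 (branchLog (-z)))
      (z ^ ν * derivSeries Δ ν 0 (ν + 1) z) := by
    refine (hasSum_cubeDeriv hν h hz (by norm_num)).congr_fun fun i => ?_
    rw [residueTerm, ← cos_mul_exp_branchLog_neg hre, pow_one]
  have h1 := meijerGLeft_eval hν h hc hc' hτ (by simp) (by rwa [norm_neg])
    (fun s hs => (meijerIntegrand_eq (-z) h hs).2.1) hr
  refine ⟨h1.1, ?_⟩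
  rw [f2, h1.2, neg_pow z]
  have hsq : ((-1 : ℂ) ^ (ν * Δ)) * (-1) ^ (ν * Δ) = 1 := by rw [← mul_pow]; norm_num
  linear_combination ((normFactor Δ ν)⁻¹ * (-1) ^ ν * z ^ ν * derivSeries Δ ν 0 (ν + 1) z) * hsq

theorem f4_eval (hν : 0 < ν) (h : ν ≤ ν * Δ) (hz : 1 ≤ ‖z‖) :
    f4 Δ ν z = -(normFactor Δ ν)⁻¹ * (-z) ^ ν * derivSeries Δ ν 1 (ν + 1) z := by
  rw [f4, derivSeries_eq hν h hz (by norm_num)]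

theorem f3_eval (hν : 0 < ν) (h : ν ≤ ν * Δ) (hc : -1 < c) (hc' : c < 0) (hτ : 0 < τ)
    (hz : 1 ≤ ‖z‖) (hre : 0 < z.re) :
    LeftLoopConverges (meijerIntegrand 5 3 (aPar Δ ν) (bPar ν) z) c τ ∧
      f3 Δ ν c τ z = f2 Δ ν c τ z * branchLog z + f4 Δ ν z := by
  have hr : HasSum (residueTerm Δ ν 2 (branchLog z))
      (branchLog z * (z ^ ν * derivSeries Δ ν 0 (ν + 1) z) -
        z ^ ν * derivSeries Δ ν 1 (ν + 1) z) := by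
    refine (((hasSum_cubeDeriv hν h hz (by norm_num)).mul_left (branchLog z)).sub
      (hasSum_cubeDeriv hν h hz (by norm_num))).congr_fun fun i => ?_
    rw [residueTerm, cos_pi_mul_intCast_sq]
    ring
  have h1 := meijerGLeft_eval hν h hc hc' hτ (by simp) hz
    (fun s hs => (meijerIntegrand_eq z h hs).2.2.1) hr
  refine ⟨h1.1, ?_⟩
  rw [f3, h1.2, (f2_eval hν h hc hc' hτ hz hre).2, f4_eval hν h hz, neg_pow z, mul_add ν, mul_one,
    pow_add]
  have hsq : ((-1 : ℂ) ^ (ν * Δ)) * (-1) ^ (ν * Δ) = 1 := by rw [← mul_pow]; norm_num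
  linear_combination ((normFactor Δ ν)⁻¹ * (-1) ^ ν * z ^ ν *
    (branchLog z * derivSeries Δ ν 0 (ν + 1) z - derivSeries Δ ν 1 (ν + 1) z)) * hsq

theorem f5Vee_eval (hν : 0 < ν) (h : ν ≤ ν * Δ) (hc : -1 < c) (hc' : c < 0) (hτ : 0 < τ)
    (hz : 1 ≤ ‖z‖) (hre : 0 < z.re) :
    LeftLoopConverges (meijerIntegrand 6 3 (aPar Δ ν) (bPar ν) (-z)) c τ ∧
      f5Vee Δ ν c τ z =
        1 / 2 * f2 Δ ν c τ z * (branchLog (-z) ^ 2 + (Real.pi : ℂ) ^ 2)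
        + f4 Δ ν z * branchLog (-z)
        + 1 / 2 * (-z) ^ ν * (normFactor Δ ν)⁻¹ * derivSeries Δ ν 2 (ν + 1) z := by
  set L := branchLog (-z) with hL
  have hr : HasSum (residueTerm Δ ν 3 L)
      (1 / 2 * ((L ^ 2 + Real.pi ^ 2) * (z ^ ν * derivSeries Δ ν 0 (ν + 1) z) -
        2 * L * (z ^ ν * derivSeries Δ ν 1 (ν + 1) z) +
        z ^ ν * derivSeries Δ ν 2 (ν + 1) z)) := by
    have hs := fun j (hj : j ≤ 2) => hasSum_cubeDeriv hν h hz hj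
    refine (((((hs 0 (by norm_num)).mul_left (L ^ 2 + Real.pi ^ 2 : ℂ)).sub
      ((hs 1 (by norm_num)).mul_left (2 * L))).add (hs 2 le_rfl)).mul_left (1 / 2)).congr_fun
      fun i => ?_
    rw [residueTerm, ← cos_mul_exp_branchLog_neg hre, ← hL, pow_succ _ 2, cos_pi_mul_intCast_sq]
    · ring
    · norm_num
    · norm_num
  have h1 := meijerGLeft_eval hν h hc hc' hτ (by simp) (by rwa [norm_neg])
    (fun s hs => (meijerIntegrand_eq (-z) h hs).2.2.2) hr
  refine ⟨h1.1, ?_⟩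
  rw [f5Vee, h1.2, (f2_eval hν h hc hc' hτ hz hre).2, f4_eval hν h hz, neg_pow z]
  have hsq : ((-1 : ℂ) ^ (ν * Δ)) * (-1) ^ (ν * Δ) = 1 := by rw [← mul_pow]; norm_num
  linear_combination ((normFactor Δ ν)⁻¹ * (-1) ^ ν * z ^ ν * (1 / 2 *
    ((L ^ 2 + Real.pi ^ 2) * derivSeries Δ ν 0 (ν + 1) z
      - 2 * L * derivSeries Δ ν 1 (ν + 1) z + derivSeries Δ ν 2 (ν + 1) z))) * hsq

theorem f2_hasSum (hν : 0 < ν) (h : ν ≤ ν * Δ) (hc : -1 < c) (hc' : c < 0) (hτ : 0 < τ)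
    (hz : 1 ≤ ‖z‖) (hre : 0 < z.re) :
    HasSum (fun k : ℕ => (-1) ^ ν * (z ^ (1 + ν * (Δ - 1) + k))⁻¹ *
          ((∏ j ∈ Finset.Icc 1 (ν * Δ - ν), ((1 : ℂ) + ν * Δ - ν + k - j)) /
            ∏ j ∈ Finset.range (ν * Δ + 1), ((1 : ℂ) + ν * Δ + k + j)) ^ 3)
        (f2 Δ ν c τ z) := by
  have hz0 : z ≠ 0 := norm_pos_iff.1 (by linarith)
  rw [(f2_eval hν h hc hc' hτ hz hre).2, ← derivSeries_eq hν h hz (by norm_num)]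
  refine ((summable_derivTerm hν h hz (by norm_num) (ν * Δ + 1)).hasSum.mul_left _).congr_fun
    fun k => ?_
  have hf : ∀ n : ℕ, (n.factorial : ℂ) ≠ 0 := fun n => Nat.cast_ne_zero.2 (Nat.factorial_ne_zero n)
  have h1 : ((∏ j ∈ Finset.Icc 1 (ν * Δ - ν), ((1 : ℂ) + ν * Δ - ν + k - j)) /
      ∏ j ∈ Finset.range (ν * Δ + 1), ((1 : ℂ) + ν * Δ + k + j)) =
      (((ν * Δ - ν).factorial : ℂ) / ((ν * Δ).factorial : ℂ)) *
        R0 Δ ν ((ν * Δ + 1 + k : ℕ) : ℂ) := by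
    have h2 : ∏ κ ∈ Finset.Icc (ν + 1) (ν * Δ), (((ν * Δ + 1 + k : ℕ) : ℂ) - κ) =
        ∏ j ∈ Finset.Icc 1 (ν * Δ - ν), ((1 : ℂ) + ν * Δ - ν + k - j) := by
      rw [show Finset.Icc (ν + 1) (ν * Δ) = Finset.Icc (1 + ν) (ν * Δ - ν + ν) by
        congr 1 <;> omega, ← prod_Icc_shift]
      refine Finset.prod_congr rfl fun j _ => ?_
      push_cast; ring
    have h3 : ∏ κ ∈ Finset.range (ν * Δ + 1), (1 / (((ν * Δ + 1 + k : ℕ) : ℂ) + κ)) =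
        (∏ j ∈ Finset.range (ν * Δ + 1), ((1 : ℂ) + ν * Δ + k + j))⁻¹ := by
      rw [← Finset.prod_inv_distrib]
      refine Finset.prod_congr rfl fun j _ => ?_
      rw [one_div]; congr 1; push_cast; ring
    rw [R0, h2, h3]
    have := hf (ν * Δ)
    have := hf (ν * Δ - ν)
    field_simp
  have h4 : z ^ (ν * Δ + 1 + k) = z ^ ν * z ^ (1 + ν * (Δ - 1) + k) := by
    rw [← pow_add, Nat.mul_sub_one]; congr 1; omega
  rw [h1, derivTerm, iteratedDeriv_zero, inv_normFactor, h4, neg_pow z]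
  have := hf (ν * Δ)
  field_simp

theorem f1Int_eval (hν : 0 < ν) (h : ν ≤ ν * Δ) (hc : -1 < c) (hc' : c < 0) (hτ : 0 < τ)
    (hz0 : z ≠ 0) (hz : ‖z‖ ≤ 1) :
    RightLoopConverges (meijerIntegrand 1 3 (aPar Δ ν) (bPar ν) z) c τ ∧
      f1Int Δ ν c τ z = (normFactor Δ ν)⁻¹ * alphaStar Δ ν z := by
  have hsin : Real.sin (Real.pi * -c) ≠ 0 := by
    rw [mul_neg, Real.sin_neg]; exact neg_ne_zero.2 (sin_pi_mul_abscissa_ne_zero hc hc')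
  have hL : 0 ≤ (-branchLog z).re := by
    rw [Complex.neg_re, branchLog_re, neg_nonneg]
    exact Real.log_nonpos (norm_nonneg _) hz
  have hE : ∀ s ∈ loopGrid (-c) τ,
      (-1) ^ (ν * Δ) * (normFactor Δ ν)⁻¹ * rightIntegrand Δ ν (-branchLog z) s =
      meijerIntegrand 1 3 (aPar Δ ν) (bPar ν) z (-s) := fun s hs => by
    have hs0 : Complex.sin (Real.pi * -s) ≠ 0 := by
      rw [mul_neg, Complex.sin_neg]
      exact neg_ne_zero.2 (sin_pi_mul_ne_zero_of_mem hτ hsin hs)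
    rw [(meijerIntegrand_eq z h hs0).1, rightIntegrand, mul_neg (Real.pi : ℂ), Complex.sin_neg,
      neg_div, neg_sq, sub_neg_eq_add, neg_mul_comm]
  refine ⟨rightLoopConverges_of_left
    (((rightIntegrand_loop hν h hsin hτ hL).1.const_mul _).congr hτ hE), ?_⟩
  rw [f1Int, meijerGRight, rightLoopIntegral_eq, ← leftLoopIntegral_congr hτ hE,
    leftLoopIntegral_const_mul,
    leftLoopIntegral_rightIntegrand hν h (neg_pos.2 hc') hsin hτ hL]
  have hk : ∀ k : ℕ, Complex.exp (-(ν + k : ℕ) * -branchLog z) = z ^ ν * z ^ k := fun k => by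
    rw [neg_mul_neg, Complex.exp_nat_mul, exp_branchLog hz0, pow_add]
  have hsum : ∑ k ∈ Finset.range (ν * Δ + 1), alphaCoeff Δ ν k *
      Complex.exp (-(ν + k : ℕ) * -branchLog z) =
      z ^ ν * ∑ k ∈ Finset.range (ν * Δ + 1), alphaCoeff Δ ν k * z ^ k := by
    rw [Finset.mul_sum]
    refine Finset.sum_congr rfl fun k _ => ?_
    rw [hk]; ring
  rw [hsum, alphaStar, starPoly, neg_pow z, mul_add ν, mul_one, pow_add]
  have hpi : (Real.pi : ℂ) ≠ 0 := Complex.ofReal_ne_zero.2 Real.pi_ne_zero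
  have := Complex.I_ne_zero
  have hsq : ((-1 : ℂ) ^ (ν * Δ)) * (-1) ^ (ν * Δ) = 1 := by rw [← mul_pow]; norm_num
  field_simp
  linear_combination (normFactor Δ ν)⁻¹ *
    (∑ k ∈ Finset.range (ν * Δ + 1), alphaCoeff Δ ν k * z ^ k) * hsq

end evaluation

/-! ### Properties of the polynomial `f₁` -/

/-- The polynomial `K⁻¹ α^*`, with rational coefficients. -/
noncomputable def f1Poly (Δ ν : ℕ) : Polynomial ℚ :=
  Polynomial.C ((((ν * (Δ - 1)).factorial : ℚ) / ((ν * Δ).factorial : ℚ)) ^ 3) *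
    (-Polynomial.X) ^ ν * ∑ k ∈ Finset.range (ν * Δ + 1), Polynomial.C ((-1) ^ (ν + ν * Δ + k) *
      ((ν * Δ).choose k : ℚ) ^ 3 * ((ν * Δ + k).choose (ν * Δ - ν) : ℚ) ^ 3) * Polynomial.X ^ k

theorem aeval_f1Poly (Δ ν : ℕ) (z : ℂ) :
    Polynomial.aeval z (f1Poly Δ ν) = (normFactor Δ ν)⁻¹ * alphaStar Δ ν z := by
  rw [inv_normFactor, f1Poly, alphaStar, starPoly, Nat.mul_sub_one]
  simp only [map_mul, map_pow, map_neg, map_sum, Polynomial.aeval_X, Polynomial.aeval_C, map_div₀,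
    map_natCast, map_one, alphaCoeff]
  ring

theorem f1_explicit (Δ ν : ℕ) (z : ℂ) : (normFactor Δ ν)⁻¹ * alphaStar Δ ν z =
    (((ν * (Δ - 1)).factorial : ℂ) / ((ν * Δ).factorial : ℂ)) ^ 3 * z ^ ν * (-1) ^ (ν * Δ) *
      ∑ k ∈ Finset.range (ν * Δ + 1), (-z) ^ k * ((ν * Δ).choose k : ℂ) ^ 3 *
        ((ν * Δ + k).choose (ν * (Δ - 1)) : ℂ) ^ 3 := by
  rw [inv_normFactor, alphaStar, starPoly, Nat.mul_sub_one, neg_pow z ν]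
  simp only [Finset.mul_sum]
  refine Finset.sum_congr rfl fun k _ => ?_
  have hsq : ((-1 : ℂ) ^ ν) * (-1) ^ ν = 1 := by rw [← mul_pow]; norm_num
  rw [alphaCoeff, neg_pow z k, pow_add, pow_add]
  linear_combination (((ν * Δ - ν).factorial : ℂ) / ((ν * Δ).factorial : ℂ)) ^ 3 * z ^ ν *
    (-1) ^ (ν * Δ) * (-1) ^ k * z ^ k * ((ν * Δ).choose k : ℂ) ^ 3 *
        ((ν * Δ + k).choose (ν * Δ - ν) : ℂ) ^ 3 * hsq

/-- An entire function is determined by its values on the punctured unit disc. -/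
theorem eq_of_eq_on_punctured_disc {F G : ℂ → ℂ} (hF : Differentiable ℂ F)
    (hG : Differentiable ℂ G) (h : ∀ z : ℂ, z ≠ 0 → ‖z‖ ≤ 1 → F z = G z) : F = G := by
  refine AnalyticOnNhd.eq_of_frequently_eq (z₀ := 0)
    (fun z _ => hF.analyticAt z) (fun z _ => hG.analyticAt z) (Eventually.frequently ?_)
  filter_upwards [self_mem_nhdsWithin,
    nhdsWithin_le_nhds (Metric.closedBall_mem_nhds (0 : ℂ) one_pos)] with z hz hz1
  exact h z hz (by simpa using hz1)

end MeijerAux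
namespace MeijerAux
open Set Filter Topology MeasureTheory

/-! ### Polylogarithmic forms -/

theorem norm_polylogTerm_le {n : ℕ} (hn : 2 ≤ n) {w : ℂ} (hw : ‖w‖ ≤ 1) (k : ℕ) :
    ‖polylogTerm n w k‖ ≤ (((k + 1 : ℕ) : ℝ) ^ 2)⁻¹ := by
  rw [polylogTerm, norm_div, norm_pow, norm_pow, Complex.norm_natCast, div_eq_mul_inv]
  calc ‖w‖ ^ (k + 1) * (((k + 1 : ℕ) : ℝ) ^ n)⁻¹ ≤ 1 * (((k + 1 : ℕ) : ℝ) ^ 2)⁻¹ := by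
        gcongr
        · exact pow_le_one₀ (norm_nonneg _) hw
        · simp
    _ = _ := one_mul _

theorem summable_inv_succ_sq : Summable fun k : ℕ => (((k + 1 : ℕ) : ℝ) ^ 2)⁻¹ :=
  (summable_nat_add_iff 1).2 (Real.summable_nat_pow_inv.2 one_lt_two)

theorem summable_polylogTerm {n : ℕ} (hn : 2 ≤ n) {w : ℂ} (hw : ‖w‖ ≤ 1) :
    Summable (polylogTerm n w) :=
  Summable.of_norm_bounded summable_inv_succ_sq (norm_polylogTerm_le hn hw)

theorem hasSum_polylogTerm {n : ℕ} (hn : 2 ≤ n) {w : ℂ} (hw : ‖w‖ ≤ 1) :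
    HasSum (polylogTerm n w) (polylog n w) := (summable_polylogTerm hn hw).hasSum

theorem continuousOn_polylog {n : ℕ} (hn : 2 ≤ n) :
    ContinuousOn (polylog n) {w : ℂ | ‖w‖ ≤ 1} := by
  unfold polylog
  refine continuousOn_tsum (fun k => ?_) summable_inv_succ_sq
    fun k w hw => norm_polylogTerm_le hn hw k
  unfold polylogTerm
  fun_prop

theorem hasSum_polylogTerm_one {w : ℂ} (hw : ‖w‖ < 1) :
    HasSum (polylogTerm 1 w) (-Complex.log (1 - w)) := by
  have h := (hasSum_nat_add_iff' 1).2 (Complex.hasSum_taylorSeries_neg_log hw)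
  simp only [Finset.range_one, Finset.sum_singleton, Nat.cast_zero, div_zero, sub_zero] at h
  exact h.congr_fun fun k => by rw [polylogTerm, pow_one]

section forms

variable {Δ ν : ℕ} {z : ℂ}

/-- Shifting the summation index by `k` turns `∑ z^{-t} (t + k)^{-n}` into `z^k` times a tail of
the polylogarithm series. -/
theorem hasSum_inv_add_pow (hz : z ≠ 0) {n : ℕ} {P : ℂ} (hP : HasSum (polylogTerm n z⁻¹) P)
    (ν k : ℕ) :
    HasSum (fun i : ℕ => (z ^ (ν + 1 + i))⁻¹ * ((((ν + 1 + i : ℕ) : ℂ) + k) ^ n)⁻¹)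
      (z ^ k * (P - ∑ t ∈ Finset.Icc 1 (k + ν), (z ^ t)⁻¹ * ((t : ℂ) ^ n)⁻¹)) := by
  have h := ((hasSum_nat_add_iff' (k + ν)).2 hP).mul_left (z ^ k)
  have h1 : ∑ t ∈ Finset.Icc 1 (k + ν), (z ^ t)⁻¹ * ((t : ℂ) ^ n)⁻¹ =
      ∑ i ∈ Finset.range (k + ν), polylogTerm n z⁻¹ i := by
    have h2 : Finset.Icc 1 (k + ν) = Finset.Ico 1 (k + ν + 1) := by
      ext x; simp only [Finset.mem_Icc, Finset.mem_Ico]; omega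
    rw [h2, Finset.sum_Ico_eq_sum_range]
    refine Finset.sum_congr rfl fun i _ => ?_
    rw [polylogTerm, inv_pow, div_eq_mul_inv, add_comm 1 i]
  rw [h1]
  refine h.congr_fun fun i => ?_
  have h3 : i + (k + ν) + 1 = k + (ν + 1 + i) := by ring
  rw [polylogTerm, h3, inv_pow, pow_add z k, mul_inv, div_eq_mul_inv, ← mul_assoc, ← mul_assoc,
    mul_inv_cancel₀ (pow_ne_zero _ hz), one_mul]
  push_cast
  rw [add_comm (k : ℂ)]

theorem hasSum_fracSum (hz : z ≠ 0) {n : ℕ} {P : ℂ} (hP : HasSum (polylogTerm n z⁻¹) P)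
    (e : ℕ → ℂ) :
    HasSum (fun i : ℕ => (-z) ^ ν * ((z ^ (ν + 1 + i))⁻¹ *
        fracSum Δ ν e n ((ν + 1 + i : ℕ) : ℂ)))
      (starPoly Δ ν e z * P - finSum Δ ν e n z) := by
  have h := (hasSum_sum (s := Finset.range (ν * Δ + 1)) fun k _ =>
    (hasSum_inv_add_pow hz hP ν k).mul_left (e k)).mul_left ((-z) ^ ν)
  convert! h using 1
  · funext i
    simp only [fracSum, Finset.mul_sum]
    refine Finset.sum_congr rfl fun k _ => ?_
    ring
  · rw [starPoly, finSum, mul_assoc, ← mul_sub, Finset.sum_mul, ← Finset.sum_sub_distrib]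
    congr 1
    refine Finset.sum_congr rfl fun k _ => ?_
    ring

theorem finSum_const_mul (a : ℂ) (e : ℕ → ℂ) (n : ℕ) :
    finSum Δ ν (fun k => a * e k) n z = a * finSum Δ ν e n z := by
  simp only [finSum, Finset.mul_sum]
  refine Finset.sum_congr rfl fun k _ => ?_
  refine Finset.sum_congr rfl fun t _ => ?_
  ring

theorem natCast_re_pos (i : ℕ) : 0 < ((ν + 1 + i : ℕ) : ℂ).re := by
  rw [Complex.natCast_re]; positivity

theorem norm_inv_le_one (hz : 1 ≤ ‖z‖) : ‖z⁻¹‖ ≤ 1 := by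
  rw [norm_inv]; exact inv_le_one_of_one_le₀ hz

theorem derivSeries_one_eq (h : ν ≤ ν * Δ) (hz : 1 ≤ ‖z‖) :
    (-z) ^ ν * derivSeries Δ ν 1 (ν + 1) z =
      -(3 * alphaStar Δ ν z * polylog 4 z⁻¹ + 2 * betaStar Δ ν z * polylog 3 z⁻¹
        + gammaStar Δ ν z * polylog 2 z⁻¹ - psiStar Δ ν z) := by
  have hz0 : z ≠ 0 := norm_pos_iff.1 (by linarith)
  have hs := fun e n (hn : 2 ≤ n) => hasSum_fracSum (Δ := Δ) (ν := ν) hz0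
    (hasSum_polylogTerm hn (norm_inv_le_one hz)) e
  have h1 := (((hs (alphaCoeff Δ ν) 4 (by norm_num)).mul_left (-3)).sub
    ((hs (betaCoeff Δ ν) 3 (by norm_num)).mul_left 2)).sub (hs (gammaCoeff Δ ν) 2 le_rfl)
  rw [derivSeries, ← tsum_mul_left]
  refine HasSum.tsum_eq ?_
  convert! h1 using 1
  · funext i
    have := cubeDeriv_one h _ (natCast_re_pos (ν := ν) i)
    rw [cubeDeriv] at this
    rw [derivTerm, this]; ring
  · rw [psiStar, finSum_const_mul, finSum_const_mul, alphaStar, betaStar, gammaStar]; ring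

theorem derivSeries_two_eq (h : ν ≤ ν * Δ) (hz : 1 ≤ ‖z‖) :
    (-z) ^ ν * derivSeries Δ ν 2 (ν + 1) z =
      2 * (6 * alphaStar Δ ν z * polylog 5 z⁻¹ + 3 * betaStar Δ ν z * polylog 4 z⁻¹
        + gammaStar Δ ν z * polylog 3 z⁻¹ - xiStar Δ ν z) := by
  have hz0 : z ≠ 0 := norm_pos_iff.1 (by linarith)
  have hs := fun e n (hn : 2 ≤ n) => hasSum_fracSum (Δ := Δ) (ν := ν) hz0
    (hasSum_polylogTerm hn (norm_inv_le_one hz)) e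
  have h1 := (((hs (alphaCoeff Δ ν) 5 (by norm_num)).mul_left 12).add
    ((hs (betaCoeff Δ ν) 4 (by norm_num)).mul_left 6)).add
    ((hs (gammaCoeff Δ ν) 3 (by norm_num)).mul_left 2)
  rw [derivSeries, ← tsum_mul_left]
  refine HasSum.tsum_eq ?_
  convert! h1 using 1
  · funext i
    have := cubeDeriv_two h _ (natCast_re_pos (ν := ν) i)
    rw [cubeDeriv] at this
    rw [derivTerm, this]; ring
  · rw [xiStar, finSum_const_mul, finSum_const_mul, alphaStar, betaStar, gammaStar]; ring

theorem derivSeries_zero_eq_of_one_lt (h : ν ≤ ν * Δ) (hz : 1 < ‖z‖) :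
    (-z) ^ ν * derivSeries Δ ν 0 (ν + 1) z =
      alphaStar Δ ν z * polylog 3 z⁻¹ + betaStar Δ ν z * polylog 2 z⁻¹
        + gammaStar Δ ν z * (-Complex.log (1 - 1 / z)) - phiStar Δ ν z := by
  have hz0 : z ≠ 0 := norm_pos_iff.1 (by linarith)
  have hs := fun e n (hn : 2 ≤ n) => hasSum_fracSum (Δ := Δ) (ν := ν) hz0
    (hasSum_polylogTerm hn (norm_inv_le_one hz.le)) e
  have hlog := hasSum_fracSum (Δ := Δ) (ν := ν) hz0
    (hasSum_polylogTerm_one (w := z⁻¹) (by rw [norm_inv]; exact inv_lt_one_of_one_lt₀ hz))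
    (gammaCoeff Δ ν)
  have h1 := ((hs (alphaCoeff Δ ν) 3 (by norm_num)).add (hs (betaCoeff Δ ν) 2 le_rfl)).add hlog
  rw [derivSeries, ← tsum_mul_left]
  refine HasSum.tsum_eq ?_
  convert! h1 using 1
  · funext i
    have := cubeDeriv_zero h _ (natCast_re_pos (ν := ν) i)
    rw [cubeDeriv] at this
    rw [derivTerm, this]; ring
  · rw [phiStar, alphaStar, betaStar, gammaStar, one_div]; ring

theorem gammaStar_one (hν : 0 < ν) (h : ν ≤ ν * Δ) : gammaStar Δ ν 1 = 0 := by
  simp [gammaStar, starPoly, sum_gammaCoeff hν h]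

theorem continuousAt_mul_clog_zero : ContinuousAt (fun x : ℂ => x * Complex.log x) 0 := by
  rw [ContinuousAt, zero_mul]
  have h1 : Tendsto (fun x : ℂ => |‖x‖ * Real.log ‖x‖| + ‖x‖ * Real.pi) (𝓝 0) (𝓝 0) := by
    have hc : Continuous fun x : ℂ => |‖x‖ * Real.log ‖x‖| + ‖x‖ * Real.pi :=
      (Real.continuous_mul_log.comp continuous_norm).abs.add (continuous_norm.mul_const _)
    simpa using hc.tendsto 0
  refine squeeze_zero_norm (fun x => ?_) h1
  rw [norm_mul, abs_mul, abs_of_nonneg (norm_nonneg x), ← mul_add]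
  refine mul_le_mul_of_nonneg_left ?_ (norm_nonneg _)
  refine (Complex.norm_le_abs_re_add_abs_im _).trans ?_
  rw [Complex.log_re, Complex.log_im]
  gcongr
  exact Complex.abs_arg_le_pi x

theorem continuous_starPoly (Δ ν : ℕ) (e : ℕ → ℂ) : Continuous (starPoly Δ ν e) := by
  unfold starPoly; fun_prop

/-- The zero of `γ^*` at `1` beats the logarithmic singularity. -/
theorem continuousAt_gammaStar_mul_log (hν : 0 < ν) (h : ν ≤ ν * Δ) (hz : 1 ≤ ‖z‖) :
    ContinuousAt (fun z => gammaStar Δ ν z * (-Complex.log (1 - 1 / z))) z := by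
  have hz0 : z ≠ 0 := norm_pos_iff.1 (by linarith)
  have hw : ContinuousAt (fun z : ℂ => 1 - 1 / z) z :=
    continuousAt_const.sub (continuousAt_const.div continuousAt_id hz0)
  by_cases h1 : z = 1
  · subst h1
    have hd : DifferentiableAt ℂ (gammaStar Δ ν) 1 := by
      unfold gammaStar starPoly; fun_prop
    have hc : ContinuousAt (fun z : ℂ => dslope (gammaStar Δ ν) 1 z * -z *
        ((1 - 1 / z) * Complex.log (1 - 1 / z))) 1 := by
      refine ((continuousAt_dslope_same.2 hd).mul continuousAt_id.neg).mul ?_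
      refine ContinuousAt.comp (f := fun z : ℂ => 1 - 1 / z)
        (g := fun x : ℂ => x * Complex.log x) ?_ hw
      simpa using continuousAt_mul_clog_zero
    refine hc.congr ?_
    filter_upwards [eventually_ne_nhds one_ne_zero] with z hz
    have h2 := sub_smul_dslope (gammaStar Δ ν) 1 z
    rw [gammaStar_one hν h, sub_zero, smul_eq_mul] at h2
    rw [← h2]
    field_simp
  · have hsl : 1 - 1 / z ∈ Complex.slitPlane := by
      rw [one_div]
      have hle := norm_inv_le_one hz
      have hre := (Complex.re_le_norm z⁻¹).trans hle
      rcases hre.lt_or_eq with h2 | h2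
      · left; simpa using h2
      · right
        intro h3
        have him : z⁻¹.im = 0 := by simpa using h3
        apply h1
        rw [← inv_inj, inv_one]
        exact Complex.ext (by simpa using h2) (by simpa using him)
    exact ((continuous_starPoly Δ ν _).continuousAt).mul (hw.clog hsl).neg

theorem continuousOn_derivSeries_zero (hν : 0 < ν) (h : ν ≤ ν * Δ) :
    ContinuousOn (derivSeries Δ ν 0 (ν + 1)) {z : ℂ | 1 ≤ ‖z‖} := by
  unfold derivSeries
  have hs := (summable_derivTerm hν h (z := 1) (by simp) (j := 0) (by norm_num) (ν + 1)).norm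
  refine continuousOn_tsum (fun i => ?_) hs fun i z hz => ?_
  · unfold derivTerm
    refine ContinuousOn.mul (ContinuousOn.inv₀ (by fun_prop) fun z hz => ?_) continuousOn_const
    have hz : 1 ≤ ‖z‖ := hz
    exact pow_ne_zero _ (norm_pos_iff.1 (by linarith))
  · simp only [derivTerm, one_pow, inv_one, one_mul]
    rw [norm_mul, norm_inv, norm_pow]
    exact mul_le_of_le_one_left (norm_nonneg _) (inv_le_one_of_one_le₀ (one_le_pow₀ hz))

theorem continuousAt_finSum (e : ℕ → ℂ) (n : ℕ) (hz : z ≠ 0) :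
    ContinuousAt (finSum Δ ν e n) z := by
  unfold finSum
  refine ContinuousAt.mul (by fun_prop) ?_
  refine tendsto_finsetSum _ fun k _ => ContinuousAt.mul (by fun_prop) ?_
  refine tendsto_finsetSum _ fun t _ => ContinuousAt.mul ?_ continuousAt_const
  exact ContinuousAt.inv₀ (by fun_prop) (pow_ne_zero _ hz)

/-- On the unit circle the identity follows by continuity from the outside. -/
theorem derivSeries_zero_eq (hν : 0 < ν) (h : ν ≤ ν * Δ) (hz : 1 ≤ ‖z‖) :
    (-z) ^ ν * derivSeries Δ ν 0 (ν + 1) z =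
      alphaStar Δ ν z * polylog 3 z⁻¹ + betaStar Δ ν z * polylog 2 z⁻¹
        + gammaStar Δ ν z * (-Complex.log (1 - 1 / z)) - phiStar Δ ν z := by
  have hz0 : z ≠ 0 := norm_pos_iff.1 (by linarith)
  have hinv : ContinuousWithinAt (fun z : ℂ => z⁻¹) {z : ℂ | 1 ≤ ‖z‖} z :=
    (continuousAt_inv₀ hz0).continuousWithinAt
  have hpl : ∀ n, 2 ≤ n → ContinuousWithinAt (fun z => polylog n z⁻¹) {z : ℂ | 1 ≤ ‖z‖} z :=
    fun n hn => (continuousOn_polylog hn _ (norm_inv_le_one hz)).comp hinv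
      fun w hw => norm_inv_le_one hw
  have hl : ContinuousWithinAt (fun z => (-z) ^ ν * derivSeries Δ ν 0 (ν + 1) z)
      {z : ℂ | 1 ≤ ‖z‖} z :=
    ContinuousWithinAt.mul (by fun_prop) (continuousOn_derivSeries_zero hν h z hz)
  have hr : ContinuousWithinAt (fun z => alphaStar Δ ν z * polylog 3 z⁻¹
      + betaStar Δ ν z * polylog 2 z⁻¹ + gammaStar Δ ν z * (-Complex.log (1 - 1 / z))
      - phiStar Δ ν z) {z : ℂ | 1 ≤ ‖z‖} z := by
    have hsp := fun e => (continuous_starPoly Δ ν e).continuousWithinAt (s := {z : ℂ | 1 ≤ ‖z‖})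
      (x := z)
    refine ((((hsp _).mul (hpl 3 (by norm_num))).add ((hsp _).mul (hpl 2 le_rfl))).add
      (continuousAt_gammaStar_mul_log hν h hz).continuousWithinAt).sub ?_
    exact (((continuousAt_finSum _ _ hz0).add (continuousAt_finSum _ _ hz0)).add
      (continuousAt_finSum _ _ hz0)).continuousWithinAt
  have hray : Tendsto (fun r : ℝ => (r : ℂ) * z) (𝓝[>] 1) (𝓝[{z : ℂ | 1 ≤ ‖z‖}] z) := by
    refine tendsto_nhdsWithin_iff.2 ⟨?_, ?_⟩
    · have hc : Continuous fun r : ℝ => (r : ℂ) * z := by fun_prop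
      simpa using (hc.tendsto 1).mono_left nhdsWithin_le_nhds
    · filter_upwards [self_mem_nhdsWithin] with r hr
      have hr : 1 < r := hr
      change 1 ≤ ‖(r : ℂ) * z‖
      rw [norm_mul, Complex.norm_real, Real.norm_of_nonneg (by linarith)]
      nlinarith
  refine tendsto_nhds_unique (hl.tendsto.comp hray) ((hr.tendsto.comp hray).congr' ?_)
  filter_upwards [self_mem_nhdsWithin] with r hr
  have hr : 1 < r := hr
  refine (derivSeries_zero_eq_of_one_lt h ?_).symm
  rw [norm_mul, Complex.norm_real, Real.norm_of_nonneg (by linarith)]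
  nlinarith

end forms

end MeijerAux

theorem mainTheorem3 (Δ ν : ℕ) (hΔ : 1 < Δ) (hν : 0 < ν)
    (c τ : ℝ) (hc : -1 < c) (hc' : c < 0) (hτ : 0 < τ) :
    -- the function `f₁`: its integral on `0 < |z| ≤ 1`, and its continuation `F` to the plane
    (∀ z : ℂ, z ≠ 0 → ‖z‖ ≤ 1 →
      MeijerAux.RightLoopConverges
        (MeijerAux.meijerIntegrand 1 3 (MeijerAux.aPar Δ ν) (MeijerAux.bPar ν) z) c τ) ∧
    (∃ F : ℂ → ℂ, Differentiable ℂ F ∧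
      (∀ z : ℂ, z ≠ 0 → ‖z‖ ≤ 1 → F z = MeijerAux.f1Int Δ ν c τ z) ∧
      (∀ F' : ℂ → ℂ, Differentiable ℂ F' →
        (∀ z : ℂ, z ≠ 0 → ‖z‖ ≤ 1 → F' z = MeijerAux.f1Int Δ ν c τ z) → F' = F) ∧
      (∃ P : Polynomial ℚ, ∀ z : ℂ, F z = Polynomial.aeval z P) ∧
      (∀ z : ℂ, F z =
        (((ν * (Δ - 1)).factorial : ℂ) / ((ν * Δ).factorial : ℂ)) ^ 3 * z ^ ν * (-1) ^ (ν * Δ) *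
          ∑ k ∈ Finset.range (ν * Δ + 1), (-z) ^ k * ((ν * Δ).choose k : ℂ) ^ 3 *
            ((ν * Δ + k).choose (ν * (Δ - 1)) : ℂ) ^ 3) ∧
      (∀ z : ℂ, MeijerAux.normFactor Δ ν * F z = MeijerAux.alphaStar Δ ν z)) ∧
    -- the partial fraction expansion of `R₀³`
    (∀ t : ℂ, (∀ k ∈ Finset.range (ν * Δ + 1), t ≠ -(k : ℂ)) →
      MeijerAux.R0 Δ ν t ^ 3 =
        ∑ k ∈ Finset.range (ν * Δ + 1), MeijerAux.alphaCoeff Δ ν k * ((t + k) ^ 3)⁻¹ +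
        ∑ k ∈ Finset.range (ν * Δ + 1), MeijerAux.betaCoeff Δ ν k * ((t + k) ^ 2)⁻¹ +
        ∑ k ∈ Finset.range (ν * Δ + 1), MeijerAux.gammaCoeff Δ ν k * (t + k)⁻¹) ∧
    (∀ k ∈ Finset.range (ν * Δ + 1),
      Filter.Tendsto
        (fun t : ℂ => deriv (fun u : ℂ => MeijerAux.R0 Δ ν u ^ 3 * (u + k) ^ 3) t)
        (nhdsWithin (-(k : ℂ)) {-(k : ℂ)}ᶜ) (nhds (MeijerAux.betaCoeff Δ ν k))) ∧
    MeijerAux.gammaStar Δ ν 1 = 0 ∧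
    -- the functions `f₂, …, f₆`
    (∀ z : ℂ, 1 ≤ ‖z‖ → 0 < z.re →
      -- convergence
      MeijerAux.LeftLoopConverges
        (MeijerAux.meijerIntegrand 4 3 (MeijerAux.aPar Δ ν) (MeijerAux.bPar ν) (-z)) c τ ∧
      MeijerAux.LeftLoopConverges
        (MeijerAux.meijerIntegrand 5 3 (MeijerAux.aPar Δ ν) (MeijerAux.bPar ν) z) c τ ∧
      MeijerAux.LeftLoopConverges
        (MeijerAux.meijerIntegrand 6 3 (MeijerAux.aPar Δ ν) (MeijerAux.bPar ν) (-z)) c τ ∧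
      (∀ j ≤ 2, ∀ N : ℕ, Summable fun k : ℕ => MeijerAux.derivTerm Δ ν j z (N + k)) ∧
      (∀ n ≥ 2, Summable (MeijerAux.polylogTerm n z⁻¹)) ∧
      -- evaluation of `f₂`
      HasSum (fun k : ℕ => (-1) ^ ν * (z ^ (1 + ν * (Δ - 1) + k))⁻¹ *
          ((∏ j ∈ Finset.Icc 1 (ν * Δ - ν), ((1 : ℂ) + ν * Δ - ν + k - j)) /
            ∏ j ∈ Finset.range (ν * Δ + 1), ((1 : ℂ) + ν * Δ + k + j)) ^ 3)
        (MeijerAux.f2 Δ ν c τ z) ∧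
      MeijerAux.normFactor Δ ν * MeijerAux.f2 Δ ν c τ z =
        (-z) ^ ν * MeijerAux.derivSeries Δ ν 0 (ν * Δ + 1) z ∧
      MeijerAux.normFactor Δ ν * MeijerAux.f2 Δ ν c τ z =
        (-z) ^ ν * MeijerAux.derivSeries Δ ν 0 (ν + 1) z ∧
      -- evaluation of `f₃` and `f₄`
      MeijerAux.f3 Δ ν c τ z = MeijerAux.f2 Δ ν c τ z * MeijerAux.branchLog z
        - (MeijerAux.normFactor Δ ν)⁻¹ * (-z) ^ ν * MeijerAux.derivSeries Δ ν 1 (ν + 1) z ∧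
      MeijerAux.f3 Δ ν c τ z =
        MeijerAux.f2 Δ ν c τ z * MeijerAux.branchLog z + MeijerAux.f4 Δ ν z ∧
      MeijerAux.normFactor Δ ν * MeijerAux.f4 Δ ν z =
        -(-z) ^ ν * MeijerAux.derivSeries Δ ν 1 (ν + 1) z ∧
      -- evaluation of `f₅^∨`, `f₅` and `f₆`
      MeijerAux.f5Vee Δ ν c τ z =
        1 / 2 * MeijerAux.f2 Δ ν c τ z * (MeijerAux.branchLog (-z) ^ 2 + (Real.pi : ℂ) ^ 2)
        + MeijerAux.f4 Δ ν z * MeijerAux.branchLog (-z)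
        + 1 / 2 * (-z) ^ ν * (MeijerAux.normFactor Δ ν)⁻¹ *
            MeijerAux.derivSeries Δ ν 2 (ν * Δ + 1) z ∧
      MeijerAux.f5Vee Δ ν c τ z =
        1 / 2 * MeijerAux.f2 Δ ν c τ z * MeijerAux.branchLog z ^ 2
        + MeijerAux.f4 Δ ν z * MeijerAux.branchLog z
        + 1 / 2 * (-z) ^ ν * (MeijerAux.normFactor Δ ν)⁻¹ *
            MeijerAux.derivSeries Δ ν 2 (ν * Δ + 1) z
        - Real.pi * Complex.I * MeijerAux.f3 Δ ν c τ z ∧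
      MeijerAux.f5Vee Δ ν c τ z =
        1 / 2 * MeijerAux.f2 Δ ν c τ z * MeijerAux.branchLog z ^ 2
        + MeijerAux.f4 Δ ν z * MeijerAux.branchLog z
        + 1 / 2 * (-z) ^ ν * (MeijerAux.normFactor Δ ν)⁻¹ *
            MeijerAux.derivSeries Δ ν 2 (ν + 1) z
        - Real.pi * Complex.I * MeijerAux.f3 Δ ν c τ z ∧
      MeijerAux.f5 Δ ν c τ z =
        MeijerAux.f5Vee Δ ν c τ z + Complex.I * Real.pi * MeijerAux.f3 Δ ν c τ z ∧
      -- the polylogarithmic forms of `f₂^*`, `f₄^*` and `f₆^*`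
      MeijerAux.normFactor Δ ν * MeijerAux.f2 Δ ν c τ z =
        MeijerAux.alphaStar Δ ν z * MeijerAux.polylog 3 z⁻¹
        + MeijerAux.betaStar Δ ν z * MeijerAux.polylog 2 z⁻¹
        + MeijerAux.gammaStar Δ ν z * (-Complex.log (1 - 1 / z))
        - MeijerAux.phiStar Δ ν z ∧
      MeijerAux.normFactor Δ ν * MeijerAux.f4 Δ ν z =
        3 * MeijerAux.alphaStar Δ ν z * MeijerAux.polylog 4 z⁻¹
        + 2 * MeijerAux.betaStar Δ ν z * MeijerAux.polylog 3 z⁻¹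
        + MeijerAux.gammaStar Δ ν z * MeijerAux.polylog 2 z⁻¹
        - MeijerAux.psiStar Δ ν z ∧
      MeijerAux.normFactor Δ ν * MeijerAux.f6 Δ ν z =
        6 * MeijerAux.alphaStar Δ ν z * MeijerAux.polylog 5 z⁻¹
        + 3 * MeijerAux.betaStar Δ ν z * MeijerAux.polylog 4 z⁻¹
        + MeijerAux.gammaStar Δ ν z * MeijerAux.polylog 3 z⁻¹
        - MeijerAux.xiStar Δ ν z) := by
  have h : ν ≤ ν * Δ := Nat.le_mul_of_pos_right ν (by omega)
  have hK := MeijerAux.normFactor_ne_zero Δ ν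
  have hdiff : Differentiable ℂ fun z =>
      (MeijerAux.normFactor Δ ν)⁻¹ * MeijerAux.alphaStar Δ ν z := by
    unfold MeijerAux.alphaStar MeijerAux.starPoly
    fun_prop
  have hf1 := fun z (hz0 : z ≠ 0) hz => MeijerAux.f1Int_eval hν h hc hc' hτ (z := z) hz0 hz
  refine ⟨fun z hz0 hz => (hf1 z hz0 hz).1, ⟨_, hdiff, fun z hz0 hz => (hf1 z hz0 hz).2.symm,
    fun F' hF' hF'' => MeijerAux.eq_of_eq_on_punctured_disc hF' hdiff fun z hz0 hz => ?_,
    ⟨MeijerAux.f1Poly Δ ν, fun z => (MeijerAux.aeval_f1Poly Δ ν z).symm⟩,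
    MeijerAux.f1_explicit Δ ν, fun z => mul_inv_cancel_left₀ hK _⟩, fun t ht => ?_,
    fun k hk => MeijerAux.tendsto_deriv_betaCoeff h hk, MeijerAux.gammaStar_one hν h,
    fun z hz hre => ?_⟩
  · rw [hF'' z hz0 hz, (hf1 z hz0 hz).2]
  · rw [MeijerAux.R0_cube h ht]
    simp only [MeijerAux.fracSum, pow_one]
  · have h2 := MeijerAux.f2_eval hν h hc hc' hτ hz hre
    have h3 := MeijerAux.f3_eval hν h hc hc' hτ hz hre
    have h4 := MeijerAux.f4_eval hν h hz (z := z)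
    have h5 := MeijerAux.f5Vee_eval hν h hc hc' hτ hz hre
    have hs := fun j (hj : j ≤ 2) => MeijerAux.derivSeries_eq hν h hz hj
    have h2' : MeijerAux.normFactor Δ ν * MeijerAux.f2 Δ ν c τ z =
        (-z) ^ ν * MeijerAux.derivSeries Δ ν 0 (ν + 1) z := by
      rw [h2.2, mul_assoc, mul_inv_cancel_left₀ hK]
    have h4' : MeijerAux.normFactor Δ ν * MeijerAux.f4 Δ ν z =
        -(-z) ^ ν * MeijerAux.derivSeries Δ ν 1 (ν + 1) z := by
      rw [h4, neg_mul, neg_mul, mul_neg, mul_assoc, mul_inv_cancel_left₀ hK, neg_mul]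
    have h6' : MeijerAux.normFactor Δ ν * MeijerAux.f6 Δ ν z =
        1 / 2 * ((-z) ^ ν * MeijerAux.derivSeries Δ ν 2 (ν + 1) z) := by
      rw [MeijerAux.f6]; field_simp
    have h5' : MeijerAux.f5Vee Δ ν c τ z =
        1 / 2 * MeijerAux.f2 Δ ν c τ z * MeijerAux.branchLog z ^ 2
        + MeijerAux.f4 Δ ν z * MeijerAux.branchLog z
        + 1 / 2 * (-z) ^ ν * (MeijerAux.normFactor Δ ν)⁻¹ *
            MeijerAux.derivSeries Δ ν 2 (ν + 1) z
        - Real.pi * Complex.I * MeijerAux.f3 Δ ν c τ z := by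
      rw [h5.2, h3.2, MeijerAux.branchLog_neg hre]
      linear_combination 1 / 2 * MeijerAux.f2 Δ ν c τ z * (Real.pi : ℂ) ^ 2 * Complex.I_sq
    refine ⟨h2.1, h3.1, h5.1, fun j hj N => MeijerAux.summable_derivTerm hν h hz hj N,
      fun n hn => MeijerAux.summable_polylogTerm hn (MeijerAux.norm_inv_le_one hz),
      MeijerAux.f2_hasSum hν h hc hc' hτ hz hre, ?_, h2', ?_, h3.2, h4', ?_, ?_, h5', ?_, ?_, ?_,
      ?_⟩
    · rw [h2', hs 0 (by norm_num)]
    · rw [h3.2, h4]; ring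
    · rw [h5.2, hs 2 le_rfl]
    · rw [h5', hs 2 le_rfl]
    · rw [h5', MeijerAux.f5, MeijerAux.f6]; ring
    · rw [h2', MeijerAux.derivSeries_zero_eq hν h hz]
    · rw [h4', neg_mul, MeijerAux.derivSeries_one_eq h hz, neg_neg]
    · rw [h6', MeijerAux.derivSeries_two_eq h hz]; ring
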